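/- Let $n\ge 3$ be odd, let $m$ be an integer coprime to $n$, put $\eta=\pi m/n$, and let the chain length $N\ge 0$ be a multiple of $n$. For $\mu=(\mu_1,\dots,\mu_N)\in\mathbb C^N$ let $$T_{6v}(\lambda)=\operatorname{Tr}\prod_{i=1}^N\mathcal L(\mu_i+\lambda),\qquad \mathcal L(\lambda)=\begin{pmatrix}\sin(\lambda+\eta)&&&\\&\sin(\lambda-\eta)&\sin2\eta&\\&\sin2\eta&\sin(\lambda-\eta)&\\&&&\sin(\lambda+\eta)\end{pmatrix}$$ be the 6-vertex model transfer matrix with inhomogeneities $\mu_i$, acting in $H=(\mathbb C^2)^{\otimes N}$ (the trace is over the two-dimensional quantum space), and let $T_0(\lambda)=\operatorname{Tr}\prod_{i=1}^N\mathcal L_0(\mu_i+\lambda)$ be the transfer matrix on $H$ built in the same way from the $(n-1)$-th symmetric power $\mathcal L_0$ of $\mathcal L$, normalized so that its blocks $\mathcal A_0,\mathcal B_0,\mathcal C_0,\mathcal D_0$ act in an $n$-dimensional space with generating vector $\Omega_0$: $\mathcal C_0(\lambda)\Omega_0=0$, $\mathcal A_0(\lambda)\Omega_0=\sin\lambda\,\Omega_0$,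 $\mathcal D_0(\lambda)\Omega_0=\sin(\lambda+2\eta)\,\Omega_0$. The chain is homogeneous if all $\mu_i$ are equal. Then, for every $\mu$, the naked vacuum $(1,0)\otimes\dots\otimes(1,0)$ is an eigenvector of $T_{6v}(\lambda)$ and of $T_0(\lambda)$ for all $\lambda$, with eigenvalues $\Lambda_\mu(\lambda)$ and $w_{0,\mu}(\lambda)$. Let $E_\mu=\{v\in H: T_{6v}(\lambda)v=\Lambda_\mu(\lambda)v\text{ for all }\lambda\}$ be the eigenspace of the 6-vertex transfer matrix that contains it; $T_0(\lambda)$ acts in $E_\mu$ as the scalar $w_{0,\mu}(\lambda)$. Let $K_\mu$ be the number of simple zeros of $w_{0,\mu}$ that are mutually different modulo $\pi/n$. (1) For the homogeneous chain, $K_\mu=N/n$, and the degeneracy $\dim E_\mu$ is divisible by $2^{N/n}$. (2) For the inhomogeneous chain, $K_\mu=N/n$ for all $\mu$ in a dense open subset of $\mathbb C^N$, and whenever $K_\mu=N/n$ the degeneracy $\dim E_\mu$ is divisible by $2^{N/n}$. -/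

import Mathlib

namespace SixVertex

/-- An `L`-operator value: a `2 × 2` matrix `[[A, B], [C, D]]` whose entries are operators on a
`d`-dimensional space. -/
abbrev LOperator (d : ℕ) : Type := Matrix (Fin 2) (Fin 2) (Matrix (Fin d) (Fin d) ℂ)

/-- The `L`-operator of the 6-vertex model with coupling constant `η`, i.e. the `4 × 4` matrix with
weights `sin (z + η)`, `sin (z - η)`, `sin 2η`, split into `2 × 2` blocks. -/
noncomputable def sixVertexL (η z : ℂ) : LOperator 2 :=
  !![!![Complex.sin (z + η), 0; 0, Complex.sin (z - η)],
      !![0, 0; Complex.sin (2 * η), 0];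
     !![0, Complex.sin (2 * η); 0, 0],
      !![Complex.sin (z - η), 0; 0, Complex.sin (z + η)]]

/-- The `(n - 1)`-th symmetric power of the 6-vertex `L`-operator for `η = π m / n`, acting in
dimension `n`. With the basis vectors numbered `0, …, n - 1`, the vector number `0` is the
generating vector `Ω`: `C Ω = 0`, `A Ω = sin z • Ω`, `D Ω = sin (z + 2η) • Ω`. The nonzero entries
of `B` and `C` are `B (k, k-1)` and `C (k-1, k)`, `1 ≤ k ≤ n - 1`, with
`B (k, k-1) * C (k-1, k) = sin (2kη) * sin (2(n-k)η)`; the way this product is distributed between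
the two factors is a choice of normalization of the basis vectors. -/
noncomputable def symPowerL (n : ℕ) (η z : ℂ) : LOperator n :=
  !![Matrix.diagonal fun k => Complex.sin (z - 2 * (k : ℕ) * η),
      Matrix.of fun i j =>
        if (i : ℕ) = (j : ℕ) + 1 then Complex.sin (2 * (i : ℕ) * η) else 0;
     Matrix.of fun i j =>
        if (j : ℕ) = (i : ℕ) + 1 then Complex.sin (2 * ((n : ℂ) - (j : ℕ)) * η) else 0,
      Matrix.diagonal fun k => Complex.sin (z + 2 * ((k : ℕ) + 1) * η)]

/-- The transfer matrix `T(z) = Tr ∏ᵢ L(μᵢ + z)` with inhomogeneities `μ`. The trace is over the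
`d`-dimensional space; the operator acts in the `N`-fold tensor product of the two-dimensional
spaces, whose standard basis is indexed by `Fin N → Fin 2`. -/
noncomputable def transferMatrix {d N : ℕ} (L : ℂ → LOperator d) (μ : Fin N → ℂ) (z : ℂ) :
    Matrix (Fin N → Fin 2) (Fin N → Fin 2) ℂ :=
  Matrix.of fun s t => ((List.ofFn fun i => L (μ i + z) (s i) (t i)).prod).trace

/-- The naked vacuum `(1,0) ⊗ ⋯ ⊗ (1,0)`. -/
def nakedVacuum (N : ℕ) : (Fin N → Fin 2) → ℂ :=
  fun s => ∏ i, (![1, 0] : Fin 2 → ℂ) (s i)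

/-- The eigenspace of a family `T(z)` of operators for an eigenvalue `Λ(z)`, which is a function of
`z`: the vectors `v` with `T(z) v = Λ(z) v` for all `z`. -/
def eigenspaceOf {ι : Type*} [Fintype ι] (T : ℂ → Matrix ι ι ℂ) (Λ : ℂ → ℂ) :
    Submodule ℂ (ι → ℂ) where
  carrier := {v | ∀ z, (T z).mulVec v = Λ z • v}
  zero_mem' := by intro z; simp
  add_mem' := by intro v w hv hw z; rw [Matrix.mulVec_add, hv z, hw z, smul_add]
  smul_mem' := by intro c v hv z; rw [Matrix.mulVec_smul, hv z, smul_comm]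

/-- The number of simple zeros of `w` that are mutually different modulo `π / n`. -/
noncomputable def numSimpleZeros (n : ℕ) (w : ℂ → ℂ) : ℕ∞ :=
  ((fun z : ℂ => (z : ℂ ⧸ AddSubgroup.zmultiples ((Real.pi : ℂ) / (n : ℂ)))) ''
    {z : ℂ | analyticOrderAt w z = 1}).encard

end SixVertex

/-!
Write `T` for the 6-vertex transfer matrix, `T₀` for that of the `(n - 1)`-th symmetric power, `E`
for the eigenspace of `T` that contains the naked vacuum, and `w₀` for the vacuum eigenvalue of
`T₀`. Every simple zero of `w₀` modulo `π / n` produces an involution of `E`, these involutions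
commute, and each of them halves the space in a way that the others respect.

*The scalar `w₀`.* Fusion expresses the transfer matrices of the symmetric powers recursively
through `T` and scalars (`transferMatrix_fusL_mul`), so on `E` they act by their vacuum eigenvalues
(`transferMatrix_fusL_mulVec`).

*The involutions.* At `η = π m / n` the symmetric power is the point `c = d = 0` of a family `cycT`
of cyclic representations of dimension `n`, in which a further parameter `ξ` becomes irrelevant at
that point. The whole family commutes with `T` (`cycT_comm_sixVertex`) and therefore acts in `E`. A
diagonal gauge transformation interchanges the two zeros of the quantum determinant of one member
(`cycT_swap`), and after a discrete Fourier transform another one exchanges a zero between two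
members of a product (`cycY_exchange`). Combining them, a product of two members can be written with
the spectral parameters in the opposite order, at the expense of changes of `ξ` and `c`
(`cycT_refactor`); close to `d = 0` the change of `c` is of second order (`exists_cycT_refactor`).

Let `z` be a zero of `w₀`. Then `T₀` vanishes on `E` at `z`, and the derivative `cycD` of `cycT` at
that point in the direction of `d` becomes the leading term. The relations above give to leading
order:

* `cycD` at `z` squares to `w₀'(z) ^ 2` on `E` (`cycD_mul_self`);
* at zeros that differ modulo `π / n` these operators commute (`cycD_comm`);
* they change sign under `ξ ↦ ξ + π`, as `n` is odd (`cycD_add_pi`).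

At a simple zero `cycD` is thus a multiple of an involution. Its trace is an integer that depends
continuously on `ξ` and changes sign along a path, so it is zero, and the two eigenspaces have equal
dimension. Induction over the zeros gives the divisibility (`two_pow_dvd_finrank`,
`two_pow_dvd_finrank_eigenspaceOf`).

*The number of simple zeros.* In the variable `X = e ^ {2inz}` the function `w₀` is, up to an
invertible factor, the polynomial `zeroPoly` of degree `N / n` with nonzero constant term: of the
product of the vacuum weights only the powers of `e ^ {2iz}` divisible by `n` survive. So there are
`N / n` simple zeros if and only if the resultant of this polynomial and its derivative does not
vanish. The resultant is a holomorphic function of the inhomogeneities, and its nonvanishing is an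
open condition, which is dense as soon as it holds at one point (`dense_setOf_ne_zero`). The
homogeneous chain provides such points: there, after a shift of `z`, the polynomial is
`∑ choose N (n l) X ^ l` up to a factor, and a positivity argument with an antisymmetric form that
is propagated by Pascal's rule (`antisymm_pos_of_pascal`) excludes nonreal and multiple zeros
(`contract_binomial_simple`).
-/

namespace SixVertex

set_option linter.unusedSectionVars false

open scoped Kronecker

/-! ### Traces of products of matrix blocks along the chain -/

section ChainTrace

variable {κ κ' κ₁ κ₂ : Type*} [Fintype κ] [DecidableEq κ] [Fintype κ'] [DecidableEq κ']
  [Fintype κ₁] [DecidableEq κ₁] [Fintype κ₂] [DecidableEq κ₂] {N : ℕ}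

/-- `2 × 2` blocks of operators on an auxiliary space with basis `κ`. This extends `LOperator` to
auxiliary spaces with an arbitrary finite index type. -/
abbrev Block (κ : Type*) : Type _ := Matrix (Fin 2) (Fin 2) (Matrix κ κ ℂ)

/-- The operator on the chain obtained by multiplying the blocks `W i` along the auxiliary space and
taking the trace over it. -/
def chainTrace (W : Fin N → Block κ) : Matrix (Fin N → Fin 2) (Fin N → Fin 2) ℂ :=
  Matrix.of fun s t => (List.ofFn fun i => W i (s i) (t i)).prod.trace

theorem transferMatrix_eq_chainTrace {d : ℕ} (L : ℂ → LOperator d) (μ : Fin N → ℂ) (z : ℂ) :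
    transferMatrix L μ z = chainTrace fun i => L (μ i + z) := rfl

theorem prod_ofFn_sum {R α : Type*} [Semiring R] [Fintype α] :
    ∀ {N : ℕ} (f : Fin N → α → R), (List.ofFn fun i => ∑ a, f i a).prod =
      ∑ r : Fin N → α, (List.ofFn fun i => f i (r i)).prod
  | 0, f => by simp
  | N + 1, f => by
    rw [List.ofFn_succ, List.prod_cons, prod_ofFn_sum (fun i => f i.succ), Finset.sum_mul_sum,
      ← (Fin.consEquiv fun _ => α).sum_comp, Fintype.sum_prod_type]
    simp [Fin.consEquiv, List.ofFn_succ]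

theorem prod_ofFn_kronecker : ∀ {N : ℕ} (f : Fin N → Matrix κ κ ℂ) (g : Fin N → Matrix κ' κ' ℂ),
    (List.ofFn fun i => f i ⊗ₖ g i).prod = (List.ofFn f).prod ⊗ₖ (List.ofFn g).prod
  | 0, f, g => by simp
  | N + 1, f, g => by
    simp only [List.ofFn_succ, List.prod_cons]
    rw [prod_ofFn_kronecker (fun i => f i.succ) (fun i => g i.succ), Matrix.mul_kronecker_mul]

/-- The product of two operators on the chain is built from the products of the blocks, with the
tensor product as auxiliary space. -/
theorem chainTrace_mul (W : Fin N → Block κ) (V : Fin N → Block κ') :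
    chainTrace W * chainTrace V =
      chainTrace fun i => Matrix.of fun s t => ∑ r, W i s r ⊗ₖ V i r t := by
  ext s t
  simp only [chainTrace, Matrix.mul_apply, Matrix.of_apply]
  rw [prod_ofFn_sum (fun i r => W i (s i) r ⊗ₖ V i r (t i)), Matrix.trace_sum]
  refine Finset.sum_congr rfl fun r _ => ?_
  rw [prod_ofFn_kronecker, Matrix.trace_kronecker]

/-- The product in the opposite order, with the auxiliary spaces kept in place. -/
theorem chainTrace_mul' (W : Fin N → Block κ) (V : Fin N → Block κ') :
    chainTrace V * chainTrace W =
      chainTrace fun i => Matrix.of fun s t => ∑ r, W i r t ⊗ₖ V i s r := by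
  ext s t
  simp only [chainTrace, Matrix.mul_apply, Matrix.of_apply]
  rw [prod_ofFn_sum (fun i r => W i r (t i) ⊗ₖ V i (s i) r), Matrix.trace_sum]
  refine Finset.sum_congr rfl fun r _ => ?_
  rw [prod_ofFn_kronecker, Matrix.trace_kronecker, mul_comm]

theorem prod_ofFn_intertwine (P : Matrix κ' κ ℂ) : ∀ {N : ℕ} (f : Fin N → Matrix κ κ ℂ)
    (g : Fin N → Matrix κ' κ' ℂ), (∀ i, g i * P = P * f i) →
      (List.ofFn g).prod * P = P * (List.ofFn f).prod
  | 0, f, g, _ => by simp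
  | N + 1, f, g, h => by
    simp only [List.ofFn_succ, List.prod_cons]
    rw [Matrix.mul_assoc, prod_ofFn_intertwine P (fun i => f i.succ) (fun i => g i.succ)
      (fun i => h i.succ), ← Matrix.mul_assoc, h 0, Matrix.mul_assoc]

/-- Blocks that are conjugate by an operator on the auxiliary space, the same for all sites, give
the same operator on the chain. -/
theorem chainTrace_eq_of_intertwine {W : Fin N → Block κ} {W' : Fin N → Block κ'}
    (P : Matrix κ' κ ℂ) (P' : Matrix κ κ' ℂ) (h₁ : P' * P = 1) (h₂ : P * P' = 1)
    (h : ∀ i s t, W' i s t * P = P * W i s t) : chainTrace W' = chainTrace W := by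
  ext s t
  simp only [chainTrace, Matrix.of_apply]
  have key := prod_ofFn_intertwine P (fun i => W i (s i) (t i)) (fun i => W' i (s i) (t i))
    fun i => h i _ _
  calc _ = ((List.ofFn fun i => W' i (s i) (t i)).prod * P * P').trace := by
        rw [Matrix.mul_assoc, h₂, Matrix.mul_one]
    _ = _ := by rw [key, Matrix.trace_mul_comm, ← Matrix.mul_assoc, h₁, Matrix.one_mul]

theorem chainTrace_smul (c : Fin N → ℂ) (W : Fin N → Block κ) :
    (chainTrace fun i => Matrix.of fun s t => c i • W i s t) = (∏ i, c i) • chainTrace W := by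
  have key : ∀ {N : ℕ} (c : Fin N → ℂ) (f : Fin N → Matrix κ κ ℂ),
      (List.ofFn fun i => c i • f i).prod = (∏ i, c i) • (List.ofFn f).prod := by
    intro N
    induction N with
    | zero => intro c f; simp
    | succ N ih =>
      intro c f
      simp only [List.ofFn_succ, List.prod_cons]
      rw [ih (fun i => c i.succ) (fun i => f i.succ), Fin.prod_univ_succ, Matrix.smul_mul,
        Matrix.mul_smul, smul_smul]
  ext s t
  simp only [chainTrace, Matrix.of_apply, Matrix.smul_apply]
  rw [key c (fun i => W i (s i) (t i)), Matrix.trace_smul]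

/-- Block triangular decomposition: if the auxiliary space is an extension of `κ₁` by `κ₂` that is
respected by all blocks, the operator on the chain is the sum of those of the two pieces. -/
theorem chainTrace_eq_add {W : Fin N → Block κ} {W₁ : Fin N → Block κ₁} {W₂ : Fin N → Block κ₂}
    (π : Matrix κ₁ κ ℂ) (ρ : Matrix κ κ₁ ℂ) (σ : Matrix κ κ₂ ℂ) (τ : Matrix κ₂ κ ℂ)
    (hπ : π * ρ = 1) (hσ : τ * σ = 1) (hsum : ρ * π + σ * τ = 1)
    (h₁ : ∀ i s t, W₁ i s t * π = π * W i s t) (h₂ : ∀ i s t, W i s t * σ = σ * W₂ i s t) :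
    chainTrace W = chainTrace W₁ + chainTrace W₂ := by
  ext s t
  simp only [chainTrace, Matrix.of_apply, Matrix.add_apply]
  have k₁ := prod_ofFn_intertwine π (fun i => W i (s i) (t i)) (fun i => W₁ i (s i) (t i))
    fun i => h₁ i _ _
  have k₂ := prod_ofFn_intertwine σ (fun i => W₂ i (s i) (t i)) (fun i => W i (s i) (t i))
    fun i => h₂ i _ _
  generalize (List.ofFn fun i => W i (s i) (t i)).prod = A at *
  generalize (List.ofFn fun i => W₁ i (s i) (t i)).prod = A₁ at *
  generalize (List.ofFn fun i => W₂ i (s i) (t i)).prod = A₂ at *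
  calc A.trace = (A * (ρ * π + σ * τ)).trace := by rw [hsum, Matrix.mul_one]
    _ = (A * ρ * π).trace + (A * σ * τ).trace := by
      rw [Matrix.mul_add, Matrix.trace_add, Matrix.mul_assoc, Matrix.mul_assoc]
    _ = (π * A * ρ).trace + (τ * (A * σ)).trace := by
      rw [Matrix.trace_mul_comm (A * ρ), Matrix.trace_mul_comm (A * σ), Matrix.mul_assoc]
    _ = _ := by
      rw [← k₁, k₂, Matrix.mul_assoc, hπ, Matrix.mul_one, ← Matrix.mul_assoc, hσ, Matrix.one_mul]

end ChainTrace

/-! ### Arithmetic of the cyclic group -/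

section Cyclic

variable {n : ℕ} [NeZero n]

theorem ZMod_prod_eq_range (F : ZMod n → ℂ) :
    ∏ k, F k = ∏ a ∈ Finset.range n, F (a : ZMod n) := by
  symm
  refine Finset.prod_bij (fun a _ => (a : ZMod n)) (fun _ _ => Finset.mem_univ _) ?_ ?_
    (fun _ _ => rfl)
  · intro a ha b hb h
    rw [Finset.mem_range] at ha hb
    have := congrArg ZMod.val h
    rwa [ZMod.val_natCast_of_lt ha, ZMod.val_natCast_of_lt hb] at this
  · intro k _
    exact ⟨k.val, Finset.mem_range.2 (ZMod.val_lt k), ZMod.natCast_zmod_val k⟩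

/-- A nowhere vanishing multiplicative cocycle on the cyclic group is a coboundary as soon as its
product over the group is `1`. -/
theorem exists_gauge (F : ZMod n → ℂ) (hF : ∀ k, F k ≠ 0) (hprod : ∏ k, F k = 1) :
    ∃ Y : ZMod n → ℂ, (∀ k, Y k ≠ 0) ∧ ∀ k, Y (k + 1) = Y k * F k := by
  let G : ℕ → ℂ := fun m => ∏ a ∈ Finset.range m, F (a : ZMod n)
  have hper : ∀ m, G (m + n) = G m := by
    intro m
    induction m with
    | zero => simpa [G, ZMod_prod_eq_range] using hprod
    | succ m ih =>
      have : G (m + 1 + n) = G (m + n) * F ((m + n : ℕ) : ZMod n) := by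
        rw [show m + 1 + n = (m + n) + 1 by ring]
        exact Finset.prod_range_succ _ _
      rw [this, ih]
      have h2 : G (m + 1) = G m * F (m : ZMod n) := Finset.prod_range_succ _ _
      rw [h2]; simp
  have hmod : ∀ m, G (m % n) = G m := by
    intro m
    have : ∀ j r, G (r + n * j) = G r := by
      intro j
      induction j with
      | zero => simp
      | succ j ih => intro r; rw [Nat.mul_succ, ← add_assoc, hper, ih]
    conv_rhs => rw [← Nat.mod_add_div m n]
    rw [this]
  refine ⟨fun k => G k.val, fun k => Finset.prod_ne_zero_iff.2 fun a _ => hF _, fun k => ?_⟩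
  have h1 : (k + 1).val = (k.val + 1) % n := by
    rw [ZMod.val_add, ZMod.val_one_eq_one_mod, Nat.add_mod_mod]
  have h2 : G (k.val + 1) = G k.val * F (k.val : ZMod n) := Finset.prod_range_succ _ _
  simp only [h1, hmod, h2, ZMod.natCast_zmod_val]

/-- The same for the step `-2`, which generates the cyclic group of odd order. -/
theorem exists_gauge_two (hodd : Odd n) (F : ZMod n → ℂ) (hF : ∀ k, F k ≠ 0)
    (hprod : ∏ k, F k = 1) :
    ∃ Y : ZMod n → ℂ, (∀ k, Y k ≠ 0) ∧ ∀ k, Y (k - 2) = Y k * F k := by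
  obtain ⟨u, hu⟩ : IsUnit (2 : ZMod n) := by
    have := (ZMod.isUnit_iff_coprime 2 n).2 (Nat.coprime_two_left.2 hodd)
    exact_mod_cast this
  obtain ⟨Y, hY, hstep⟩ := exists_gauge (fun i => F (-((u : ZMod n) * i)))
    (fun _ => hF _) (by
      rw [← hprod]
      exact Fintype.prod_equiv ((Units.mulLeft u).trans (Equiv.neg (ZMod n))) _ _ fun i => rfl)
  refine ⟨fun j => Y (-((↑u⁻¹ : ZMod n) * j)), fun _ => hY _, fun k => ?_⟩
  have : -((↑u⁻¹ : ZMod n) * (k - 2)) = -((↑u⁻¹ : ZMod n) * k) + 1 := by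
    rw [mul_sub, ← hu, Units.inv_mul]; ring
  simp only [this, hstep]
  rw [mul_neg, neg_neg, Units.mul_inv_cancel_left]

variable {η : ℂ}

/-- The angle `2kη` attached to a residue `k`. -/
noncomputable def angle (η : ℂ) (k : ZMod n) : ℂ := 2 * (k.val : ℂ) * η

/-- The character `k ↦ exp (2ikη)` of the cyclic group, for `exp (2iη)` an `n`-th root of unity. -/
noncomputable def chi (η : ℂ) (k : ZMod n) : ℂ := Complex.exp (angle η k * Complex.I)

theorem chi_eq_pow (k : ZMod n) : chi η k = Complex.exp (2 * η * Complex.I) ^ k.val := by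
  rw [chi, angle, ← Complex.exp_nat_mul]; ring_nf

theorem chi_ne_zero (k : ZMod n) : chi η k ≠ 0 := Complex.exp_ne_zero _

variable (hq : IsPrimitiveRoot (Complex.exp (2 * η * Complex.I)) n)

include hq in
theorem chi_natCast (a : ℕ) : chi η (a : ZMod n) = Complex.exp (2 * η * Complex.I) ^ a := by
  rw [chi_eq_pow, ZMod.val_natCast, ← pow_eq_pow_mod a hq.pow_eq_one]

include hq in
theorem chi_add (j k : ZMod n) : chi η (j + k) = chi η j * chi η k := by
  rw [← ZMod.natCast_zmod_val j, ← ZMod.natCast_zmod_val k, ← Nat.cast_add, chi_natCast hq,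
    chi_natCast hq, chi_natCast hq, pow_add]

theorem chi_zero : chi η (0 : ZMod n) = 1 := by simp [chi, angle]

include hq in
theorem chi_neg (k : ZMod n) : chi η (-k) = (chi η k)⁻¹ := by
  apply eq_inv_of_mul_eq_one_left
  rw [← chi_add hq, neg_add_cancel, chi_zero]

include hq in
theorem chi_sub (j k : ZMod n) : chi η (j - k) = chi η j * (chi η k)⁻¹ := by
  rw [sub_eq_add_neg, chi_add hq, chi_neg hq]

include hq in
theorem chi_one : chi η (1 : ZMod n) = Complex.exp (2 * η * Complex.I) := by
  simpa using chi_natCast hq 1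

theorem sin_add_angle (w : ℂ) (k : ZMod n) : Complex.sin (w + angle η k) =
    ((Complex.exp (w * Complex.I))⁻¹ * (chi η k)⁻¹ - Complex.exp (w * Complex.I) * chi η k) *
      Complex.I / 2 := by
  rw [Complex.sin, chi, ← Complex.exp_neg, ← Complex.exp_neg, ← Complex.exp_add, ← Complex.exp_add]
  ring_nf

include hq in
theorem prod_one_sub_mul_chi (r : ℂ) : ∏ k : ZMod n, (1 - r * chi η k) = 1 - r ^ n := by
  have h := hq.pow_sub_pow_eq_prod_sub_mul 1 r (NeZero.pos n)
  rw [one_pow] at h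
  rw [h]
  symm
  classical
  have him : Polynomial.nthRootsFinset n (1 : ℂ) =
      Finset.univ.image (fun k : ZMod n => chi η k) := by
    symm
    apply Finset.eq_of_subset_of_card_le
    · intro x hx
      obtain ⟨k, -, rfl⟩ := Finset.mem_image.1 hx
      rw [Polynomial.mem_nthRootsFinset (NeZero.pos n), chi_eq_pow, ← pow_mul, mul_comm k.val, pow_mul,
        hq.pow_eq_one, one_pow]
    · rw [hq.card_nthRootsFinset, Finset.card_image_of_injective, Finset.card_univ, ZMod.card]
      intro j k h
      simp only [chi_eq_pow] at h
      exact ZMod.val_injective n (hq.pow_inj (ZMod.val_lt j) (ZMod.val_lt k) h)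
  rw [him, Finset.prod_image]
  · simp [mul_comm]
  · intro j _ k _ h
    simp only [chi_eq_pow] at h
    exact ZMod.val_injective n (hq.pow_inj (ZMod.val_lt j) (ZMod.val_lt k) h)

include hq in
/-- The multiple angle formula for the product of the sines of shifted angles. -/
theorem exists_prod_sin (hodd : Odd n) : ∃ K : ℂ, K ≠ 0 ∧
    ∀ a : ℂ, ∏ k : ZMod n, Complex.sin (a + angle η k) = K * Complex.sin (n * a) := by
  have hI : Complex.I ≠ 0 := Complex.I_ne_zero
  refine ⟨(∏ k : ZMod n, ((chi η k)⁻¹ * Complex.I / 2)) * (2 / Complex.I), ?_, fun a => ?_⟩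
  · refine mul_ne_zero (Finset.prod_ne_zero_iff.2 fun k _ => ?_) (by simp)
    have := chi_ne_zero (η := η) k
    simp [this]
  have h2 : ∏ k : ZMod n, (1 - Complex.exp (2 * a * Complex.I) * chi η (2 * k)) =
      1 - Complex.exp (2 * a * Complex.I) ^ n := by
    rw [← prod_one_sub_mul_chi hq]
    obtain ⟨u, hu⟩ : IsUnit (2 : ZMod n) := by
      have := (ZMod.isUnit_iff_coprime 2 n).2 (Nat.coprime_two_left.2 hodd)
      exact_mod_cast this
    exact Fintype.prod_equiv (Units.mulLeft u) _ _ fun k => by rw [← hu]; rfl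
  have h3 : ∀ k : ZMod n, Complex.sin (a + angle η k) = ((chi η k)⁻¹ * Complex.I / 2) *
      ((Complex.exp (a * Complex.I))⁻¹ *
        (1 - Complex.exp (2 * a * Complex.I) * chi η (2 * k))) := by
    intro k
    have e1 : Complex.exp (2 * a * Complex.I) = Complex.exp (a * Complex.I) ^ 2 := by
      rw [← Complex.exp_nat_mul]; ring_nf
    rw [sin_add_angle, two_mul k, chi_add hq, e1]
    have := chi_ne_zero (η := η) k
    have := Complex.exp_ne_zero (a * Complex.I)
    field_simp
  rw [Finset.prod_congr rfl fun k _ => h3 k, Finset.prod_mul_distrib, Finset.prod_mul_distrib, h2,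
    Finset.prod_const, Finset.card_univ, ZMod.card]
  have e2 : Complex.exp (2 * a * Complex.I) ^ n = Complex.exp (a * Complex.I) ^ n *
      Complex.exp (a * Complex.I) ^ n := by
    rw [← mul_pow, ← Complex.exp_add]; ring_nf
  have e3 : Complex.sin (n * a) = ((Complex.exp (a * Complex.I) ^ n)⁻¹ -
      Complex.exp (a * Complex.I) ^ n) * Complex.I / 2 := by
    rw [Complex.sin, ← Complex.exp_nat_mul, ← Complex.exp_neg]; ring_nf
  have := pow_ne_zero n (Complex.exp_ne_zero (a * Complex.I))
  rw [e2, e3, inv_pow]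
  generalize ∏ k : ZMod n, ((chi η k)⁻¹ * Complex.I / 2) = K
  field_simp

include hq in
theorem sin_add_angle_ne_zero (hodd : Odd n) {a : ℂ} (ha : Complex.sin (n * a) ≠ 0) (k : ZMod n) :
    Complex.sin (a + angle η k) ≠ 0 := by
  obtain ⟨K, hK, h⟩ := exists_prod_sin hq hodd
  have := h a ▸ mul_ne_zero hK ha
  exact Finset.prod_ne_zero_iff.1 this k (Finset.mem_univ _)

include hq in
theorem sum_chi_mul (j : ZMod n) : ∑ k : ZMod n, chi η (j * k) = if j = 0 then (n : ℂ) else 0 := by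
  have hc := Fact.mk hq
  let ψ : AddChar (ZMod n) ℂ := AddChar.zmodChar n hq.pow_eq_one
  have hψ : ∀ k, ψ k = chi η k := fun k => by
    rw [chi_eq_pow]; exact AddChar.zmodChar_apply hq.pow_eq_one k
  have := AddChar.sum_mulShift j (AddChar.zmodChar_primitive_of_primitive_root n hq)
  rw [ZMod.card] at this
  convert this using 2
  · rw [← hψ, mul_comm]
  · simp

end Cyclic

/-! ### The cyclic deformation of the symmetric power -/

section CyclicL

variable {n : ℕ} [NeZero n]

/-- The cyclic raising operator with weights `b`. -/
def raise (b : ZMod n → ℂ) : Matrix (ZMod n) (ZMod n) ℂ :=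
  Matrix.of fun i j => if i = j + 1 then b i else 0

/-- The cyclic lowering operator with weights `c`. -/
def lower (c : ZMod n → ℂ) : Matrix (ZMod n) (ZMod n) ℂ :=
  Matrix.of fun i j => if j = i + 1 then c j else 0

theorem diagonal_mul_raise (f b : ZMod n → ℂ) :
    Matrix.diagonal f * raise b = raise fun k => f k * b k := by
  ext i j; simp [raise, Matrix.diagonal_mul]

theorem raise_mul_diagonal (f b : ZMod n → ℂ) :
    raise b * Matrix.diagonal f = raise fun k => b k * f (k - 1) := by
  ext i j
  simp only [raise, Matrix.mul_diagonal, Matrix.of_apply, ite_mul, zero_mul]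
  split_ifs with h
  · rw [h, add_sub_cancel_right]
  · rfl

theorem diagonal_mul_lower (f c : ZMod n → ℂ) :
    Matrix.diagonal f * lower c = lower fun k => f (k - 1) * c k := by
  ext i j
  simp only [lower, Matrix.diagonal_mul, Matrix.of_apply, mul_ite, mul_zero]
  split_ifs with h
  · rw [h, add_sub_cancel_right]
  · rfl

theorem lower_mul_diagonal (f c : ZMod n → ℂ) :
    lower c * Matrix.diagonal f = lower fun k => c k * f k := by
  ext i j; simp [lower, Matrix.mul_diagonal]

theorem raise_mul_lower (b c : ZMod n → ℂ) :
    raise b * lower c = Matrix.diagonal fun k => b k * c k := by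
  ext i j
  simp only [raise, lower, Matrix.mul_apply, Matrix.of_apply, Matrix.diagonal_apply]
  rw [Finset.sum_eq_single (i - 1)]
  · by_cases h : i = j
    · simp [h]
    · simp [h, Ne.symm h]
  · intro k _ hk
    rw [if_neg, zero_mul]
    rintro rfl
    simp at hk
  · simp

theorem lower_mul_raise (b c : ZMod n → ℂ) :
    lower c * raise b = Matrix.diagonal fun k => c (k + 1) * b (k + 1) := by
  ext i j
  simp only [raise, lower, Matrix.mul_apply, Matrix.of_apply, Matrix.diagonal_apply]
  rw [Finset.sum_eq_single (i + 1)]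
  · by_cases h : i = j
    · simp [h]
    · simp [h]
  · intro k _ hk
    simp [hk]
  · simp

theorem smul_raise (a : ℂ) (b : ZMod n → ℂ) : a • raise b = raise fun k => a * b k := by
  ext i j; simp [raise]

theorem smul_lower (a : ℂ) (b : ZMod n → ℂ) : a • lower b = lower fun k => a * b k := by
  ext i j; simp [lower]

theorem raise_add (b c : ZMod n → ℂ) : raise b + raise c = raise fun k => b k + c k := by
  ext i j; simp only [raise, Matrix.add_apply, Matrix.of_apply]; split_ifs <;> simp

theorem lower_add (b c : ZMod n → ℂ) : lower b + lower c = lower fun k => b k + c k := by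
  ext i j; simp only [lower, Matrix.add_apply, Matrix.of_apply]; split_ifs <;> simp

theorem smul_diagonal' (a : ℂ) (b : ZMod n → ℂ) :
    a • Matrix.diagonal b = Matrix.diagonal fun k => a * b k := by
  ext i j; simp [Matrix.diagonal_apply]

/-- The `L`-operator of the cyclic representations of dimension `n`. The parameter `ξ` distributes
the weights between raising and lowering operators, `c` shifts the weights and `d` splits the two
factors `sin (z + d)` and `sin (z - d)` of the quantum determinant. At `c = d = 0` the corner
entries vanish and the symmetric power is recovered. -/
noncomputable def cycL (n : ℕ) [NeZero n] (η ξ c d z : ℂ) : Block (ZMod n) :=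
  !![Matrix.diagonal fun k => Complex.sin (z - c - angle η k),
      raise fun k => Complex.exp (ξ * Complex.I) * Complex.sin (c + d + angle η k);
     lower fun k => -(Complex.exp (ξ * Complex.I))⁻¹ * Complex.sin (c - d + angle η k),
      Matrix.diagonal fun k => Complex.sin (z + c + 2 * η + angle η k)]

/-- The transfer matrix of the cyclic representation. -/
noncomputable def cycT (n : ℕ) [NeZero n] {N : ℕ} (η : ℂ) (μ : Fin N → ℂ) (ξ c d z : ℂ) :
    Matrix (Fin N → Fin 2) (Fin N → Fin 2) ℂ :=
  chainTrace fun i => cycL n η ξ c d (μ i + z)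

variable {η : ℂ} (hq : IsPrimitiveRoot (Complex.exp (2 * η * Complex.I)) n)

theorem sin_eq_exp (w : ℂ) : Complex.sin w =
    ((Complex.exp (w * Complex.I))⁻¹ - Complex.exp (w * Complex.I)) * Complex.I / 2 := by
  rw [Complex.sin, ← Complex.exp_neg]; ring_nf

theorem expI_add (a b : ℂ) : Complex.exp ((a + b) * Complex.I) =
    Complex.exp (a * Complex.I) * Complex.exp (b * Complex.I) := by
  rw [add_mul, Complex.exp_add]

theorem expI_sub (a b : ℂ) : Complex.exp ((a - b) * Complex.I) =
    Complex.exp (a * Complex.I) * (Complex.exp (b * Complex.I))⁻¹ := by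
  rw [sub_mul, Complex.exp_sub, div_eq_mul_inv]

theorem expI_neg (a : ℂ) : Complex.exp (-a * Complex.I) = (Complex.exp (a * Complex.I))⁻¹ := by
  rw [neg_mul, Complex.exp_neg]

theorem expI_two (a : ℂ) : Complex.exp (2 * a * Complex.I) =
    Complex.exp (a * Complex.I) * Complex.exp (a * Complex.I) := by
  rw [← Complex.exp_add]; ring_nf

theorem expI_angle (k : ZMod n) : Complex.exp (angle η k * Complex.I) = chi η k := rfl

include hq in
/-- The Yang–Baxter relation between the cyclic and the 6-vertex `L`-operators. -/
theorem cycL_rll (ξ c d z z' : ℂ) (s t α β : Fin 2) :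
    ∑ γ, ∑ r, sixVertexL η z' r t γ β • (cycL n η ξ c d (z - z' + η) α γ * cycL n η ξ c d z s r) =
    ∑ γ, ∑ r, sixVertexL η z' s r α γ • (cycL n η ξ c d z r t * cycL n η ξ c d (z - z' + η) γ β) := by
  have hη := Complex.exp_ne_zero (η * Complex.I)
  have hz := Complex.exp_ne_zero (z * Complex.I)
  have hz' := Complex.exp_ne_zero (z' * Complex.I)
  have hc := Complex.exp_ne_zero (c * Complex.I)
  have hd := Complex.exp_ne_zero (d * Complex.I)
  have hξ := Complex.exp_ne_zero (ξ * Complex.I)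
  fin_cases s <;> fin_cases t <;> fin_cases α <;> fin_cases β <;>
  simp [sixVertexL, cycL, Fin.sum_univ_two, diagonal_mul_raise, raise_mul_diagonal,
    diagonal_mul_lower, lower_mul_diagonal, raise_mul_lower, lower_mul_raise, smul_raise,
    smul_lower, raise_add, lower_add, smul_diagonal', -mul_eq_mul_left_iff,
    -mul_eq_mul_right_iff, -neg_mul] <;>
  (try first
    | (intro k; ring1)
    | (first | (congr 1; funext k) | intro k
       have hk := chi_ne_zero (η := η) k
       simp only [sin_eq_exp, expI_add, expI_sub, expI_two, expI_angle, chi_add hq, chi_sub hq,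
         chi_one hq]
       field_simp; ring))


/-- The operator on the product of the auxiliary space and a two-dimensional space given by a
block. -/
def blockOp {κ : Type*} (L : Block κ) : Matrix (κ × Fin 2) (κ × Fin 2) ℂ :=
  Matrix.of fun p q => L p.2 q.2 p.1 q.1

theorem blockOp_mul {κ : Type*} [Fintype κ] (L L' : Block κ) :
    blockOp L * blockOp L' = blockOp (Matrix.of fun α β => ∑ γ, L α γ * L' γ β) := by
  ext ⟨i, α⟩ ⟨j, β⟩
  simp only [blockOp, Matrix.mul_apply, Matrix.of_apply, Fintype.sum_prod_type, Matrix.sum_apply]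
  rw [Finset.sum_comm]

theorem blockOp_smul_one {κ : Type*} [DecidableEq κ] (a : ℂ) :
    blockOp (Matrix.of fun α β => if α = β then a • (1 : Matrix κ κ ℂ) else 0) = a • 1 := by
  ext ⟨i, α⟩ ⟨j, β⟩
  simp only [blockOp, Matrix.of_apply, Matrix.smul_apply, Matrix.one_apply, Prod.mk.injEq]
  by_cases h : α = β <;> by_cases h' : i = j <;> simp [h, h']

/-- The quantum adjugate of the cyclic `L`-operator. -/
noncomputable def cycAdj (n : ℕ) [NeZero n] (η ξ c d z : ℂ) : Block (ZMod n) :=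
  !![cycL n η ξ c d (z - 2 * η) 1 1, -cycL n η ξ c d z 0 1;
     -cycL n η ξ c d z 1 0, cycL n η ξ c d (z - 2 * η) 0 0]

theorem neg_raise (b : ZMod n → ℂ) : -raise b = raise fun k => -b k := by
  ext i j; simp only [raise, Matrix.neg_apply, Matrix.of_apply]; split_ifs <;> simp

theorem neg_lower (b : ZMod n → ℂ) : -lower b = lower fun k => -b k := by
  ext i j; simp only [lower, Matrix.neg_apply, Matrix.of_apply]; split_ifs <;> simp

theorem raise_eq_zero_of {f : ZMod n → ℂ} (h : ∀ k, f k = 0) : raise f = 0 := by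
  ext i j; simp [raise, h]

theorem lower_eq_zero_of {f : ZMod n → ℂ} (h : ∀ k, f k = 0) : lower f = 0 := by
  ext i j; simp [lower, h]

theorem diagonal_eq_smul_one_of {f : ZMod n → ℂ} {a : ℂ} (h : ∀ k, f k = a) :
    Matrix.diagonal f = a • 1 := by
  ext i j
  by_cases hij : i = j
  · simp [hij, h]
  · simp [hij]

include hq in
/-- The product with the quantum adjugate is the quantum determinant; where the latter is not zero,
the cyclic `L`-operator is invertible. -/
theorem cycL_mul_cycAdj (ξ c d z : ℂ) : blockOp (cycL n η ξ c d z) * blockOp (cycAdj n η ξ c d z) =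
    (Complex.sin (z + d) * Complex.sin (z - d)) • 1 := by
  have hη := Complex.exp_ne_zero (η * Complex.I)
  have hz := Complex.exp_ne_zero (z * Complex.I)
  have hc := Complex.exp_ne_zero (c * Complex.I)
  have hd := Complex.exp_ne_zero (d * Complex.I)
  have hξ := Complex.exp_ne_zero (ξ * Complex.I)
  rw [blockOp_mul, ← blockOp_smul_one]
  congr 1
  ext1 α β
  fin_cases α <;> fin_cases β <;>
  simp only [cycL, cycAdj, Fin.sum_univ_two, Matrix.of_apply, Fin.zero_eta, Fin.mk_one,
    Matrix.cons_val', Matrix.cons_val_zero, Matrix.cons_val_one, Matrix.cons_val_fin_one,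
    neg_raise, neg_lower, diagonal_mul_raise, raise_mul_diagonal,
    diagonal_mul_lower, lower_mul_diagonal, raise_mul_lower, lower_mul_raise, raise_add, lower_add,
    Matrix.diagonal_mul_diagonal, Matrix.diagonal_add, if_true, zero_ne_one, one_ne_zero, if_false] <;>
  [apply diagonal_eq_smul_one_of; apply raise_eq_zero_of; apply lower_eq_zero_of;
    apply diagonal_eq_smul_one_of] <;>
  (intro k
   have hk := chi_ne_zero (η := η) k
   simp only [sin_eq_exp, expI_add, expI_sub, expI_two, expI_angle, chi_add hq, chi_sub hq,
     chi_one hq]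
   field_simp; ring)

/-- The zeros of a product of two shifted sines are isolated. -/
theorem eventually_sin_mul_sin_ne_zero (a b : ℂ) (z : ℂ) :
    ∀ᶠ w in nhdsWithin z {z}ᶜ, Complex.sin (w + a) * Complex.sin (w + b) ≠ 0 := by
  have key : ∀ a : ℂ, ∀ᶠ w in nhdsWithin z {z}ᶜ, Complex.sin (w + a) ≠ 0 := by
    intro a
    have han : AnalyticOnNhd ℂ (fun w : ℂ => Complex.sin (w + a)) Set.univ :=
      (Complex.differentiable_sin.comp (differentiable_id.add_const a)).differentiableOn.analyticOnNhd
        isOpen_univ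
    rcases (han z trivial).eventually_eq_zero_or_eventually_ne_zero with h | h
    · exfalso
      have := han.eqOn_zero_of_preconnected_of_eventuallyEq_zero isPreconnected_univ
        (Set.mem_univ z) h (Set.mem_univ ((Real.pi : ℂ) / 2 - a))
      simp at this
    · exact h
  filter_upwards [key a, key b] with w ha hb using mul_ne_zero ha hb

theorem continuous_chainTrace {κ X : Type*} [Fintype κ] [DecidableEq κ] [TopologicalSpace X] {N : ℕ}
    {W : X → Fin N → Block κ} (hW : ∀ i s t k l, Continuous fun x => W x i s t k l) :
    Continuous fun x => chainTrace (W x) := by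
  refine continuous_matrix fun s t => ?_
  simp only [chainTrace, Matrix.of_apply]
  have key : ∀ {N : ℕ} {f : X → Fin N → Matrix κ κ ℂ}, (∀ i, Continuous fun x => f x i) →
      Continuous fun x => (List.ofFn (f x)).prod := by
    intro N
    induction N with
    | zero => intro f _; simpa using continuous_const
    | succ N ih =>
      intro f hf
      simp only [List.ofFn_succ, List.prod_cons]
      exact (hf 0).mul (ih fun i => hf i.succ)
  exact (key fun i => continuous_matrix fun k l => hW i _ _ k l).matrix_trace

include hq in
/-- The cyclic transfer matrices commute with the 6-vertex transfer matrix. -/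
theorem cycT_comm_sixVertex {N : ℕ} (μ : Fin N → ℂ) (ξ c d z z' : ℂ) :
    transferMatrix (sixVertexL η) μ z' * cycT n η μ ξ c d z =
      cycT n η μ ξ c d z * transferMatrix (sixVertexL η) μ z' := by
  -- the intertwiner is invertible for generic `z'`
  have gen : ∀ z', Complex.sin (z' + (-z - η - d)) * Complex.sin (z' + (-z - η + d)) ≠ 0 →
      transferMatrix (sixVertexL η) μ z' * cycT n η μ ξ c d z =
      cycT n η μ ξ c d z * transferMatrix (sixVertexL η) μ z' := by
    intro z' hne
    have hne' : Complex.sin (z - z' + η + d) * Complex.sin (z - z' + η - d) ≠ 0 := by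
      rw [← neg_mul_neg, ← Complex.sin_neg, ← Complex.sin_neg]
      convert hne using 3 <;> ring
    have hinv := cycL_mul_cycAdj hq ξ c d (z - z' + η)
    have h1 : blockOp (cycL n η ξ c d (z - z' + η)) *
        ((Complex.sin (z - z' + η + d) * Complex.sin (z - z' + η - d))⁻¹ •
          blockOp (cycAdj n η ξ c d (z - z' + η))) = 1 := by
      rw [Matrix.mul_smul, hinv, smul_smul, inv_mul_cancel₀ hne', one_smul]
    have h2 := mul_eq_one_comm.1 h1
    rw [cycT, transferMatrix_eq_chainTrace, chainTrace_mul', chainTrace_mul]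
    refine chainTrace_eq_of_intertwine _ _ h2 h1 fun i s t => ?_
    ext ⟨k, α⟩ ⟨l, β⟩
    have key := congrFun (congrFun (cycL_rll hq ξ c d (μ i + z) (μ i + z') s t α β) k) l
    rw [show μ i + z - (μ i + z') + η = z - z' + η by ring] at key
    simp only [Fin.sum_univ_two, Matrix.add_apply, Matrix.smul_apply, Matrix.mul_apply,
      smul_eq_mul] at key
    simp only [blockOp, Matrix.mul_apply, Matrix.of_apply, Fintype.sum_prod_type,
      Fin.sum_univ_two, Matrix.add_apply, Matrix.kroneckerMap_apply]
    calc _ = _ := ?_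
      _ = _ := key.symm
      _ = _ := ?_
    · simp only [Finset.mul_sum, ← Finset.sum_add_distrib]
      exact Finset.sum_congr rfl fun _ _ => by ring
    · simp only [Finset.mul_sum, ← Finset.sum_add_distrib]
      exact Finset.sum_congr rfl fun _ _ => by ring
  have hcont : Continuous fun w => transferMatrix (sixVertexL η) μ w := by
    refine continuous_chainTrace fun i s t k l => ?_
    fin_cases s <;> fin_cases t <;> fin_cases k <;> fin_cases l <;> simp [sixVertexL] <;> fun_prop
  have hl := ((hcont.mul (continuous_const (y := cycT n η μ ξ c d z))).tendsto z').mono_left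
    (nhdsWithin_le_nhds (s := {z'}ᶜ))
  have hr := (((continuous_const (y := cycT n η μ ξ c d z)).mul hcont).tendsto z').mono_left
    (nhdsWithin_le_nhds (s := {z'}ᶜ))
  refine tendsto_nhds_unique (hl.congr' ?_) hr
  filter_upwards [eventually_sin_mul_sin_ne_zero (-z - η - d) (-z - η + d) z'] with w hw
  exact gen w hw

end CyclicL

/-! ### Gauge transformations of the cyclic transfer matrix -/

section Gauge

variable {n : ℕ} [NeZero n] {η : ℂ} (hq : IsPrimitiveRoot (Complex.exp (2 * η * Complex.I)) n)

theorem chainTrace_reindex {κ κ' : Type*} [Fintype κ] [DecidableEq κ] [Fintype κ'] [DecidableEq κ']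
    {N : ℕ} (e : κ ≃ κ') (W : Fin N → Block κ') :
    (chainTrace fun i => Matrix.of fun s t => (W i s t).submatrix e e) = chainTrace W := by
  ext s t
  simp only [chainTrace, Matrix.of_apply]
  have key : ∀ {N : ℕ} (f : Fin N → Matrix κ' κ' ℂ),
      (List.ofFn fun i => (f i).submatrix e e).prod = (List.ofFn f).prod.submatrix e e := by
    intro N
    induction N with
    | zero => intro f; simp
    | succ N ih =>
      intro f
      simp only [List.ofFn_succ, List.prod_cons]
      rw [ih, Matrix.submatrix_mul_equiv]
  rw [key fun i => W i (s i) (t i)]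
  simp only [Matrix.trace, Matrix.diag_apply, Matrix.submatrix_apply]
  exact e.sum_comp fun k => (List.ofFn fun i => W i (s i) (t i)).prod k k

theorem chainTrace_diagonal_gauge {N : ℕ} {W W' : Fin N → Block (ZMod n)} (p : ZMod n → ℂ)
    (hp : ∀ k, p k ≠ 0)
    (h : ∀ i s t, W' i s t * Matrix.diagonal p = Matrix.diagonal p * W i s t) :
    chainTrace W' = chainTrace W := by
  refine chainTrace_eq_of_intertwine (Matrix.diagonal p) (Matrix.diagonal fun k => (p k)⁻¹) ?_ ?_ h
  · rw [Matrix.diagonal_mul_diagonal, ← Matrix.diagonal_one]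
    congr 1; funext k; exact inv_mul_cancel₀ (hp k)
  · rw [Matrix.diagonal_mul_diagonal, ← Matrix.diagonal_one]
    congr 1; funext k; exact mul_inv_cancel₀ (hp k)

include hq in
/-- The transfer matrix depends on the weights of the raising and lowering operators only through
their products along the cycle; this allows one to interchange the two zeros of the quantum
determinant. -/
theorem cycT_swap (hodd : Odd n) {N : ℕ} (μ : Fin N → ℂ) {ξ ξ' c d : ℂ} (z : ℂ)
    (h₁ : Complex.sin (n * (c + d)) ≠ 0) (h₂ : Complex.sin (n * (c - d)) ≠ 0)
    (hξ : Complex.exp (ξ' * Complex.I) ^ n * Complex.sin (n * (c - d)) =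
      Complex.exp (ξ * Complex.I) ^ n * Complex.sin (n * (c + d))) :
    cycT n η μ ξ c d z = cycT n η μ ξ' c (-d) z := by
  have hx := Complex.exp_ne_zero (ξ * Complex.I)
  have hx' := Complex.exp_ne_zero (ξ' * Complex.I)
  have s₁ := sin_add_angle_ne_zero hq hodd h₁
  have s₂ := sin_add_angle_ne_zero hq hodd h₂
  obtain ⟨K, hK, hprod⟩ := exists_prod_sin hq hodd
  let F : ZMod n → ℂ := fun k => (Complex.exp (ξ' * Complex.I) * Complex.sin (c - d + angle η k)) /
    (Complex.exp (ξ * Complex.I) * Complex.sin (c + d + angle η k))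
  have hF : ∀ k, F k ≠ 0 := fun k => div_ne_zero (mul_ne_zero hx' (s₂ k)) (mul_ne_zero hx (s₁ k))
  have hF1 : ∏ k, F (k + 1) = 1 := by
    rw [show ∏ k, F (k + 1) = ∏ k, F k from Equiv.prod_comp (Equiv.addRight (1 : ZMod n)) F,
      Finset.prod_div_distrib,
      Finset.prod_mul_distrib, Finset.prod_mul_distrib, hprod, hprod, Finset.prod_const,
      Finset.prod_const, Finset.card_univ, ZMod.card, div_eq_one_iff_eq]
    · linear_combination K * hξ
    · exact mul_ne_zero (pow_ne_zero _ hx) (mul_ne_zero hK h₁)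
  obtain ⟨p, hp, hstep⟩ := exists_gauge (fun k => F (k + 1)) (fun k => hF _) hF1
  have hstep' : ∀ k, p k = p (k - 1) * F k := fun k => by
    have := hstep (k - 1); rwa [sub_add_cancel] at this
  symm
  refine chainTrace_diagonal_gauge p hp fun i s t => ?_
  fin_cases s <;> fin_cases t
  · simp [cycL, Matrix.diagonal_mul_diagonal, mul_comm]
  · simp only [cycL, Fin.zero_eta, Fin.mk_one, Matrix.of_apply, Matrix.cons_val', Matrix.cons_val_zero,
      Matrix.cons_val_one, Matrix.cons_val_fin_one, raise_mul_diagonal, diagonal_mul_raise]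
    congr 1; funext k
    rw [hstep' k]
    have := s₁ k
    simp only [F, ← sub_eq_add_neg]
    field_simp
  · simp only [cycL, Fin.zero_eta, Fin.mk_one, Matrix.of_apply, Matrix.cons_val', Matrix.cons_val_zero,
      Matrix.cons_val_one, Matrix.cons_val_fin_one, lower_mul_diagonal, diagonal_mul_lower]
    congr 1; funext k
    rw [hstep' k]
    have := s₁ k
    simp only [F, sub_neg_eq_add]
    field_simp
  · simp [cycL, Matrix.diagonal_mul_diagonal, mul_comm]

/-- The residues as an index type of size `n`. -/
def residueEquiv (n : ℕ) [NeZero n] : ZMod n ≃ Fin n where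
  toFun k := ⟨k.val, ZMod.val_lt k⟩
  invFun i := ((i : ℕ) : ZMod n)
  left_inv k := ZMod.natCast_zmod_val k
  right_inv i := Fin.ext (ZMod.val_natCast_of_lt i.2)

include hq in
/-- At `c = d = 0` the cyclic transfer matrix is that of the symmetric power, whatever `ξ`. -/
theorem cycT_zero_zero {N : ℕ} (μ : Fin N → ℂ) (ξ z : ℂ) :
    cycT n η μ ξ 0 0 z = transferMatrix (symPowerL n η) μ z := by
  rw [transferMatrix_eq_chainTrace, ← chainTrace_reindex (residueEquiv n)]
  symm
  have hx := Complex.exp_ne_zero (ξ * Complex.I)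
  have hval : ∀ k l : ZMod n, k = l + 1 → k.val = l.val + 1 ∨ k = 0 := by
    rintro k l rfl
    by_cases h : l.val + 1 < n
    · left
      by_cases h1 : n = 1
      · subst h1; omega
      · rw [ZMod.val_add_of_lt]
        · rw [ZMod.val_one'' h1]
        · rwa [ZMod.val_one'' h1]
    · right
      have hl := ZMod.val_lt l
      rw [← ZMod.natCast_zmod_val l, show (1 : ZMod n) = ((1 : ℕ) : ZMod n) by simp,
        ← Nat.cast_add, show l.val + 1 = n by omega, ZMod.natCast_self]
  have hval' : ∀ k l : ZMod n, k.val = l.val + 1 → k = l + 1 := by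
    intro k l h
    rw [← ZMod.natCast_zmod_val k, h]; simp
  refine chainTrace_diagonal_gauge (fun k => (Complex.exp (ξ * Complex.I))⁻¹ ^ k.val)
    (fun k => pow_ne_zero _ (inv_ne_zero hx)) fun i s t => ?_
  ext k l
  rw [Matrix.mul_diagonal, Matrix.diagonal_mul]
  have hper : Complex.exp (2 * (n : ℂ) * η * Complex.I) = 1 := by
    rw [← hq.pow_eq_one, ← Complex.exp_nat_mul]; ring_nf
  fin_cases s <;> fin_cases t
  · simp only [symPowerL, cycL, residueEquiv, angle, Matrix.of_apply, Matrix.submatrix_apply,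
      Matrix.diagonal_apply, Fin.zero_eta, Matrix.cons_val', Matrix.cons_val_zero,
      Matrix.cons_val_fin_one, Equiv.coe_fn_mk, Fin.mk.injEq, (ZMod.val_injective n).eq_iff]
    split_ifs with h
    · subst h; simp [mul_comm]
    · simp
  · simp only [symPowerL, cycL, residueEquiv, angle, raise, Matrix.of_apply, Matrix.submatrix_apply,
      Fin.zero_eta, Fin.mk_one, Matrix.cons_val', Matrix.cons_val_zero, Matrix.cons_val_one,
      Matrix.cons_val_fin_one, Equiv.coe_fn_mk]
    by_cases h : k.val = l.val + 1
    · rw [if_pos h, if_pos (hval' _ _ h), h, pow_succ]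
      field_simp
      simp
    · rw [if_neg h]
      split_ifs with h'
      · rcases hval _ _ h' with h'' | h''
        · exact absurd h'' h
        · simp [h'']
      · simp
  · simp only [symPowerL, cycL, residueEquiv, angle, lower, Matrix.of_apply, Matrix.submatrix_apply,
      Fin.zero_eta, Fin.mk_one, Matrix.cons_val', Matrix.cons_val_zero, Matrix.cons_val_one,
      Matrix.cons_val_fin_one, Equiv.coe_fn_mk]
    by_cases h : l.val = k.val + 1
    · rw [if_pos h, if_pos (hval' _ _ h)]
      have : Complex.sin (2 * ((n : ℂ) - (l.val : ℂ)) * η) =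
          -Complex.sin (0 - 0 + 2 * (l.val : ℂ) * η) := by
        rw [sin_eq_exp, sin_eq_exp, show 2 * ((n : ℂ) - (l.val : ℂ)) * η =
          2 * (n : ℂ) * η - 2 * (l.val : ℂ) * η by ring, expI_sub, hper]
        have := Complex.exp_ne_zero (2 * (l.val : ℂ) * η * Complex.I)
        simp only [sub_zero, zero_add]
        field_simp
        ring
      rw [this, h, pow_succ]
      ring
    · rw [if_neg h]
      split_ifs with h'
      · rcases hval _ _ h' with h'' | h''
        · exact absurd h'' h
        · simp [h'']
      · simp
  · simp only [symPowerL, cycL, residueEquiv, angle, Matrix.of_apply, Matrix.submatrix_apply,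
      Matrix.diagonal_apply, Fin.mk_one, Matrix.cons_val', Matrix.cons_val_one,
      Matrix.cons_val_fin_one, Equiv.coe_fn_mk, Fin.mk.injEq, (ZMod.val_injective n).eq_iff]
    split_ifs with h
    · subst h
      rw [mul_comm]; congr 2; ring
    · simp

end Gauge

/-! ### The exchange relation of cyclic transfer matrices -/

section Exchange

variable {n : ℕ} [NeZero n] {η : ℂ} (hq : IsPrimitiveRoot (Complex.exp (2 * η * Complex.I)) n)

/-- The factor of a path weight acting on the outgoing spin. -/
noncomputable def outV (η x b : ℂ) (k : ZMod n) : Fin 2 → ℂ := ![1, x⁻¹ * b * (chi η k)⁻¹]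

/-- The factor of a path weight acting on the incoming spin. -/
noncomputable def inV (η x a : ℂ) (k : ZMod n) : Fin 2 → ℂ := ![1, -x * a * chi η k]

/-- The cyclic `L`-operator in the basis where the cyclic shift is diagonal. It moves the residue
by one step up or down, and each of the two steps carries a weight of rank one in the spins. The
two zeros of the quantum determinant enter the two factors of the weight separately. -/
noncomputable def pathL (n : ℕ) [NeZero n] (η x G a b : ℂ) : Block (ZMod n) :=
  Matrix.of fun s t => Matrix.of fun k' k =>
    (if k' = k - 1 then Complex.I / 2 * G * outV η x b k' s * inV η x a k t else 0) -
    (if k' = k + 1 then Complex.I / 2 * G⁻¹ * outV η x b⁻¹ k' s * inV η x a⁻¹ k t else 0)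

/-- The matrix of the discrete Fourier transform. -/
noncomputable def dft (n : ℕ) [NeZero n] (η : ℂ) : Matrix (ZMod n) (ZMod n) ℂ :=
  Matrix.of fun k j => chi η (k * j)

/-- The matrix of the inverse discrete Fourier transform. -/
noncomputable def dftInv (n : ℕ) [NeZero n] (η : ℂ) : Matrix (ZMod n) (ZMod n) ℂ :=
  Matrix.of fun j k => (n : ℂ)⁻¹ * chi η (-(k * j))

include hq in
theorem dft_mul_dftInv : dft n η * dftInv n η = 1 := by
  have hn : (n : ℂ) ≠ 0 := Nat.cast_ne_zero.2 (NeZero.ne n)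
  ext k l
  simp only [dft, dftInv, Matrix.mul_apply, Matrix.of_apply]
  calc _ = (n : ℂ)⁻¹ * ∑ j, chi η ((k - l) * j) := by
        rw [Finset.mul_sum]
        refine Finset.sum_congr rfl fun j _ => ?_
        rw [sub_mul, sub_eq_add_neg, chi_add hq]; ring
    _ = _ := by
        rw [sum_chi_mul hq, Matrix.one_apply]
        simp only [sub_eq_zero]
        split_ifs <;> simp [hn]

include hq in
/-- The discrete Fourier transform conjugates the cyclic `L`-operator into `pathL`. -/
theorem pathL_mul_dft (ξ c d z : ℂ) (s t : Fin 2) :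
    pathL n η (Complex.exp (ξ * Complex.I)) (Complex.exp ((c - z) * Complex.I))
      (Complex.exp ((z + d) * Complex.I)) (Complex.exp ((z - d) * Complex.I)) s t * dft n η =
      dft n η * cycL n η ξ c d z s t := by
  have hη := Complex.exp_ne_zero (η * Complex.I)
  have hz := Complex.exp_ne_zero (z * Complex.I)
  have hc := Complex.exp_ne_zero (c * Complex.I)
  have hd := Complex.exp_ne_zero (d * Complex.I)
  have hξ := Complex.exp_ne_zero (ξ * Complex.I)
  have hI : Complex.I ^ 2 = -1 := Complex.I_sq
  have hraise : ∀ (b : ZMod n → ℂ) (k j : ZMod n),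
      (dft n η * raise b) k j = chi η (k * (j + 1)) * b (j + 1) := fun b k j => by
    simp [dft, raise, Matrix.mul_apply]
  have hlower : ∀ (b : ZMod n → ℂ) (k j : ZMod n),
      (dft n η * lower b) k j = chi η (k * (j - 1)) * b j := fun b k j => by
    simp only [dft, lower, Matrix.mul_apply, Matrix.of_apply, ← sub_eq_iff_eq_add]
    simp
  ext k j
  have hk := chi_ne_zero (η := η) k
  have hj := chi_ne_zero (η := η) j
  have hkj := chi_ne_zero (η := η) (k * j)
  have hL : ∀ f g : ZMod n → ℂ, (∑ x, ((if k = x - 1 then f x else 0) -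
      (if k = x + 1 then g x else 0)) * chi η (x * j)) =
      f (k + 1) * chi η ((k + 1) * j) - g (k - 1) * chi η ((k - 1) * j) := by
    intro f g
    simp only [sub_mul, Finset.sum_sub_distrib, eq_sub_iff_add_eq, ← sub_eq_iff_eq_add, ite_mul,
      zero_mul, Finset.sum_ite_eq, Finset.mem_univ, if_true]
  rw [Matrix.mul_apply]
  simp only [pathL, dft, Matrix.of_apply]
  rw [hL]
  fin_cases s <;> fin_cases t
  · change _ = (dft n η * Matrix.diagonal _ : Matrix (ZMod n) (ZMod n) ℂ) k j
    rw [Matrix.mul_diagonal]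
    simp only [dft, Matrix.of_apply, outV, inV, Fin.zero_eta, Matrix.cons_val_zero, add_mul k,
      sub_mul k, one_mul, chi_add hq, chi_sub hq, sin_eq_exp, expI_add, expI_sub, expI_angle]
    field_simp
  · change _ = (dft n η * raise _ : Matrix (ZMod n) (ZMod n) ℂ) k j
    rw [hraise]
    simp only [outV, inV, Fin.zero_eta, Fin.mk_one, Matrix.cons_val_zero, Matrix.cons_val_one,
      Matrix.cons_val_fin_one, add_mul k, sub_mul k, mul_add, mul_one, one_mul, chi_add hq,
      chi_sub hq, sin_eq_exp, expI_add, expI_sub, expI_angle, chi_one hq, expI_two]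
    field_simp
    ring
  · change _ = (dft n η * lower _ : Matrix (ZMod n) (ZMod n) ℂ) k j
    rw [hlower]
    simp only [outV, inV, Fin.zero_eta, Fin.mk_one, Matrix.cons_val_zero, Matrix.cons_val_one,
      Matrix.cons_val_fin_one, add_mul k, sub_mul k, mul_sub, mul_one, one_mul, chi_add hq,
      chi_sub hq, sin_eq_exp, expI_add, expI_sub, expI_angle, chi_one hq, expI_two]
    field_simp
    ring
  · change _ = (dft n η * Matrix.diagonal _ : Matrix (ZMod n) (ZMod n) ℂ) k j
    rw [Matrix.mul_diagonal]
    simp only [dft, Matrix.of_apply, outV, inV, Fin.mk_one, Matrix.cons_val_one,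
      Matrix.cons_val_fin_one, add_mul k, sub_mul k, one_mul, chi_add hq, chi_sub hq, sin_eq_exp,
      expI_add, expI_sub, expI_angle, chi_one hq, expI_two]
    field_simp
    ring

include hq in
theorem cycT_eq_path {N : ℕ} (μ : Fin N → ℂ) (ξ c d z : ℂ) : cycT n η μ ξ c d z =
    chainTrace fun i => pathL n η (Complex.exp (ξ * Complex.I))
      (Complex.exp ((c - (μ i + z)) * Complex.I)) (Complex.exp ((μ i + z + d) * Complex.I))
      (Complex.exp ((μ i + z - d) * Complex.I)) :=
  (chainTrace_eq_of_intertwine (dft n η) (dftInv n η) (mul_eq_one_comm.1 (dft_mul_dftInv hq))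
    (dft_mul_dftInv hq) fun i s t => pathL_mul_dft hq ξ c d (μ i + z) s t).symm

/-- Expansion of the contraction over the intermediate spin of two operators that move up or down by
one step; `A`, `A'`, `B`, `B'` stand for the conditions on the steps. -/
theorem step_pairs_expand (A A' B B' : Prop) [Decidable A] [Decidable A'] [Decidable B]
    [Decidable B'] (u u' v v' p₀ p₁ p₀' p₁' q₀ q₁ q₀' q₁' : ℂ) :
    ((if A then u * p₀ else 0) - (if A' then u' * p₀' else 0)) *
        ((if B then v * q₀ else 0) - (if B' then v' * q₀' else 0)) +
      ((if A then u * p₁ else 0) - (if A' then u' * p₁' else 0)) *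
        ((if B then v * q₁ else 0) - (if B' then v' * q₁' else 0)) =
      (if A ∧ B then u * v * (p₀ * q₀ + p₁ * q₁) else 0)
      - (if A ∧ B' then u * v' * (p₀ * q₀' + p₁ * q₁') else 0)
      - (if A' ∧ B then u' * v * (p₀' * q₀ + p₁' * q₁) else 0)
      + (if A' ∧ B' then u' * v' * (p₀' * q₀' + p₁' * q₁') else 0) := by
  by_cases hA : A <;> by_cases hA' : A' <;> by_cases hB : B <;> by_cases hB' : B' <;>
  simp only [hA, hA', hB, hB', if_true, if_false, and_true, and_false] <;> ring

include hq in
/-- One site of the exchange relation: the gauge transformation `Y` of the relative residue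
interchanges the incoming zero `a₁` of the first factor with the outgoing zero `b₂` of the second
one. -/
theorem pathL_exchange {x₁ x₂ G₁ G₂ G₁' G₂' a₁ a₂ b₁ b₂ ρ h : ℂ} (hx₂ : x₂ ≠ 0)
    (hG₁ : G₁ ≠ 0) (hG₂ : G₂ ≠ 0) (hG₁' : G₁' ≠ 0) (hG₂' : G₂' ≠ 0) (hb : b₂ ≠ 0) (hρ : ρ ≠ 0)
    (ha : a₁ = ρ * b₂) (hG : G₁' * G₂' = G₁ * G₂) (hh : G₁' * G₂ = h * (G₂' * G₁))
    (Y : ZMod n → ℂ) (hY : ∀ j, Y (j - 2) * (1 - x₁ / x₂ * ρ * chi η (j - 1)) =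
      h * (1 - x₁ / x₂ * ρ⁻¹ * chi η (j - 1)) * Y j) (s t : Fin 2) :
    (∑ r, pathL n η x₁ G₁' b₂ b₁ s r ⊗ₖ pathL n η x₂ G₂' a₂ a₁ r t) *
        Matrix.diagonal (fun p : ZMod n × ZMod n => Y (p.1 - p.2)) =
      Matrix.diagonal (fun p : ZMod n × ZMod n => Y (p.1 - p.2)) *
        ∑ r, pathL n η x₁ G₁ a₁ b₁ s r ⊗ₖ pathL n η x₂ G₂ a₂ b₂ r t := by
  have hh0 : h ≠ 0 := by
    rintro rfl
    rw [zero_mul] at hh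
    exact mul_ne_zero hG₁' hG₂ hh
  have hGG : G₁' * G₂'⁻¹ = h * (G₁ * G₂⁻¹) := by
    field_simp; linear_combination hh
  have hGG' : G₁'⁻¹ * G₂' = h⁻¹ * (G₁⁻¹ * G₂) := by
    field_simp; linear_combination -hh
  have hGi : G₁'⁻¹ * G₂'⁻¹ = G₁⁻¹ * G₂⁻¹ := by rw [← mul_inv, hG, mul_inv]
  ext ⟨k', l'⟩ ⟨k, l⟩
  rw [Matrix.mul_diagonal, Matrix.diagonal_mul]
  simp only [Fin.sum_univ_two, Matrix.add_apply, Matrix.kroneckerMap_apply, pathL, Matrix.of_apply]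
  have hk := chi_ne_zero (η := η) k
  have hl := chi_ne_zero (η := η) l
  have ho := chi_ne_zero (η := η) (1 : ZMod n)
  -- contraction of the spin between the two factors, for the four pairs of steps
  have con : ∀ (a b : ℂ) (k l' : ZMod n), inV η x₁ a k 0 * outV η x₂ b l' 0 +
      inV η x₁ a k 1 * outV η x₂ b l' 1 = 1 - x₁ / x₂ * (a * b) * chi η (k - l') := by
    intro a b k l'
    rw [chi_sub hq]
    simp only [inV, outV, Matrix.cons_val_zero, Matrix.cons_val_one, Matrix.cons_val_fin_one]
    rw [div_eq_mul_inv]; ring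
  have mv : ∀ (G x b a : ℂ) (k l : ZMod n) (r t : Fin 2),
      Complex.I / 2 * G * outV η x b k r * inV η x a l t =
      (Complex.I / 2 * G * inV η x a l t) * outV η x b k r := fun _ _ _ _ _ _ _ _ => by ring
  rw [mv G₂', mv G₂', mv G₂'⁻¹, mv G₂'⁻¹, mv G₂, mv G₂, mv G₂⁻¹, mv G₂⁻¹, step_pairs_expand,
    step_pairs_expand]
  simp only [con]
  have combine : ∀ {T₁ T₂ T₃ T₄ S₁ S₂ S₃ S₄ y y' : ℂ}, T₁ * y = y' * S₁ → T₂ * y = y' * S₂ →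
      T₃ * y = y' * S₃ → T₄ * y = y' * S₄ →
      (T₁ - T₂ - T₃ + T₄) * y = y' * (S₁ - S₂ - S₃ + S₄) := by
    intro _ _ _ _ _ _ _ _ _ _ e₁ e₂ e₃ e₄
    linear_combination e₁ - e₂ - e₃ + e₄
  refine combine ?_ ?_ ?_ ?_
  · split_ifs with hc
    · obtain ⟨rfl, rfl⟩ := hc
      rw [sub_sub_sub_cancel_right, mul_comm b₂ a₁]
      linear_combination (Complex.I / 2) ^ 2 * outV η x₁ b₁ (k - 1) s * inV η x₂ a₂ l t *
        (1 - x₁ / x₂ * (a₁ * b₂) * chi η (k - (l - 1))) * Y (k - l) * hG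
    · simp
  · split_ifs with hc
    · obtain ⟨rfl, rfl⟩ := hc
      have key := hY (k - l)
      rw [show k - (l + 1) = k - l - 1 by ring, show k - 1 - (l + 1) = k - l - 2 by ring]
      have e1 : b₂ * a₁⁻¹ = ρ⁻¹ := by rw [ha]; field_simp
      have e2 : a₁ * b₂⁻¹ = ρ := by rw [ha]; field_simp
      rw [e1, e2]
      linear_combination (Complex.I / 2) ^ 2 * outV η x₁ b₁ (k - 1) s * inV η x₂ a₂⁻¹ l t *
        ((1 - x₁ / x₂ * ρ⁻¹ * chi η (k - l - 1)) * Y (k - l) * hGG - G₁ * G₂⁻¹ * key)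
    · simp
  · split_ifs with hc
    · obtain ⟨rfl, rfl⟩ := hc
      have key := hY (k - l + 2)
      rw [show k - l + 2 - 2 = k - l by ring, show k - l + 2 - 1 = k - l + 1 by ring] at key
      rw [show k - (l - 1) = k - l + 1 by ring, show k + 1 - (l - 1) = k - l + 2 by ring]
      have e1 : b₂⁻¹ * a₁ = ρ := by rw [ha]; field_simp
      have e2 : a₁⁻¹ * b₂ = ρ⁻¹ := by rw [ha]; field_simp
      rw [e1, e2]
      have key' : h⁻¹ * (Y (k - l) * (1 - x₁ / x₂ * ρ * chi η (k - l + 1))) =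
          (1 - x₁ / x₂ * ρ⁻¹ * chi η (k - l + 1)) * Y (k - l + 2) := by
        rw [key]; field_simp
      linear_combination (Complex.I / 2) ^ 2 * outV η x₁ b₁⁻¹ (k + 1) s * inV η x₂ a₂ l t *
        ((1 - x₁ / x₂ * ρ * chi η (k - l + 1)) * Y (k - l) * hGG' + G₁⁻¹ * G₂ * key')
    · simp
  · split_ifs with hc
    · obtain ⟨rfl, rfl⟩ := hc
      rw [add_sub_add_right_eq_sub, mul_comm b₂⁻¹ a₁⁻¹]
      linear_combination (Complex.I / 2) ^ 2 * outV η x₁ b₁⁻¹ (k + 1) s * inV η x₂ a₂⁻¹ l t *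
        (1 - x₁ / x₂ * (a₁⁻¹ * b₂⁻¹) * chi η (k - (l + 1))) * Y (k - l) * hGi
    · simp

/-- The cyclic transfer matrix as a function of `y₁ = z + d` and `y₂ = z - d`. These parameters are
called the zeros of the quantum determinant, which is `sin (μ i + y₁) * sin (μ i + y₂)` at the site
number `i`. -/
noncomputable def cycY (n : ℕ) [NeZero n] {N : ℕ} (η : ℂ) (μ : Fin N → ℂ) (ξ c y₁ y₂ : ℂ) :
    Matrix (Fin N → Fin 2) (Fin N → Fin 2) ℂ :=
  cycT n η μ ξ c ((y₁ - y₂) / 2) ((y₁ + y₂) / 2)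

include hq in
/-- The exchange relation: in a product of two cyclic transfer matrices one can interchange a zero
of the first with a zero of the second, at the expense of shifting the parameter `c`. -/
theorem cycY_exchange (hodd : Odd n) {N : ℕ} (μ : Fin N → ℂ) {ξ₁ ξ₂ τ : ℂ} (c₁ c₂ : ℂ)
    {y₁ y₂ y₃ y₄ R p : ℂ} (hR : R = Complex.exp ((ξ₁ - ξ₂) * Complex.I) ^ n)
    (hp : p = Complex.exp ((y₄ - y₁) * Complex.I) ^ n)
    (h₁ : p - R ≠ 0) (h₂ : 1 - R * p ≠ 0)
    (hτ : Complex.exp (2 * τ * Complex.I) ^ n = (p - R) / (1 - R * p)) :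
    cycY n η μ ξ₁ c₁ y₁ y₂ * cycY n η μ ξ₂ c₂ y₃ y₄ =
      cycY n η μ ξ₁ (c₁ + τ) y₄ y₂ * cycY n η μ ξ₂ (c₂ - τ) y₃ y₁ := by
  have hp0 : p ≠ 0 := by rw [hp]; exact pow_ne_zero _ (Complex.exp_ne_zero _)
  set r := Complex.exp (ξ₁ * Complex.I) / Complex.exp (ξ₂ * Complex.I) with hr
  set ρ := Complex.exp ((y₁ - y₄) * Complex.I) with hρ
  set h := Complex.exp ((2 * τ + (y₁ - y₄)) * Complex.I) with hh
  have hrR : r ^ n = R := by rw [hR, hr, expI_sub, div_eq_mul_inv]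
  have hρp : ρ ^ n = p⁻¹ := by
    rw [hp, hρ, ← inv_pow, ← expI_neg, neg_sub]
  have hρ0 : ρ ≠ 0 := Complex.exp_ne_zero _
  have hhn : h ^ n = (p - R) / (1 - R * p) * p⁻¹ := by
    rw [hh, expI_add, mul_pow, hτ, ← hρ, hρp]
  have prod_shift : ∀ u : ℂ, ∏ j : ZMod n, (1 - u * chi η (j - 1)) = 1 - u ^ n := by
    intro u
    rw [← prod_one_sub_mul_chi hq]
    exact Equiv.prod_comp (Equiv.subRight (1 : ZMod n)) fun j => 1 - u * chi η j
  have hd₁ : ∏ j : ZMod n, (1 - r * ρ * chi η (j - 1)) = (p - R) * p⁻¹ := by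
    rw [prod_shift, mul_pow, hrR, hρp]; field_simp
  have hd₂ : ∏ j : ZMod n, (1 - r * ρ⁻¹ * chi η (j - 1)) = 1 - R * p := by
    rw [prod_shift, mul_pow, hrR, inv_pow, hρp, inv_inv]
  have n₁ : ∀ j : ZMod n, 1 - r * ρ * chi η (j - 1) ≠ 0 := fun j =>
    Finset.prod_ne_zero_iff.1 (hd₁ ▸ mul_ne_zero h₁ (inv_ne_zero hp0)) j (Finset.mem_univ _)
  have n₂ : ∀ j : ZMod n, 1 - r * ρ⁻¹ * chi η (j - 1) ≠ 0 := fun j =>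
    Finset.prod_ne_zero_iff.1 (hd₂ ▸ h₂) j (Finset.mem_univ _)
  have hh0 : h ≠ 0 := Complex.exp_ne_zero _
  obtain ⟨Y, hY0, hY⟩ := exists_gauge_two hodd
    (fun j : ZMod n => h * (1 - r * ρ⁻¹ * chi η (j - 1)) / (1 - r * ρ * chi η (j - 1)))
    (fun j => div_ne_zero (mul_ne_zero hh0 (n₂ j)) (n₁ j)) (by
      rw [Finset.prod_div_distrib, Finset.prod_mul_distrib, hd₁, hd₂, Finset.prod_const,
        Finset.card_univ, ZMod.card, hhn]
      have h₂' : 1 - p * R ≠ 0 := by rwa [mul_comm]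
      field_simp)
  rw [cycY, cycY, cycY, cycY, cycT_eq_path hq, cycT_eq_path hq, cycT_eq_path hq, cycT_eq_path hq,
    chainTrace_mul, chainTrace_mul]
  symm
  refine chainTrace_eq_of_intertwine (Matrix.diagonal fun p : ZMod n × ZMod n => Y (p.1 - p.2))
    (Matrix.diagonal fun p : ZMod n × ZMod n => (Y (p.1 - p.2))⁻¹) ?_ ?_ fun i s t => ?_
  · rw [Matrix.diagonal_mul_diagonal, ← Matrix.diagonal_one]
    congr 1; funext k; exact inv_mul_cancel₀ (hY0 _)
  · rw [Matrix.diagonal_mul_diagonal, ← Matrix.diagonal_one]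
    congr 1; funext k; exact mul_inv_cancel₀ (hY0 _)
  simp only [Matrix.of_apply]
  rw [show μ i + (y₄ + y₂) / 2 + (y₄ - y₂) / 2 = μ i + y₄ by ring,
    show μ i + (y₄ + y₂) / 2 - (y₄ - y₂) / 2 = μ i + y₂ by ring,
    show μ i + (y₃ + y₁) / 2 + (y₃ - y₁) / 2 = μ i + y₃ by ring,
    show μ i + (y₃ + y₁) / 2 - (y₃ - y₁) / 2 = μ i + y₁ by ring,
    show μ i + (y₁ + y₂) / 2 + (y₁ - y₂) / 2 = μ i + y₁ by ring,
    show μ i + (y₁ + y₂) / 2 - (y₁ - y₂) / 2 = μ i + y₂ by ring,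
    show μ i + (y₃ + y₄) / 2 + (y₃ - y₄) / 2 = μ i + y₃ by ring,
    show μ i + (y₃ + y₄) / 2 - (y₃ - y₄) / 2 = μ i + y₄ by ring]
  refine pathL_exchange (h := h) (ρ := ρ) hq (Complex.exp_ne_zero _) (Complex.exp_ne_zero _)
    (Complex.exp_ne_zero _) (Complex.exp_ne_zero _) (Complex.exp_ne_zero _) (Complex.exp_ne_zero _)
    hρ0 ?_ ?_ ?_ Y (fun j => ?_) s t
  · rw [hρ, ← expI_add]; ring_nf
  · rw [← expI_add, ← expI_add]; ring_nf
  · rw [hh, ← expI_add, ← expI_add, ← expI_add]; ring_nf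
  · rw [hY j]
    have := n₁ j
    rw [← hr]
    field_simp

end Exchange

/-! ### Fusion -/

section Fusion

/-- The `L`-operator of the `(d - 1)`-th symmetric power for arbitrary `d` and `η`, in the
normalization where the weights of the raising operator vanish at the top of the ladder and those of
the lowering operator at its bottom. -/
noncomputable def fusL (d : ℕ) (η z : ℂ) : Block (Fin d) :=
  !![Matrix.diagonal fun k => Complex.sin (z - 2 * (k : ℕ) * η),
      Matrix.of fun i j =>
        if (i : ℕ) = (j : ℕ) + 1 then Complex.sin (2 * ((d : ℂ) - (i : ℕ)) * η) else 0;
     Matrix.of fun i j => if (j : ℕ) = (i : ℕ) + 1 then Complex.sin (2 * (j : ℕ) * η) else 0,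
      Matrix.diagonal fun k => Complex.sin (z + 2 * ((k : ℕ) + 1 - d) * η)]

/-- The weight with which the block `(s, t)` of `fusL d η z` acts on the basis vector number `i`. -/
noncomputable def fusWeight (d : ℕ) (η z : ℂ) (i : ℕ) : Matrix (Fin 2) (Fin 2) ℂ :=
  !![Complex.sin (z - 2 * i * η), Complex.sin (2 * ((d : ℂ) - (i + 1)) * η);
     Complex.sin (2 * i * η), Complex.sin (z + 2 * (i + 1 - d) * η)]

theorem fusL_apply {d : ℕ} (η z : ℂ) (s t : Fin 2) (j i : Fin d) :
    fusL d η z s t j i = if (j : ℕ) = i + t - s then fusWeight d η z i s t else 0 := by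
  fin_cases s <;> fin_cases t
  · simp [fusL, fusWeight, Matrix.diagonal_apply, Fin.ext_iff]
    split_ifs with h
    · rw [h]
    · rfl
  · simp [fusL, fusWeight]
    split_ifs with h
    · simp [h]
    · rfl
  · simp [fusL, fusWeight]
    by_cases hi : (i : ℕ) = 0
    · simp [hi]
    · simp only [show (i : ℕ) = j + 1 ↔ (j : ℕ) = i - 1 by omega]
  · simp [fusL, fusWeight, Matrix.diagonal_apply, Fin.ext_iff]
    split_ifs with h
    · rw [h]
    · rfl

theorem fusWeight_zero_one {d : ℕ} {i : ℕ} (η z : ℂ) (h : i + 1 = d) :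
    fusWeight d η z i 0 1 = 0 := by
  have hd : (d : ℂ) = i + 1 := by exact_mod_cast h.symm
  simp [fusWeight, hd]

theorem sum_mul_fusL {d : ℕ} (η z : ℂ) (g : ℕ → ℂ) (s t : Fin 2) (i : Fin d) :
    ∑ j : Fin d, g j * fusL d η z s t j i = g (i + t - s) * fusWeight d η z i s t := by
  have hi := i.2
  by_cases h : (i + t - s : ℕ) < d
  · rw [Finset.sum_eq_single (⟨i + t - s, h⟩ : Fin d)]
    · rw [fusL_apply, if_pos rfl]
    · intro j _ hj
      rw [fusL_apply, if_neg (fun h' => hj (Fin.ext h')), mul_zero]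
    · simp
  · obtain ⟨rfl, rfl, hd⟩ : s = 0 ∧ t = 1 ∧ (i : ℕ) + 1 = d := by
      fin_cases s <;> fin_cases t <;> simp at h ⊢ <;> omega
    rw [fusWeight_zero_one η z hd, mul_zero]
    refine Finset.sum_eq_zero fun j _ => ?_
    rw [fusL_apply, fusWeight_zero_one η z hd, ite_self, mul_zero]

theorem sin_fusion_diag (Z b h : ℂ) : Complex.sin (Z + b) * Complex.sin (Z - h) +
    Complex.sin b * Complex.sin h = Complex.sin Z * Complex.sin (Z + b - h) := by
  have hZ := Complex.exp_ne_zero (Z * Complex.I)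
  have hb := Complex.exp_ne_zero (b * Complex.I)
  have hh := Complex.exp_ne_zero (h * Complex.I)
  simp only [sin_eq_exp, expI_add, expI_sub]
  field_simp
  ring

theorem sin_fusion_off (Z b h : ℂ) : Complex.sin (Z + b) * Complex.sin h +
    Complex.sin b * Complex.sin (Z - h) = Complex.sin Z * Complex.sin (b + h) := by
  have hZ := Complex.exp_ne_zero (Z * Complex.I)
  have hb := Complex.exp_ne_zero (b * Complex.I)
  have hh := Complex.exp_ne_zero (h * Complex.I)
  simp only [sin_eq_exp, expI_add, expI_sub]
  field_simp
  ring

/-- The two-dimensional `L`-operator. -/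
noncomputable def spinL (η Z : ℂ) : Block (Fin 2) :=
  !![!![Complex.sin Z, 0; 0, Complex.sin (Z - 2 * η)], !![0, 0; Complex.sin (2 * η), 0];
     !![0, Complex.sin (2 * η); 0, 0], !![Complex.sin (Z - 2 * η), 0; 0, Complex.sin Z]]

theorem spinL_eq (η Z : ℂ) : spinL η Z = sixVertexL η (Z - η) := by
  rw [spinL, sixVertexL, show Z - η + η = Z by ring, show Z - η - η = Z - 2 * η by ring]

/-- The multiplication map onto the next symmetric power. -/
def fusProj (e : ℕ) : Matrix (Fin (e + 2)) (Fin (e + 1) × Fin 2) ℂ :=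
  Matrix.of fun k p => if (k : ℕ) = (p.1 : ℕ) + (p.2 : ℕ) then 1 else 0

/-- The kernel of the multiplication map: antisymmetric combinations. -/
def fusKer (e : ℕ) : Matrix (Fin (e + 1) × Fin 2) (Fin e) ℂ :=
  Matrix.of fun p k => (if p.2 = 1 ∧ (p.1 : ℕ) = (k : ℕ) then 1 else 0) -
    (if p.2 = 0 ∧ (p.1 : ℕ) = (k : ℕ) + 1 then 1 else 0)

/-- A section of the multiplication map. -/
def fusSec (e : ℕ) : Matrix (Fin (e + 1) × Fin 2) (Fin (e + 2)) ℂ :=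
  Matrix.of fun p k => if ((p.2 : ℕ) = 0 ∨ (p.1 : ℕ) = e) ∧ (k : ℕ) = (p.1 : ℕ) + (p.2 : ℕ) then 1 else 0

/-- A retraction onto the kernel of the multiplication map. -/
def fusRet (e : ℕ) : Matrix (Fin e) (Fin (e + 1) × Fin 2) ℂ :=
  Matrix.of fun k p => if p.2 = 1 ∧ (p.1 : ℕ) = (k : ℕ) then 1 else 0

theorem fusProj_mul_fusSec (e : ℕ) : fusProj e * fusSec e = 1 := by
  ext k l
  simp only [fusProj, fusSec, Matrix.mul_apply, Matrix.of_apply, Matrix.one_apply]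
  have hk := k.2
  obtain ⟨p, hp⟩ : ∃ p : Fin (e + 1) × Fin 2,
      ((p.2 : ℕ) = 0 ∨ (p.1 : ℕ) = e) ∧ (k : ℕ) = (p.1 : ℕ) + (p.2 : ℕ) := by
    by_cases h : (k : ℕ) = e + 1
    · exact ⟨(⟨e, by omega⟩, 1), Or.inr rfl, h⟩
    · exact ⟨(⟨k, by omega⟩, 0), Or.inl rfl, rfl⟩
  rw [Finset.sum_eq_single p]
  · rw [if_pos hp.2, one_mul]
    have hkl : (l : ℕ) = k ↔ k = l := by rw [Fin.ext_iff, eq_comm]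
    simp only [hp.1, true_and, ← hp.2, hkl]
  · intro r _ hne
    have hr := r.1.2
    have hr' := r.2.2
    have hp' := p.2.2
    by_cases h₁ : (k : ℕ) = (r.1 : ℕ) + (r.2 : ℕ)
    · rw [if_neg (c := ((r.2 : ℕ) = 0 ∨ (r.1 : ℕ) = e) ∧ (l : ℕ) = (r.1 : ℕ) + (r.2 : ℕ)), mul_zero]
      rintro ⟨h₂, -⟩
      exact hne (Prod.ext (Fin.ext (by omega)) (Fin.ext (by omega)))
    · rw [if_neg h₁, zero_mul]
  · simp

theorem fusRet_mul_fusKer (e : ℕ) : fusRet e * fusKer e = 1 := by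
  ext k l
  simp only [fusRet, fusKer, Matrix.mul_apply, Matrix.of_apply, Fintype.sum_prod_type,
    Fin.sum_univ_two, Matrix.one_apply]
  rw [Finset.sum_eq_single (⟨k, by omega⟩ : Fin (e + 1))]
  · by_cases hkl : k = l
    · subst hkl; simp
    · have : ¬ (k : ℕ) = l := fun h' => hkl (Fin.ext h')
      simp [hkl, this]
  · intro j _ hj
    have : ¬ (j : ℕ) = k := fun h' => hj (Fin.ext h')
    simp [this]
  · simp

theorem fusSec_add_fusKer (e : ℕ) : fusSec e * fusProj e + fusKer e * fusRet e = 1 := by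
  ext ⟨i, α⟩ ⟨j, β⟩
  simp only [fusProj, fusSec, fusKer, fusRet, Matrix.mul_apply, Matrix.of_apply, Matrix.add_apply,
    Matrix.one_apply, Prod.mk.injEq]
  have hi := i.2
  have hj := j.2
  rw [Finset.sum_eq_single (⟨j + β, by omega⟩ : Fin (e + 2)) (by
    intro k _ hk
    rw [if_neg (fun h' : (k : ℕ) = _ => hk (Fin.ext h')), mul_zero]) (by simp)]
  by_cases hje : (j : ℕ) < e
  · rw [Finset.sum_eq_single (⟨j, hje⟩ : Fin e) (by
      intro k _ hk
      rw [if_neg (c := β = 1 ∧ (j : ℕ) = k), mul_zero]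
      exact fun h' => hk (Fin.ext h'.2.symm)) (by simp)]
    fin_cases α <;> fin_cases β <;> simp [Fin.ext_iff] <;> (try split_ifs) <;>
      first | omega | norm_num
  · rw [Finset.sum_eq_zero (s := (Finset.univ : Finset (Fin e))) (by
      intro k _
      rw [if_neg (c := β = 1 ∧ (j : ℕ) = k), mul_zero]
      rintro ⟨-, h⟩
      have := k.2
      omega)]
    fin_cases α <;> fin_cases β <;> simp [Fin.ext_iff] <;> (try split_ifs) <;>
      first | omega | norm_num

theorem fusWeight_add_one (e i : ℕ) (η Z : ℂ) : fusWeight (e + 1) η (Z + 2 * e * η) i =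
    !![Complex.sin (Z + 2 * (e - i) * η), Complex.sin (2 * (e - i) * η);
      Complex.sin (2 * i * η), Complex.sin (Z + 2 * i * η)] := by
  ext s t
  fin_cases s <;> fin_cases t <;> refine congrArg Complex.sin ?_ <;> push_cast <;> ring

theorem fusWeight_add_two (e i : ℕ) (η Z : ℂ) : fusWeight (e + 2) η (Z + 2 * e * η) i =
    !![Complex.sin (Z + 2 * (e - i) * η), Complex.sin (2 * (e - i) * η + 2 * η);
      Complex.sin (2 * i * η), Complex.sin (Z + 2 * i * η - 2 * η)] := by
  ext s t
  fin_cases s <;> fin_cases t <;> refine congrArg Complex.sin ?_ <;> push_cast <;> ring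

theorem fusWeight_self (e i : ℕ) (η Z : ℂ) : fusWeight e η (Z + 2 * e * η) i =
    !![Complex.sin (Z + 2 * (e - i) * η), Complex.sin (2 * (e - i) * η - 2 * η);
      Complex.sin (2 * i * η), Complex.sin (Z + 2 * i * η + 2 * η)] := by
  ext s t
  fin_cases s <;> fin_cases t <;> refine congrArg Complex.sin ?_ <;> ring

/-- The multiplication map intertwines the fused product of `L`-operators with the next one. -/
theorem fusL_mul_fusProj (e : ℕ) (η Z : ℂ) (s t : Fin 2) :
    (Complex.sin Z • fusL (e + 2) η (Z + 2 * e * η) s t) * fusProj e =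
      fusProj e * ∑ r, fusL (e + 1) η (Z + 2 * e * η) s r ⊗ₖ spinL η Z r t := by
  ext k ⟨i, α⟩
  have hi := i.2
  have hl : ((Complex.sin Z • fusL (e + 2) η (Z + 2 * e * η) s t) * fusProj e) k (i, α) =
      Complex.sin Z * ((if (k : ℕ) = i + α + t - s then 1 else 0) *
        fusWeight (e + 2) η (Z + 2 * e * η) (i + α) s t) := by
    rw [Matrix.mul_apply, Finset.sum_eq_single (⟨i + α, by omega⟩ : Fin (e + 2))]
    · simp [fusProj, fusL_apply]
    · intro l _ hl
      simp only [fusProj, Matrix.of_apply]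
      rw [if_neg (fun h' => hl (Fin.ext h')), mul_zero]
    · simp
  have hr : (fusProj e * ∑ r, fusL (e + 1) η (Z + 2 * e * η) s r ⊗ₖ spinL η Z r t) k (i, α) =
      ∑ r : Fin 2, ∑ β : Fin 2, (if (k : ℕ) = i + r - s + β then 1 else 0) *
        fusWeight (e + 1) η (Z + 2 * e * η) i s r * spinL η Z r t β α := by
    simp only [Matrix.mul_sum, Matrix.sum_apply]
    refine Finset.sum_congr rfl fun r _ => ?_
    rw [Matrix.mul_apply, Fintype.sum_prod_type_right]
    refine Finset.sum_congr rfl fun β _ => ?_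
    rw [← sum_mul_fusL η (Z + 2 * e * η) (fun j => if (k : ℕ) = j + β then 1 else 0),
      Finset.sum_mul]
    simp [fusProj, mul_assoc]
  rw [hl, hr, fusWeight_add_two, fusWeight_add_one]
  have I₁ := sin_fusion_diag Z
  have I₂ := sin_fusion_off Z
  push_cast
  rw [show 2 * ((e : ℂ) - (i + (α : ℕ))) * η = 2 * (e - i) * η - (α : ℕ) * (2 * η) by ring,
    show 2 * ((i : ℂ) + (α : ℕ)) * η = 2 * i * η + (α : ℕ) * (2 * η) by ring]
  generalize 2 * ((e : ℂ) - i) * η = b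
  generalize ha : 2 * (i : ℂ) * η = a
  have hs (x : ℂ) : (if (k : ℕ) = i - 1 + 1 then Complex.sin a * x else 0) =
      if (k : ℕ) = i then Complex.sin a * x else 0 := by
    by_cases hi0 : (i : ℕ) = 0
    · have : a = 0 := by rw [← ha, hi0]; simp
      simp [this]
    · rw [Nat.sub_add_cancel (Nat.pos_of_ne_zero hi0)]
  clear hl hr
  fin_cases s <;> fin_cases t <;> fin_cases α <;>
    simp [spinL]
  · simp only [mul_comm]
  · rw [← add_sub_assoc, ← I₁]
    split_ifs <;> simp
  · rw [← I₂]
    split_ifs <;> simp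
  · simp only [mul_comm]
  · simp only [mul_comm]
  · rw [← I₂, hs]
    split_ifs <;> simp [add_comm]
  · rw [← I₁, hs]
    split_ifs <;> simp [add_comm]
  · rw [← add_assoc, add_sub_cancel_right]
    simp only [mul_comm]

/-- On the kernel of the multiplication map the fused product of `L`-operators restricts to the
previous one. -/
theorem fusL_mul_fusKer (e : ℕ) (η Z : ℂ) (s t : Fin 2) :
    (∑ r, fusL (e + 1) η (Z + 2 * e * η) s r ⊗ₖ spinL η Z r t) * fusKer e =
      fusKer e * (Complex.sin (Z - 2 * η) • fusL e η (Z + 2 * e * η) s t) := by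
  ext ⟨j, β⟩ k
  have hk := k.2
  have hr : (fusKer e * (Complex.sin (Z - 2 * η) • fusL e η (Z + 2 * e * η) s t)) (j, β) k =
      ((if β = 1 ∧ (j : ℕ) = k + t - s then 1 else 0) -
        (if β = 0 ∧ (j : ℕ) = k + t - s + 1 then 1 else 0)) *
        fusWeight e η (Z + 2 * e * η) k s t * Complex.sin (Z - 2 * η) := by
    rw [← sum_mul_fusL η (Z + 2 * e * η) (fun l => (if β = 1 ∧ (j : ℕ) = l then 1 else 0) -
        (if β = 0 ∧ (j : ℕ) = l + 1 then 1 else 0)), Finset.sum_mul, Matrix.mul_apply]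
    refine Finset.sum_congr rfl fun l _ => ?_
    rw [fusKer, Matrix.of_apply, Matrix.smul_apply, smul_eq_mul]
    ring
  have hl : ((∑ r, fusL (e + 1) η (Z + 2 * e * η) s r ⊗ₖ spinL η Z r t) * fusKer e) (j, β) k =
      ∑ r : Fin 2, ((if (j : ℕ) = k + r - s then
        fusWeight (e + 1) η (Z + 2 * e * η) k s r else 0) * spinL η Z r t β 1 -
        (if (j : ℕ) = k + 1 + r - s then
        fusWeight (e + 1) η (Z + 2 * e * η) (k + 1 : ℕ) s r else 0) * spinL η Z r t β 0) := by
    rw [Matrix.sum_mul, Matrix.sum_apply]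
    refine Finset.sum_congr rfl fun r _ => ?_
    rw [Matrix.mul_apply, Fintype.sum_prod_type_right, Fin.sum_univ_two,
      Finset.sum_eq_single (⟨k + 1, by omega⟩ : Fin (e + 1)),
      Finset.sum_eq_single (⟨k, by omega⟩ : Fin (e + 1))]
    · simp [fusKer, fusL_apply]
      ring
    · intro i _ hi
      have : ¬ (i : ℕ) = k := fun h' => hi (Fin.ext h')
      simp [fusKer, this]
    · simp
    · intro i _ hi
      have : ¬ (i : ℕ) = k + 1 := fun h' => hi (Fin.ext h')
      simp [fusKer, this]
    · simp
  rw [hl, hr, fusWeight_self, fusWeight_add_one, fusWeight_add_one]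
  have I₁ := sin_fusion_diag Z
  have I₂ := sin_fusion_off Z
  push_cast
  rw [show 2 * ((e : ℂ) - (k + 1)) * η = 2 * (e - k) * η - 2 * η by ring,
    show 2 * ((k : ℂ) + 1) * η = 2 * k * η + 2 * η by ring]
  generalize 2 * ((e : ℂ) - k) * η = b
  generalize ha : 2 * (k : ℂ) * η = a
  have hs (x : ℂ) : (if (j : ℕ) = k - 1 + 1 then Complex.sin a * x else 0) =
      if (j : ℕ) = k then Complex.sin a * x else 0 := by
    by_cases hi0 : (k : ℕ) = 0
    · have : a = 0 := by rw [← ha, hi0]; simp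
      simp [this]
    · rw [Nat.sub_add_cancel (Nat.pos_of_ne_zero hi0)]
  clear hl hr
  fin_cases s <;> fin_cases t <;> fin_cases β <;>
    simp [spinL]
  · have h := I₁ b (2 * η)
    split_ifs
    · rw [← add_sub_assoc]
      linear_combination h
    · simp
  · have h := I₂ (b - 2 * η) (2 * η)
    rw [sub_add_cancel] at h
    split_ifs
    · linear_combination -h
    · simp
  · have h := I₂ a (2 * η)
    rw [hs]
    split_ifs
    · linear_combination h
    · simp
  · rw [add_assoc]
  · have h := I₁ (a + 2 * η) (2 * η)
    rw [← add_assoc, add_sub_cancel_right] at h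
    split_ifs
    · linear_combination -h
    · simp

/-- The fusion relation between the transfer matrices of consecutive symmetric powers. -/
theorem transferMatrix_fusL_mul {N : ℕ} (e : ℕ) (η : ℂ) (μ : Fin N → ℂ) (Z : ℂ) :
    transferMatrix (fusL (e + 1) η) μ (Z + 2 * e * η) *
        transferMatrix (sixVertexL η) μ (Z - η) =
      (∏ i, Complex.sin (μ i + Z)) • transferMatrix (fusL (e + 2) η) μ (Z + 2 * e * η) +
      (∏ i, Complex.sin (μ i + Z - 2 * η)) • transferMatrix (fusL e η) μ (Z + 2 * e * η) := by
  simp only [transferMatrix_eq_chainTrace, chainTrace_mul, ← chainTrace_smul]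
  refine chainTrace_eq_add (fusProj e) (fusSec e) (fusKer e) (fusRet e) (fusProj_mul_fusSec e)
    (fusRet_mul_fusKer e) (fusSec_add_fusKer e) (fun i s t => ?_) (fun i s t => ?_)
  · simp only [Matrix.of_apply, ← add_sub_assoc, ← spinL_eq]
    rw [← add_assoc]
    exact fusL_mul_fusProj e η (μ i + Z) s t
  · simp only [Matrix.of_apply, ← add_sub_assoc, ← spinL_eq]
    rw [← add_assoc]
    exact fusL_mul_fusKer e η (μ i + Z) s t

theorem transferMatrix_fusL_zero {N : ℕ} (η : ℂ) (μ : Fin N → ℂ) (z : ℂ) :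
    transferMatrix (fusL 0 η) μ z = 0 := by
  ext s t
  simp [transferMatrix, Matrix.trace]

/-- The zeroth symmetric power is a scalar. -/
theorem transferMatrix_fusL_one {N : ℕ} (η : ℂ) (μ : Fin N → ℂ) (z : ℂ) :
    transferMatrix (fusL 1 η) μ z = (∏ i, Complex.sin (μ i + z)) • 1 := by
  have hL : ∀ (w : ℂ) (s t : Fin 2), fusL 1 η w s t =
      Matrix.scalar (Fin 1) (if s = t then Complex.sin w else 0) := by
    intro w s t
    ext a b
    obtain rfl := Subsingleton.elim a 0
    obtain rfl := Subsingleton.elim b 0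
    fin_cases s <;> fin_cases t <;> simp [fusL]
  ext s t
  rw [transferMatrix, Matrix.of_apply]
  simp only [hL]
  have hl : (List.ofFn fun i => Matrix.scalar (Fin 1) (if s i = t i then Complex.sin (μ i + z)
      else 0)) = (List.ofFn fun i => if s i = t i then Complex.sin (μ i + z) else 0).map
        (Matrix.scalar (Fin 1)) := by
    rw [List.map_ofFn]
    rfl
  rw [hl, ← map_list_prod, List.prod_ofFn, Finset.prod_ite_zero, Matrix.smul_apply,
    Matrix.one_apply]
  simp [Matrix.trace, funext_iff]

theorem sin_add_of_exp_eq_one {y : ℂ} (hy : Complex.exp (y * Complex.I) = 1) (x : ℂ) :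
    Complex.sin (x + y) = Complex.sin x := by
  rw [sin_eq_exp, sin_eq_exp, expI_add, hy, mul_one]

/-- At a root of unity the `(n - 1)`-th symmetric power differs from the fused `L`-operator by a
change of signs of basis vectors only. -/
theorem transferMatrix_symPowerL_eq_fusL {n N : ℕ} {η : ℂ}
    (hη : Complex.exp (2 * η * Complex.I) ^ n = 1) (μ : Fin N → ℂ) (z : ℂ) :
    transferMatrix (symPowerL n η) μ z = transferMatrix (fusL n η) μ z := by
  have hper : Complex.exp (2 * n * η * Complex.I) = 1 := by
    rw [← hη, ← Complex.exp_nat_mul]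
    ring_nf
  have hrefl (k : ℂ) : Complex.sin (2 * ((n : ℂ) - k) * η) = -Complex.sin (2 * k * η) := by
    rw [← Complex.sin_neg, ← sin_add_of_exp_eq_one hper (-(2 * k * η))]
    ring_nf
  rw [transferMatrix_eq_chainTrace, transferMatrix_eq_chainTrace]
  have hdd : Matrix.diagonal (fun k : Fin n => (-1 : ℂ) ^ (k : ℕ)) *
      Matrix.diagonal (fun k : Fin n => (-1 : ℂ) ^ (k : ℕ)) = 1 := by
    rw [Matrix.diagonal_mul_diagonal, ← Matrix.diagonal_one]
    congr 1
    funext k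
    rw [← mul_pow]
    simp
  refine chainTrace_eq_of_intertwine _ _ hdd hdd fun i s t => ?_
  ext j k
  rw [Matrix.mul_diagonal, Matrix.diagonal_mul]
  fin_cases s <;> fin_cases t <;> simp only [symPowerL, fusL, Matrix.of_apply, Fin.zero_eta,
    Fin.mk_one, Fin.isValue, Matrix.cons_val, Matrix.diagonal_apply]
  · split_ifs with h
    · rw [h, mul_comm]
    · simp
  · split_ifs with h
    · rw [hrefl, h, pow_succ]
      ring
    · simp
  · split_ifs with h
    · rw [hrefl, h, pow_succ]
      ring
    · simp
  · split_ifs with h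
    · rw [h, mul_comm, ← sin_add_of_exp_eq_one hper (μ i + z + 2 * ((k : ℕ) + 1 - n) * η)]
      ring_nf
    · simp

theorem continuous_transferMatrix_fusL {N : ℕ} (d : ℕ) (η : ℂ) (μ : Fin N → ℂ) :
    Continuous (transferMatrix (fusL d η) μ) := by
  simp only [funext fun z => transferMatrix_eq_chainTrace (fusL d η) μ z]
  refine continuous_chainTrace fun i s t k l => ?_
  simp only [fusL_apply]
  split_ifs
  · fin_cases s <;> fin_cases t <;> simp [fusWeight] <;> fun_prop
  · exact continuous_const

theorem eventually_prod_sin_ne_zero {N : ℕ} (μ : Fin N → ℂ) (a z : ℂ) :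
    ∀ᶠ w in nhdsWithin z {z}ᶜ, ∏ i, Complex.sin (μ i + (w + a)) ≠ 0 := by
  have h : ∀ᶠ w in nhdsWithin z {z}ᶜ, ∀ i, Complex.sin (μ i + (w + a)) ≠ 0 := by
    rw [Filter.eventually_all]
    intro i
    filter_upwards [eventually_sin_mul_sin_ne_zero (μ i + a) (μ i + a) z] with w hw
    convert left_ne_zero_of_mul hw using 2
    ring
  filter_upwards [h] with w hw using Finset.prod_ne_zero_iff.2 fun i _ => hw i

/-- On a vector on which the 6-vertex transfer matrix acts with the vacuum eigenvalue, the transfer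
matrices of all symmetric powers act with their vacuum eigenvalues. -/
theorem transferMatrix_fusL_mulVec {N : ℕ} (η : ℂ) (μ : Fin N → ℂ) {v : (Fin N → Fin 2) → ℂ}
    (hv : ∀ z, (transferMatrix (sixVertexL η) μ z).mulVec v =
      (∏ i, Complex.sin (μ i + (z + η)) + ∏ i, Complex.sin (μ i + (z - η))) • v) (d : ℕ) :
    ∀ z, (transferMatrix (fusL d η) μ z).mulVec v =
      (∑ k ∈ Finset.range d, ∏ i, Complex.sin (μ i + (z - 2 * k * η))) • v := by
  induction d using Nat.strong_induction_on with
  | _ d ih =>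
    match d with
    | 0 => simp [transferMatrix_fusL_zero]
    | 1 => simp [transferMatrix_fusL_one, Matrix.smul_mulVec]
    | e + 2 =>
      have gen : ∀ z, ∏ i, Complex.sin (μ i + (z + -(2 * e * η))) ≠ 0 →
          (transferMatrix (fusL (e + 2) η) μ z).mulVec v =
          (∑ k ∈ Finset.range (e + 2), ∏ i, Complex.sin (μ i + (z - 2 * k * η))) • v := by
        intro z hz
        have key := congrArg (fun A => A.mulVec v) (transferMatrix_fusL_mul e η μ (z - 2 * e * η))
        simp only [sub_add_cancel, ← Matrix.mulVec_mulVec, Matrix.add_mulVec, Matrix.smul_mulVec,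
          hv, Matrix.mulVec_smul, ih e (by omega), ih (e + 1) (by omega)] at key
        rw [← sub_eq_add_neg] at hz
        refine smul_right_injective _ hz ?_
        simp only
        rw [eq_sub_of_add_eq key.symm]
        simp only [Finset.sum_range_succ]
        have e₁ : ∏ i, Complex.sin (μ i + (z - 2 * e * η - η - η)) =
            ∏ i, Complex.sin (μ i + (z - 2 * ((e + 1 : ℕ) : ℂ) * η)) := by
          refine Finset.prod_congr rfl fun i _ => congrArg Complex.sin ?_
          push_cast; ring
        have e₂ : ∏ i, Complex.sin (μ i + (z - 2 * e * η) - 2 * η) =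
            ∏ i, Complex.sin (μ i + (z - 2 * ((e + 1 : ℕ) : ℂ) * η)) := by
          refine Finset.prod_congr rfl fun i _ => congrArg Complex.sin ?_
          push_cast; ring
        rw [e₁, e₂]
        module
      intro z
      have hcont : Continuous fun z => (transferMatrix (fusL (e + 2) η) μ z).mulVec v :=
        (continuous_transferMatrix_fusL (e + 2) η μ).matrix_mulVec continuous_const
      have hcont' : Continuous fun z : ℂ =>
          (∑ k ∈ Finset.range (e + 2), ∏ i, Complex.sin (μ i + (z - 2 * k * η))) • v := by
        fun_prop
      refine tendsto_nhds_unique (((hcont.tendsto z).mono_left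
        (nhdsWithin_le_nhds (s := {z}ᶜ))).congr' ?_) ((hcont'.tendsto z).mono_left
        (nhdsWithin_le_nhds (s := {z}ᶜ)))
      filter_upwards [eventually_prod_sin_ne_zero μ (-(2 * e * η)) z] with w hw using gen w hw

theorem prod_ofFn_upperTriangular : ∀ {N : ℕ} (f : Fin N → Matrix (Fin 2) (Fin 2) ℂ),
    (∀ i, f i 1 0 = 0) → (List.ofFn f).prod 1 0 = 0 ∧
      (List.ofFn f).prod 0 0 = ∏ i, f i 0 0 ∧ (List.ofFn f).prod 1 1 = ∏ i, f i 1 1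
  | 0, f, _ => by simp
  | N + 1, f, hf => by
    obtain ⟨h₁, h₂, h₃⟩ := prod_ofFn_upperTriangular (fun i => f i.succ) fun i => hf i.succ
    rw [List.ofFn_succ, List.prod_cons, Fin.prod_univ_succ, Fin.prod_univ_succ]
    simp [Matrix.mul_apply, hf 0, h₁, h₂, h₃]

theorem nakedVacuum_eq (N : ℕ) : nakedVacuum N = Pi.single 0 1 := by
  funext s
  by_cases hs : s = 0
  · subst hs
    simp [nakedVacuum]
  · rw [Pi.single_eq_of_ne hs]
    obtain ⟨i, hi⟩ := Function.ne_iff.1 hs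
    refine Finset.prod_eq_zero (Finset.mem_univ i) ?_
    have : s i = 1 := Fin.eq_one_of_ne_zero _ hi
    rw [this]
    rfl

theorem nakedVacuum_ne_zero (N : ℕ) : nakedVacuum N ≠ 0 := by
  rw [nakedVacuum_eq]
  exact Pi.single_ne_zero_iff.2 one_ne_zero

/-- The naked vacuum is an eigenvector of the 6-vertex transfer matrix. -/
theorem sixVertex_mulVec_nakedVacuum {N : ℕ} (η : ℂ) (μ : Fin N → ℂ) (z : ℂ) :
    (transferMatrix (sixVertexL η) μ z).mulVec (nakedVacuum N) =
      (∏ i, Complex.sin (μ i + (z + η)) + ∏ i, Complex.sin (μ i + (z - η))) • nakedVacuum N := by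
  rw [nakedVacuum_eq, Matrix.mulVec_single_one]
  funext s
  have htri (i : Fin N) : sixVertexL η (μ i + z) (s i) ((0 : Fin N → Fin 2) i) 1 0 = 0 := by
    rw [Pi.zero_apply]
    generalize s i = a
    fin_cases a <;> simp [sixVertexL]
  obtain ⟨-, h₀, h₁⟩ := prod_ofFn_upperTriangular _ htri
  simp only [Matrix.col_apply, transferMatrix, Matrix.of_apply, Matrix.trace_fin_two, h₀, h₁,
    Pi.smul_apply, smul_eq_mul]
  by_cases hs : s = 0
  · subst hs
    simp [sixVertexL, add_assoc, add_sub_assoc]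
  · rw [Pi.single_eq_of_ne hs, mul_zero]
    obtain ⟨i, hi⟩ := Function.ne_iff.1 hs
    replace hi : s i = 1 := Fin.eq_one_of_ne_zero _ hi
    rw [Finset.prod_eq_zero (Finset.mem_univ i), Finset.prod_eq_zero (Finset.mem_univ i), add_zero]
    · simp [sixVertexL, hi]
    · simp [sixVertexL, hi]

end Fusion

/-! ### Refactorization of products of two cyclic transfer matrices -/

section Refactor

variable {n : ℕ} [NeZero n] {η : ℂ} (hq : IsPrimitiveRoot (Complex.exp (2 * η * Complex.I)) n)

theorem sin_nat_mul_add (n : ℕ) (c d : ℂ) : Complex.sin (n * (c + d)) =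
    (Complex.exp (2 * c * Complex.I) ^ n * Complex.exp (2 * d * Complex.I) ^ n - 1) *
      -(Complex.I / (2 * Complex.exp (c * Complex.I) ^ n * Complex.exp (d * Complex.I) ^ n)) := by
  have hc := pow_ne_zero n (Complex.exp_ne_zero (c * Complex.I))
  have hd := pow_ne_zero n (Complex.exp_ne_zero (d * Complex.I))
  rw [sin_eq_exp, mul_assoc, Complex.exp_nat_mul, expI_add, expI_two, expI_two]
  simp only [mul_pow]
  field_simp
  ring

theorem sin_nat_mul_sub (n : ℕ) (c d : ℂ) : Complex.sin (n * (c - d)) =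
    (Complex.exp (2 * c * Complex.I) ^ n - Complex.exp (2 * d * Complex.I) ^ n) *
      -(Complex.I / (2 * Complex.exp (c * Complex.I) ^ n * Complex.exp (d * Complex.I) ^ n)) := by
  have hc := pow_ne_zero n (Complex.exp_ne_zero (c * Complex.I))
  have hd := pow_ne_zero n (Complex.exp_ne_zero (d * Complex.I))
  rw [sin_eq_exp, mul_assoc, Complex.exp_nat_mul, expI_sub, expI_two, expI_two]
  simp only [mul_pow, inv_pow]
  field_simp
  ring

include hq in
/-- The two zeros of the quantum determinant can be interchanged at the expense of a change of `ξ`.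
This is `cycT_swap` in exponential variables. -/
theorem cycY_swap (hodd : Odd n) {N : ℕ} (μ : Fin N → ℂ) {ξ ξ' c y₁ y₂ x p : ℂ}
    (hx : x = Complex.exp (2 * c * Complex.I) ^ n) (hp : p = Complex.exp ((y₁ - y₂) * Complex.I) ^ n)
    (h₁ : x * p - 1 ≠ 0) (h₂ : x - p ≠ 0)
    (hξ : Complex.exp (ξ' * Complex.I) ^ n * (x - p) =
      Complex.exp (ξ * Complex.I) ^ n * (x * p - 1)) :
    cycY n η μ ξ c y₁ y₂ = cycY n η μ ξ' c y₂ y₁ := by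
  have hp' : p = Complex.exp (2 * ((y₁ - y₂) / 2) * Complex.I) ^ n := by
    rw [hp, mul_div_cancel₀ _ (two_ne_zero' ℂ)]
  have hne : -(Complex.I / (2 * Complex.exp (c * Complex.I) ^ n *
      Complex.exp ((y₁ - y₂) / 2 * Complex.I) ^ n)) ≠ 0 :=
    neg_ne_zero.2 (div_ne_zero Complex.I_ne_zero (mul_ne_zero (mul_ne_zero two_ne_zero
      (pow_ne_zero _ (Complex.exp_ne_zero _))) (pow_ne_zero _ (Complex.exp_ne_zero _))))
  rw [cycY, cycY, show (y₂ - y₁) / 2 = -((y₁ - y₂) / 2) by ring, add_comm y₂ y₁]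
  apply cycT_swap hq hodd
  · rw [sin_nat_mul_add, ← hx, ← hp']
    exact mul_ne_zero h₁ hne
  · rw [sin_nat_mul_sub, ← hx, ← hp']
    exact mul_ne_zero h₂ hne
  · rw [sin_nat_mul_add, sin_nat_mul_sub, ← hx, ← hp', ← mul_assoc, hξ, mul_assoc]

theorem exists_exp_pow_eq (n : ℕ) [NeZero n] {w : ℂ} (hw : w ≠ 0) :
    ∃ a, Complex.exp (a * Complex.I) ^ n = w := by
  have hn : (n : ℂ) ≠ 0 := Nat.cast_ne_zero.2 (NeZero.ne n)
  refine ⟨Complex.log w / (n * Complex.I), ?_⟩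
  rw [← Complex.exp_nat_mul]
  conv_rhs => rw [← Complex.exp_log hw]
  congr 1
  field_simp

include hq in
/-- Two exchanges with an interchange of zeros in between swap the two spectral parameters in a
product of cyclic transfer matrices. -/
theorem cycT_refactor (hodd : Odd n) {N : ℕ} (μ : Fin N → ℂ) {ξ₁ ξ₂ l c t z z' R P u A B : ℂ}
    (hR : R = Complex.exp ((ξ₁ - ξ₂) * Complex.I) ^ n)
    (hP : P = Complex.exp ((z' - z) * Complex.I) ^ n)
    (hu : u = Complex.exp (-(2 * t) * Complex.I) ^ n)
    (hA : A = P ^ 2 * u - R * P - 1 + R * P * u) (hB : B = P * u - R - P + R * P ^ 2 * u)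
    (h₁ : P * u - R ≠ 0) (h₂ : 1 - R * P * u ≠ 0) (hA₀ : A ≠ 0) (hB₀ : B ≠ 0)
    (h₃ : P * B ^ 2 - R * u * A ^ 2 ≠ 0) (h₄ : u * B ^ 2 - R * P * A ^ 2 ≠ 0)
    (hl : Complex.exp (l * Complex.I) ^ n = R * A / B)
    (hc : Complex.exp (2 * c * Complex.I) ^ n = (P * u - R) * (P * B ^ 2 - R * u * A ^ 2) /
      ((1 - R * P * u) * (u * B ^ 2 - R * P * A ^ 2))) :
    cycT n η μ ξ₁ 0 t z * cycT n η μ ξ₂ 0 t z' =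
      cycT n η μ (ξ₂ + l) c t z' * cycT n η μ (ξ₁ - l) (-c) t z := by
  obtain ⟨D, hD⟩ : ∃ D, D = 1 - R * P * u := ⟨_, rfl⟩
  obtain ⟨E, hE⟩ : ∃ E, E = u * B ^ 2 - R * P * A ^ 2 := ⟨_, rfl⟩
  rw [← hD] at h₂ hc
  rw [← hE] at h₄ hc
  have hR0 : R ≠ 0 := hR ▸ pow_ne_zero _ (Complex.exp_ne_zero _)
  have hu0 : u ≠ 0 := hu ▸ pow_ne_zero _ (Complex.exp_ne_zero _)
  have hP0 : P ≠ 0 := hP ▸ pow_ne_zero _ (Complex.exp_ne_zero _)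
  obtain ⟨τ₂, hτ₂⟩ := exists_exp_pow_eq n (div_ne_zero h₁ h₂)
  obtain ⟨τ, rfl⟩ : ∃ τ, τ₂ = 2 * τ := ⟨τ₂ / 2, by ring⟩
  have hT (ξ c z : ℂ) : cycT n η μ ξ c t z = cycY n η μ ξ c (z + t) (z - t) := by
    rw [cycY]; ring_nf
  have hx : Complex.exp (2 * τ * Complex.I) ^ n = (P * u - R) / D := hτ₂
  have hxp : (P * u - R) / D * P - 1 = A / D := by
    field_simp; rw [hA, hD]; ring
  have hxm : (P * u - R) / D - P = B / D := by
    field_simp; rw [hB, hD]; ring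
  rw [hT, hT, hT, hT]
  -- exchange the zeros `z + t` and `z' - t`
  rw [cycY_exchange hq hodd μ (τ := τ) 0 0 hR (p := P * u) (by
    rw [hP, hu, ← mul_pow, ← expI_add]; ring_nf) h₁ (by rwa [← mul_assoc, ← hD])
      (by rwa [← mul_assoc, ← hD]),
    zero_add, zero_sub]
  -- interchange the two zeros in each factor
  rw [cycY_swap hq hodd μ (ξ := ξ₁) (ξ' := ξ₂ + l) (c := τ) hx.symm (p := P) (by
      rw [hP]; ring_nf) (by rw [hxp]; exact div_ne_zero hA₀ h₂)
    (by rw [hxm]; exact div_ne_zero hB₀ h₂) (by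
      rw [hxp, hxm, expI_add, mul_pow, hl, hR, expI_sub, mul_pow, inv_pow]
      have := Complex.exp_ne_zero (ξ₂ * Complex.I)
      field_simp)]
  rw [cycY_swap hq hodd μ (ξ := ξ₂) (ξ' := ξ₁ - l) (c := -τ) (x := D / (P * u - R)) (by
      rw [mul_neg, expI_neg, inv_pow, hx, inv_div]) (p := P) (by rw [hP]; ring_nf)
    (by
      rw [show D / (P * u - R) * P - 1 = -B / (P * u - R) by field_simp; rw [hB, hD]; ring]
      exact div_ne_zero (neg_ne_zero.2 hB₀) h₁)
    (by
      rw [show D / (P * u - R) - P = -A / (P * u - R) by field_simp; rw [hA, hD]; ring]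
      exact div_ne_zero (neg_ne_zero.2 hA₀) h₁)
    (by
      rw [show D / (P * u - R) * P - 1 = -B / (P * u - R) by field_simp; rw [hB, hD]; ring,
        show D / (P * u - R) - P = -A / (P * u - R) by field_simp; rw [hA, hD]; ring,
        expI_sub, mul_pow, inv_pow, hl, hR, expI_sub, mul_pow, inv_pow]
      have := Complex.exp_ne_zero (ξ₂ * Complex.I)
      have := Complex.exp_ne_zero (ξ₁ * Complex.I)
      field_simp)]
  -- exchange the zeros `z - t` and `z' + t`
  have hR' : R * A ^ 2 / B ^ 2 = Complex.exp ((ξ₂ + l - (ξ₁ - l)) * Complex.I) ^ n := by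
    rw [expI_sub, mul_pow, inv_pow, expI_add, mul_pow, expI_sub, mul_pow, inv_pow, hl, hR, expI_sub,
      mul_pow, inv_pow]
    have := Complex.exp_ne_zero (ξ₂ * Complex.I)
    have := Complex.exp_ne_zero (ξ₁ * Complex.I)
    field_simp
  have e₁ : P / u - R * A ^ 2 / B ^ 2 = (P * B ^ 2 - R * u * A ^ 2) / (u * B ^ 2) := by
    field_simp
  have e₂ : 1 - R * A ^ 2 / B ^ 2 * (P / u) = E / (u * B ^ 2) := by
    rw [hE]; field_simp
  rw [cycY_exchange hq hodd μ (τ := c - τ) τ (-τ) hR' (p := P / u) (by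
      rw [hP, hu, div_eq_mul_inv, ← inv_pow, ← expI_neg, ← mul_pow, ← expI_add]; ring_nf)
    (by rw [e₁]; exact div_ne_zero h₃ (mul_ne_zero hu0 (pow_ne_zero _ hB₀)))
    (by rw [e₂]; exact div_ne_zero h₄ (mul_ne_zero hu0 (pow_ne_zero _ hB₀)))
    (by
      rw [e₁, e₂, show 2 * (c - τ) = 2 * c - 2 * τ by ring, expI_sub, mul_pow, inv_pow, hx, hc]
      field_simp)]
  rw [add_sub_cancel, show -τ - (c - τ) = -c by ring]

include hq in
/-- Near `t = 0` the parameters of the refactorization are differentiable functions of `t`, and the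
shift of the parameter `c` vanishes to second order. -/
theorem exists_cycT_refactor (hodd : Odd n) {N : ℕ} (μ : Fin N → ℂ) {ξ₁ ξ₂ z z' R P : ℂ}
    (hR : R = Complex.exp ((ξ₁ - ξ₂) * Complex.I) ^ n)
    (hP : P = Complex.exp ((z' - z) * Complex.I) ^ n)
    (hPR : P - R ≠ 0) (hRP : 1 - R * P ≠ 0) (hPP : P ^ 2 - 1 ≠ 0) :
    ∃ (l c : ℂ → ℂ) (l' : ℂ), l 0 = 0 ∧ HasDerivAt l l' 0 ∧ c 0 = 0 ∧ HasDerivAt c 0 0 ∧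
      ∀ᶠ t in nhds 0, cycT n η μ ξ₁ 0 t z * cycT n η μ ξ₂ 0 t z' =
        cycT n η μ (ξ₂ + l t) (c t) t z' * cycT n η μ (ξ₁ - l t) (-c t) t z := by
  have hn : (n : ℂ) ≠ 0 := Nat.cast_ne_zero.2 (NeZero.ne n)
  have hR0 : R ≠ 0 := hR ▸ pow_ne_zero _ (Complex.exp_ne_zero _)
  set u : ℂ → ℂ := fun t => Complex.exp (-(2 * t) * Complex.I) ^ n with hu
  set A : ℂ → ℂ := fun t => P ^ 2 * u t - R * P - 1 + R * P * u t with hA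
  set B : ℂ → ℂ := fun t => P * u t - R - P + R * P ^ 2 * u t with hB
  have hu0 : u 0 = 1 := by simp [hu]
  have hA0 : A 0 = P ^ 2 - 1 := by simp only [hA, hu0]; ring
  have hB0 : B 0 = R * (P ^ 2 - 1) := by simp only [hB, hu0]; ring
  have hud : Differentiable ℂ u := by fun_prop
  have hAd : Differentiable ℂ A := by fun_prop
  have hBd : Differentiable ℂ B := by fun_prop
  set num : ℂ → ℂ := fun t => (P * u t - R) * (P * B t ^ 2 - R * u t * A t ^ 2) with hnum
  set den : ℂ → ℂ := fun t => (1 - R * P * u t) * (u t * B t ^ 2 - R * P * A t ^ 2) with hden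
  have hnumd : Differentiable ℂ num := by fun_prop
  have hdend : Differentiable ℂ den := by fun_prop
  have hnum0 : num 0 ≠ 0 := by
    have : num 0 = -((P - R) * (P ^ 2 - 1) ^ 2 * R * (1 - R * P)) := by
      simp only [hnum, hu0, hA0, hB0]; ring
    rw [this]
    exact neg_ne_zero.2 (mul_ne_zero (mul_ne_zero (mul_ne_zero hPR (pow_ne_zero _ hPP)) hR0) hRP)
  have hnd : num 0 = den 0 := by
    simp only [hnum, hden, hu0, hA0, hB0]; ring
  have hden0 : den 0 ≠ 0 := hnd ▸ hnum0
  -- numerator and denominator agree to second order at `u = 1`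
  have hf : HasDerivAt (fun t => num t / den t) 0 0 := by
    obtain ⟨g, hg, hgd⟩ : ∃ g : ℂ → ℂ, Differentiable ℂ g ∧
        ∀ t, num t = den t + (u t - 1) ^ 2 * g t := by
      refine ⟨fun t => R ^ 2 * (P ^ 2 - 1) ^ 2 * R * P +
          2 * R * (P ^ 2 - 1) * (P * (R * P + 1)) * (P ^ 2 - 1 + 2 * R * P) +
          (P * (R * P + 1)) ^ 2 * (P ^ 2 - 1) + R * (-(P * (P ^ 2 - 1) ^ 2) -
          2 * (P ^ 2 - 1) * (P * (P + R)) * (R * (P ^ 2 - 1) + 2 * P) -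
          (P * (P + R)) ^ 2 * R * (P ^ 2 - 1)) +
          (2 * R * (P ^ 2 - 1) * (P * (R * P + 1)) * R * P +
          (P * (R * P + 1)) ^ 2 * (P ^ 2 - 1 + 2 * R * P) +
          R * (-(2 * (P ^ 2 - 1) * (P * (P + R)) * P) -
          (P * (P + R)) ^ 2 * (R * (P ^ 2 - 1) + 2 * P))) * (u t - 1) +
          ((P * (R * P + 1)) ^ 2 * R * P - R * (P * (P + R)) ^ 2 * P) * (u t - 1) ^ 2, ?_,
        fun t => ?_⟩
      · fun_prop
      · simp only [hnum, hden, hA, hB]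
        generalize u t = w
        ring
    have h₁ : HasDerivAt (fun t => (u t - 1) ^ 2) 0 0 := by
      have := ((hud 0).hasDerivAt.sub_const 1).pow 2
      simpa [hu0, Pi.pow_def] using this
    have h₂ := (h₁.mul ((hg 0).div (hdend 0) hden0).hasDerivAt).const_add 1
    rw [hu0, sub_self, zero_pow two_ne_zero, zero_mul, zero_mul, add_zero] at h₂
    refine h₂.congr_of_eventuallyEq ?_
    filter_upwards [hdend.continuous.continuousAt.eventually_ne hden0] with t ht
    rw [hgd]
    simp only [Pi.mul_apply, Pi.div_apply]
    field_simp
  have hlg : HasDerivAt (fun t => R * A t / B t) (deriv (fun t => R * A t / B t) 0) 0 := by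
    refine DifferentiableAt.hasDerivAt (((hAd 0).const_mul R).div (hBd 0) ?_)
    rw [hB0]
    exact mul_ne_zero hR0 hPP
  have hlg0 : R * A 0 / B 0 = 1 := by
    rw [hA0, hB0]
    exact div_self (mul_ne_zero hR0 hPP)
  have hpow (w k : ℂ) (hw : w ≠ 0) (hk : k ≠ 0) :
      Complex.exp (k * (Complex.log w / (k * n * Complex.I)) * Complex.I) ^ n = w := by
    rw [← Complex.exp_nat_mul]
    conv_rhs => rw [← Complex.exp_log hw]
    congr 1
    field_simp
  refine ⟨fun t => Complex.log (R * A t / B t) / (n * Complex.I),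
    fun t => Complex.log (num t / den t) / (2 * n * Complex.I), _, ?_,
    (hlg.clog (by rw [hlg0]; exact Complex.one_mem_slitPlane)).div_const _, ?_, ?_, ?_⟩
  · simp only [hlg0, Complex.log_one, zero_div]
  · simp only [hnd, div_self hden0, Complex.log_one, zero_div]
  · have := (hf.clog (by
      rw [hnd, div_self hden0]; exact Complex.one_mem_slitPlane)).div_const (2 * n * Complex.I)
    simpa using this
  · filter_upwards [hnumd.continuous.continuousAt.eventually_ne hnum0,
      hdend.continuous.continuousAt.eventually_ne hden0,
      hAd.continuous.continuousAt.eventually_ne (by rw [hA0]; exact hPP),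
      hBd.continuous.continuousAt.eventually_ne (by rw [hB0]; exact mul_ne_zero hR0 hPP)]
      with t h₁ h₂ h₃ h₄
    refine cycT_refactor hq hodd μ hR hP (u := u t) (A := A t) (B := B t) rfl rfl rfl
      (left_ne_zero_of_mul h₁) (left_ne_zero_of_mul h₂) h₃ h₄ (right_ne_zero_of_mul h₁)
      (right_ne_zero_of_mul h₂) ?_ ?_
    · have := hpow (R * A t / B t) 1 (div_ne_zero (mul_ne_zero hR0 h₃) h₄) one_ne_zero
      rwa [one_mul, one_mul] at this
    · exact hpow _ 2 (div_ne_zero h₁ h₂) two_ne_zero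

end Refactor

/-! ### Derivatives of the cyclic transfer matrices -/

section Derivative

variable {n : ℕ} [NeZero n] {η : ℂ} (hq : IsPrimitiveRoot (Complex.exp (2 * η * Complex.I)) n)

theorem contDiff_chainTrace {κ X : Type*} [Fintype κ] [DecidableEq κ] [NormedAddCommGroup X]
    [NormedSpace ℂ X] {N : ℕ} {W : X → Fin N → Block κ}
    (hW : ∀ i s t k l, ContDiff ℂ 1 fun x => W x i s t k l) (s t : Fin N → Fin 2) :
    ContDiff ℂ 1 fun x => chainTrace (W x) s t := by
  have key : ∀ {N : ℕ} {f : X → Fin N → Matrix κ κ ℂ},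
      (∀ i k l, ContDiff ℂ 1 fun x => f x i k l) →
      ∀ k l, ContDiff ℂ 1 fun x => (List.ofFn (f x)).prod k l := by
    intro N
    induction N with
    | zero => intro f _ k l; simpa using contDiff_const
    | succ N ih =>
      intro f hf k l
      simp only [List.ofFn_succ, List.prod_cons, Matrix.mul_apply]
      exact ContDiff.sum fun j _ => (hf 0 k j).mul (ih (fun i => hf i.succ) j l)
  simp only [chainTrace, Matrix.of_apply, Matrix.trace, Matrix.diag_apply]
  exact ContDiff.sum fun k _ => key (fun i k l => hW i _ _ k l) k k

/-- The cyclic transfer matrix is continuously differentiable in `(ξ, c, d)`. -/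
theorem contDiff_cycT {N : ℕ} (μ : Fin N → ℂ) (z : ℂ) (a b : Fin N → Fin 2) :
    ContDiff ℂ 1 fun x : ℂ × ℂ × ℂ => cycT n η μ x.1 x.2.1 x.2.2 z a b := by
  refine contDiff_chainTrace (fun i s t k l => ?_) a b
  have hexp : ContDiff ℂ 1 fun x : ℂ × ℂ × ℂ => Complex.exp (x.1 * Complex.I) :=
    (contDiff_fst.mul contDiff_const).cexp
  fin_cases s <;> fin_cases t <;>
    simp only [cycL, raise, lower, Matrix.of_apply, Fin.zero_eta, Fin.mk_one, Fin.isValue,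
      Matrix.cons_val, Matrix.diagonal_apply] <;> split_ifs <;> try exact contDiff_const
  · fun_prop
  · fun_prop
  · exact (hexp.inv fun x => Complex.exp_ne_zero _).neg.mul (by fun_prop)
  · fun_prop

/-- The derivative of the cyclic transfer matrix with parameter `c = 0` in the direction of the
splitting `d` of the two zeros of the quantum determinant, at `d = 0`. -/
noncomputable def cycD (n : ℕ) [NeZero n] {N : ℕ} (η : ℂ) (μ : Fin N → ℂ) (ξ z : ℂ) :
    Matrix (Fin N → Fin 2) (Fin N → Fin 2) ℂ :=
  Matrix.of fun a b => deriv (fun t => cycT n η μ ξ 0 t z a b) 0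

/-- If `G` vanishes on the first axis, its derivative along a curve that is tangent to the plane
spanned by the first and the third axis depends only on the third component of the velocity. -/
theorem hasDerivAt_curve {G : ℂ × ℂ × ℂ → ℂ} {ξ : ℂ} (hG : DifferentiableAt ℂ G (ξ, 0, 0))
    (h₀ : ∀ ξ, G (ξ, 0, 0) = 0) {l c : ℂ → ℂ} {l' : ℂ} (hl₀ : l 0 = 0) (hl : HasDerivAt l l' 0)
    (hc₀ : c 0 = 0) (hc : HasDerivAt c 0 0) :
    HasDerivAt (fun t => G (ξ + l t, c t, t)) (deriv (fun t => G (ξ, 0, t)) 0) 0 := by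
  have hG' := hG.hasFDerivAt
  have e₁ : fderiv ℂ G (ξ, 0, 0) (1, 0, 0) = 0 := by
    have h : HasDerivAt (fun x : ℂ => ((x, 0, 0) : ℂ × ℂ × ℂ)) (1, 0, 0) ξ :=
      (hasDerivAt_id ξ).prodMk ((hasDerivAt_const ξ (0 : ℂ)).prodMk (hasDerivAt_const ξ (0 : ℂ)))
    have := hG'.comp_hasDerivAt ξ h
    refine this.unique ?_
    have hz : G ∘ (fun x : ℂ => ((x, 0, 0) : ℂ × ℂ × ℂ)) = fun _ => 0 := funext h₀
    rw [hz]
    exact hasDerivAt_const _ _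
  have e₂ : fderiv ℂ G (ξ, 0, 0) (0, 0, 1) = deriv (fun t => G (ξ, 0, t)) 0 := by
    have h : HasDerivAt (fun t : ℂ => ((ξ, 0, t) : ℂ × ℂ × ℂ)) (0, 0, 1) 0 :=
      (hasDerivAt_const _ ξ).prodMk ((hasDerivAt_const _ (0 : ℂ)).prodMk (hasDerivAt_id _))
    exact (hG'.comp_hasDerivAt 0 h).deriv.symm
  have h : HasDerivAt (fun t : ℂ => ((ξ + l t, c t, t) : ℂ × ℂ × ℂ)) (l', 0, 1) 0 :=
    (hl.const_add ξ).prodMk (hc.prodMk (hasDerivAt_id _))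
  have hG'' : HasFDerivAt G (fderiv ℂ G (ξ, 0, 0)) (ξ + l 0, c 0, 0) := by
    rw [hl₀, hc₀, add_zero]; exact hG'
  have := hG''.comp_hasDerivAt 0 h
  rw [show ((l', 0, 1) : ℂ × ℂ × ℂ) = l' • (1, 0, 0) + (0, 0, 1) by simp, map_add, map_smul, e₁, e₂,
    smul_zero, zero_add] at this
  exact this

/-- Along a curve that leaves the point `c = d = 0` in the direction of `d`, up to a change of the
irrelevant parameter `ξ`, the transfer matrix has the derivative `cycD` on any subspace where it
vanishes at that point. -/
theorem tendsto_cycT_curve {N : ℕ} (μ : Fin N → ℂ) (ξ z : ℂ)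
    {Q : Matrix (Fin N → Fin 2) (Fin N → Fin 2) ℂ} (h₀ : ∀ ξ, cycT n η μ ξ 0 0 z * Q = 0)
    {l c : ℂ → ℂ} {l' : ℂ} (hl₀ : l 0 = 0) (hl : HasDerivAt l l' 0)
    (hc₀ : c 0 = 0) (hc : HasDerivAt c 0 0) :
    Filter.Tendsto (fun t => t⁻¹ • (cycT n η μ (ξ + l t) (c t) t z * Q)) (nhdsWithin 0 {0}ᶜ)
      (nhds (cycD n η μ ξ z * Q)) := by
  refine tendsto_pi_nhds.2 fun a => tendsto_pi_nhds.2 fun b => ?_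
  set G : ℂ × ℂ × ℂ → ℂ := fun x => (cycT n η μ x.1 x.2.1 x.2.2 z * Q) a b with hG
  have hd (e : Fin N → Fin 2) : Differentiable ℂ fun x : ℂ × ℂ × ℂ =>
      cycT n η μ x.1 x.2.1 x.2.2 z a e := (contDiff_cycT μ z a e).differentiable one_ne_zero
  have hGd : Differentiable ℂ G := by
    simp only [hG, Matrix.mul_apply]
    exact Differentiable.fun_sum fun e _ => (hd e).mul_const _
  have h := hasDerivAt_curve (ξ := ξ) (hGd _) (fun ξ => by
    simp only [hG]; rw [h₀]; rfl) hl₀ hl hc₀ hc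
  have hderiv : deriv (fun t => G (ξ, 0, t)) 0 = (cycD n η μ ξ z * Q) a b := by
    simp only [hG, cycD, Matrix.mul_apply, Matrix.of_apply]
    rw [deriv_fun_sum fun e _ => ?_]
    · refine Finset.sum_congr rfl fun e _ => ?_
      rw [deriv_mul_const_field]
    · exact (((hd e).comp (g := fun x : ℂ × ℂ × ℂ => cycT n η μ x.1 x.2.1 x.2.2 z a e)
        (f := fun t : ℂ => ((ξ, 0, t) : ℂ × ℂ × ℂ)) (by fun_prop)).mul_const _) 0
  rw [hderiv] at h
  have hs := h.tendsto_slope_zero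
  refine hs.congr fun t => ?_
  have : (cycT n η μ (ξ + l 0) (c 0) 0 z * Q) a b = 0 := by rw [hc₀, h₀]; rfl
  simp only [hG, zero_add, this, sub_zero]
  rfl

theorem continuous_cycD {N : ℕ} (μ : Fin N → ℂ) (z : ℂ) :
    Continuous fun ξ => cycD n η μ ξ z := by
  refine continuous_matrix fun a b => ?_
  set G : ℂ × ℂ × ℂ → ℂ := fun x => cycT n η μ x.1 x.2.1 x.2.2 z a b with hG
  have hGc : ContDiff ℂ 1 G := contDiff_cycT μ z a b
  have h : ∀ ξ, cycD n η μ ξ z a b = fderiv ℂ G (ξ, 0, 0) (0, 0, 1) := by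
    intro ξ
    have hc : HasDerivAt (fun t : ℂ => ((ξ, 0, t) : ℂ × ℂ × ℂ)) (0, 0, 1) 0 :=
      (hasDerivAt_const _ ξ).prodMk ((hasDerivAt_const _ (0 : ℂ)).prodMk (hasDerivAt_id _))
    exact ((hGc.differentiable one_ne_zero _).hasFDerivAt.comp_hasDerivAt 0 hc).deriv
  simp only [h]
  have hcont := hGc.continuous_fderiv one_ne_zero
  fun_prop

/-- The shift by `π` changes the sign because `n` is odd. -/
theorem exp_add_pi_pow (hodd : Odd n) (ξ : ℂ) :
    Complex.exp ((ξ + Real.pi) * Complex.I) ^ n = -Complex.exp (ξ * Complex.I) ^ n := by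
  rw [expI_add, Complex.exp_pi_mul_I, mul_neg_one, hodd.neg_pow]

include hq in
/-- The shift of `ξ` by `π` reverses the sign of the derivative: at `c = 0` it amounts to the
interchange of the two zeros of the quantum determinant, which is `d ↦ -d`. -/
theorem cycD_add_pi (hodd : Odd n) {N : ℕ} (μ : Fin N → ℂ) (ξ z : ℂ) :
    cycD n η μ (ξ + Real.pi) z = -cycD n η μ ξ z := by
  have hn : (n : ℂ) ≠ 0 := Nat.cast_ne_zero.2 (NeZero.ne n)
  have hsin : ∀ᶠ t : ℂ in nhdsWithin 0 {0}ᶜ, Complex.sin (n * t) ≠ 0 := by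
    have h : HasDerivAt (fun t : ℂ => Complex.sin (n * t)) (n : ℂ) 0 := by
      simpa using ((hasDerivAt_id (0 : ℂ)).const_mul (n : ℂ)).csin
    simpa using h.eventually_ne hn (c := 0)
  have hev : ∀ᶠ t : ℂ in nhds 0,
      cycT n η μ (ξ + Real.pi) 0 t z = cycT n η μ ξ 0 (-t) z := by
    rw [eventually_nhdsWithin_iff] at hsin
    filter_upwards [hsin] with t ht
    by_cases h0 : t = 0
    · rw [h0, neg_zero, cycT_zero_zero hq, cycT_zero_zero hq]
    · have ht := ht h0
      refine cycT_swap hq hodd μ z (by rwa [zero_add]) ?_ ?_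
      · rw [zero_sub, mul_neg, Complex.sin_neg]
        exact neg_ne_zero.2 ht
      · rw [exp_add_pi_pow hodd, zero_sub, zero_add, mul_neg, Complex.sin_neg]
        ring
  ext a b
  simp only [cycD, Matrix.of_apply, Matrix.neg_apply]
  have : (fun t => cycT n η μ (ξ + Real.pi) 0 t z a b) =ᶠ[nhds 0]
      fun t => cycT n η μ ξ 0 (-t) z a b := by
    filter_upwards [hev] with t ht
    rw [ht]
  rw [this.deriv_eq, deriv_comp_neg (f := fun t => cycT n η μ ξ 0 t z a b), neg_zero]

include hq in
/-- Multiplying by a projection onto a common invariant subspace, the operators `cycD` at two zeros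
of the eigenvalue of `T₀` commute, for generic parameters. -/
theorem cycD_comm_of_generic (hodd : Odd n) {N : ℕ} (μ : Fin N → ℂ)
    {Q : Matrix (Fin N → Fin 2) (Fin N → Fin 2) ℂ}
    (hQ : ∀ ξ c t z, Q * (cycT n η μ ξ c t z * Q) = cycT n η μ ξ c t z * Q) {z z' ξ₁ ξ₂ : ℂ}
    (hz : transferMatrix (symPowerL n η) μ z * Q = 0)
    (hz' : transferMatrix (symPowerL n η) μ z' * Q = 0)
    (hPP : (Complex.exp ((z' - z) * Complex.I) ^ n) ^ 2 ≠ 1)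
    (hPR : Complex.exp ((ξ₁ - ξ₂) * Complex.I) ^ n ≠ Complex.exp ((z' - z) * Complex.I) ^ n)
    (hRP : Complex.exp ((ξ₁ - ξ₂) * Complex.I) ^ n ≠ (Complex.exp ((z' - z) * Complex.I) ^ n)⁻¹) :
    cycD n η μ ξ₁ z * Q * (cycD n η μ ξ₂ z' * Q) =
      cycD n η μ ξ₂ z' * Q * (cycD n η μ ξ₁ z * Q) := by
  have hP0 : Complex.exp ((z' - z) * Complex.I) ^ n ≠ 0 := pow_ne_zero _ (Complex.exp_ne_zero _)
  obtain ⟨l, c, l', hl₀, hl, hc₀, hc, hev⟩ := exists_cycT_refactor hq hodd μ (ξ₁ := ξ₁) (ξ₂ := ξ₂)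
    (z := z) (z' := z') rfl rfl (sub_ne_zero.2 hPR.symm)
    (fun h => hRP (eq_inv_of_mul_eq_one_left (sub_eq_zero.1 h).symm)) (sub_ne_zero.2 hPP)
  have h₀ : ∀ ξ, cycT n η μ ξ 0 0 z * Q = 0 := fun ξ => by rw [cycT_zero_zero hq, hz]
  have h₀' : ∀ ξ, cycT n η μ ξ 0 0 z' * Q = 0 := fun ξ => by rw [cycT_zero_zero hq, hz']
  have t₁ := tendsto_cycT_curve μ ξ₁ z h₀ (l := 0) (c := 0) rfl (hasDerivAt_const _ _) rfl
    (hasDerivAt_const _ _)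
  have t₂ := tendsto_cycT_curve μ ξ₂ z' h₀' (l := 0) (c := 0) rfl (hasDerivAt_const _ _) rfl
    (hasDerivAt_const _ _)
  have t₃ := tendsto_cycT_curve μ ξ₂ z' h₀' hl₀ hl hc₀ hc
  have t₄ := tendsto_cycT_curve μ ξ₁ z h₀ (l := -l) (c := -c) (by simp [hl₀]) hl.neg (by simp [hc₀])
    (by simpa using hc.neg)
  refine tendsto_nhds_unique (t₁.mul t₂) ((t₃.mul t₄).congr' ?_)
  filter_upwards [hev.filter_mono nhdsWithin_le_nhds] with t ht
  simp only [Pi.zero_apply, add_zero, Pi.neg_apply, ← sub_eq_add_neg]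
  rw [smul_mul_smul_comm, smul_mul_smul_comm, Matrix.mul_assoc, hQ, Matrix.mul_assoc, hQ,
    ← Matrix.mul_assoc, ← Matrix.mul_assoc, ht]

include hq in
/-- The operators `cycD` at two different zeros commute for all parameters, by continuity from
generic ones. -/
theorem cycD_comm (hodd : Odd n) {N : ℕ} (μ : Fin N → ℂ)
    {Q : Matrix (Fin N → Fin 2) (Fin N → Fin 2) ℂ}
    (hQ : ∀ ξ c t z, Q * (cycT n η μ ξ c t z * Q) = cycT n η μ ξ c t z * Q) {z z' : ℂ}
    (hz : transferMatrix (symPowerL n η) μ z * Q = 0)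
    (hz' : transferMatrix (symPowerL n η) μ z' * Q = 0)
    (hPP : (Complex.exp ((z' - z) * Complex.I) ^ n) ^ 2 ≠ 1) (ξ₁ ξ₂ : ℂ) :
    cycD n η μ ξ₁ z * Q * (cycD n η μ ξ₂ z' * Q) =
      cycD n η μ ξ₂ z' * Q * (cycD n η μ ξ₁ z * Q) := by
  have hn : (n : ℂ) ≠ 0 := Nat.cast_ne_zero.2 (NeZero.ne n)
  have hc : Continuous fun ξ => cycD n η μ ξ z * Q :=
    (continuous_cycD μ z).matrix_mul continuous_const
  have hder : HasDerivAt (fun ξ : ℂ => Complex.exp ((ξ - ξ₂) * Complex.I) ^ n)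
      (n * Complex.exp ((ξ₁ - ξ₂) * Complex.I) ^ (n - 1) *
        (Complex.exp ((ξ₁ - ξ₂) * Complex.I) * (1 * Complex.I))) ξ₁ :=
    ((((hasDerivAt_id ξ₁).sub_const ξ₂).mul_const Complex.I).cexp).pow n
  have hne (w : ℂ) : ∀ᶠ ξ : ℂ in nhdsWithin ξ₁ {ξ₁}ᶜ,
      Complex.exp ((ξ - ξ₂) * Complex.I) ^ n ≠ w :=
    hder.eventually_ne (mul_ne_zero (mul_ne_zero hn (pow_ne_zero _ (Complex.exp_ne_zero _)))
      (mul_ne_zero (Complex.exp_ne_zero _) (mul_ne_zero one_ne_zero Complex.I_ne_zero)))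
  refine tendsto_nhds_unique_of_eventuallyEq (l := nhdsWithin ξ₁ {ξ₁}ᶜ)
    (((hc.matrix_mul continuous_const).tendsto ξ₁).mono_left nhdsWithin_le_nhds)
    (((continuous_const.matrix_mul hc).tendsto ξ₁).mono_left nhdsWithin_le_nhds) ?_
  filter_upwards [hne _, hne _] with ξ h₁ h₂
  exact cycD_comm_of_generic hq hodd μ hQ hz hz' hPP h₁ h₂

include hq in
/-- At a zero of the eigenvalue of `T₀` the square of `cycD` is the square of the derivative of that
eigenvalue. -/
theorem cycD_mul_self (hodd : Odd n) {N : ℕ} (μ : Fin N → ℂ)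
    {Q : Matrix (Fin N → Fin 2) (Fin N → Fin 2) ℂ}
    (hQ : ∀ ξ c t z, Q * (cycT n η μ ξ c t z * Q) = cycT n η μ ξ c t z * Q) {w : ℂ → ℂ}
    (hw : ∀ z, transferMatrix (symPowerL n η) μ z * Q = w z • Q) {z w' : ℂ} (hz : w z = 0)
    (hw' : HasDerivAt w w' z) (ξ : ℂ) :
    cycD n η μ ξ z * Q * (cycD n η μ ξ z * Q) = w' ^ 2 • Q := by
  have h₀ : ∀ ξ, cycT n η μ ξ 0 0 z * Q = 0 := fun ξ => by
    rw [cycT_zero_zero hq, hw, hz, zero_smul]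
  have t₁ := tendsto_cycT_curve μ ξ z h₀ (l := 0) (c := 0) rfl (hasDerivAt_const _ _) rfl
    (hasDerivAt_const _ _)
  have t₂ := tendsto_cycT_curve μ (ξ + Real.pi) z h₀ (l := 0) (c := 0) rfl (hasDerivAt_const _ _) rfl
    (hasDerivAt_const _ _)
  have w₁ : Filter.Tendsto (fun t => t⁻¹ • w (z + t)) (nhdsWithin 0 {0}ᶜ) (nhds w') := by
    simpa [hz] using hw'.tendsto_slope_zero
  have w₂ : Filter.Tendsto (fun t => t⁻¹ • w (z - t)) (nhdsWithin 0 {0}ᶜ) (nhds (-w')) := by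
    have hd : HasDerivAt (fun t => w (z - t)) (-w') 0 := by
      have h : HasDerivAt w w' (z - 0) := by rwa [sub_zero]
      simpa [Function.comp_def] using h.comp (0 : ℂ) ((hasDerivAt_id (0 : ℂ)).const_sub z)
    simpa [hz] using hd.tendsto_slope_zero
  have key : cycD n η μ ξ z * Q * (cycD n η μ (ξ + Real.pi) z * Q) = (-w' * w') • Q := by
    refine tendsto_nhds_unique (t₁.mul t₂) (((w₂.mul w₁).smul_const Q).congr' ?_)
    -- exchanging the zeros `z + t` and `z - t` of two factors with opposite signs of `cycD` gives
    -- a product of two transfer matrices without splitting, at `z - t` and `z + t`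
    have hu : Continuous fun t : ℂ => Complex.exp ((z - t - (z + t)) * Complex.I) ^ n + 1 := by
      fun_prop
    filter_upwards [(hu.continuousAt (x := 0)).eventually_ne (y := 0) (by norm_num) |>.filter_mono
      nhdsWithin_le_nhds] with t ht
    simp only [Pi.zero_apply, add_zero]
    have hexch := cycY_exchange hq hodd μ (ξ₁ := ξ) (ξ₂ := ξ + Real.pi) (τ := 0) 0 0
      (y₁ := z + t) (y₂ := z - t) (y₃ := z + t) (y₄ := z - t) (R := -1)
      (by
        rw [show ξ - (ξ + Real.pi) = -(0 + (Real.pi : ℂ)) by ring, expI_neg, inv_pow,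
          exp_add_pi_pow hodd]
        simp) rfl (by simpa using ht) (by simpa [add_comm] using ht)
      (by
        rw [mul_zero, zero_mul, Complex.exp_zero, one_pow, sub_neg_eq_add, neg_one_mul,
          sub_neg_eq_add, add_comm, div_self (by rwa [add_comm])])
    simp only [cycY, add_zero, sub_self, zero_div] at hexch
    rw [show (z + t - (z - t)) / 2 = t by ring, show (z + t + (z - t)) / 2 = z by ring,
      show (z - t + (z - t)) / 2 = z - t by ring, show (z + t + (z + t)) / 2 = z + t by ring,
      cycT_zero_zero hq, cycT_zero_zero hq] at hexch
    rw [smul_mul_smul_comm, smul_mul_smul_comm, Matrix.mul_assoc, hQ, ← Matrix.mul_assoc, hexch, Matrix.mul_assoc, hw,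
      Matrix.mul_smul, hw, smul_smul, smul_smul]
    congr 1
    simp only [smul_eq_mul]
    ring
  rw [cycD_add_pi hq hodd, Matrix.neg_mul, Matrix.mul_neg, neg_eq_iff_eq_neg] at key
  rw [key, ← neg_smul]
  congr 1
  ring

end Derivative

/-! ### Commuting families of involutions that change sign along a path -/

section Involutions

/-- The trace of an involution in terms of the dimension of its eigenspace with eigenvalue `1`. -/
theorem trace_eq_of_mul_self_eq_one {V : Type*} [AddCommGroup V] [Module ℂ V]
    [FiniteDimensional ℂ V] {s : Module.End ℂ V} (hs : s * s = 1) :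
    LinearMap.trace ℂ V s = 2 * (Module.finrank ℂ (LinearMap.range ((2 : ℂ)⁻¹ • (1 + s))) : ℂ) -
      (Module.finrank ℂ V : ℂ) := by
  have hp : IsIdempotentElem ((2 : ℂ)⁻¹ • (1 + s)) := by
    rw [IsIdempotentElem, smul_mul_smul_comm, add_mul, mul_add, mul_add, hs]
    simp only [one_mul, mul_one]
    module
  have h := (LinearMap.IsIdempotentElem.isProj_range _ hp).trace
  rw [map_smul, map_add, LinearMap.trace_one, smul_eq_mul] at h
  linear_combination 2 * h

/-- If each of `M` involutions can be deformed through involutions into its negative, in such a way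
that different members of the family commute at all times, then `2 ^ M` divides the dimension: the
trace of an involution is an integer, hence constant along the path, hence zero, and so the
eigenspaces of the first involution have half the dimension and carry the remaining ones. -/
theorem two_pow_dvd_finrank (M : ℕ) : ∀ (V : Type*) [AddCommGroup V] [Module ℂ V]
    [FiniteDimensional ℂ V] (S : Fin M → ℝ → Module.End ℂ V), (∀ i x, S i x * S i x = 1) →
    (∀ i, S i 1 = -S i 0) →
    (∀ i (f : V →ₗ[ℂ] ℂ) v, Continuous fun x => f (S i x v)) →
    (∀ i j x y, i ≠ j → S i x * S j y = S j y * S i x) → 2 ^ M ∣ Module.finrank ℂ V := by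
  induction M with
  | zero => intros; simp
  | succ M ih =>
    intro V _ _ _ S hsq hneg hcont hcomm
    set b := Module.finBasis ℂ V
    have htc : Continuous fun x => LinearMap.trace ℂ V (S 0 x) := by
      simp only [LinearMap.trace_eq_matrix_trace ℂ b, Matrix.trace, Matrix.diag_apply,
        LinearMap.toMatrix_apply]
      exact continuous_finsetSum _ fun i _ => hcont 0 (b.coord i) (b i)
    have htr0 : LinearMap.trace ℂ V (S 0 0) = 0 := by
      have hmaps : Set.MapsTo (fun x => LinearMap.trace ℂ V (S 0 x)) Set.univ
          (Set.range (((↑) : ℝ → ℂ) ∘ ((↑) : ℤ → ℝ))) := by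
        intro x _
        refine ⟨2 * (Module.finrank ℂ (LinearMap.range ((2 : ℂ)⁻¹ • (1 + S 0 x))) : ℤ) -
          Module.finrank ℂ V, ?_⟩
        simp only [trace_eq_of_mul_self_eq_one (hsq 0 x), Function.comp_apply]
        push_cast
        rfl
      have := isPreconnected_univ.constant_of_mapsTo (Complex.isometry_ofReal.isEmbedding.comp
        Real.isClosedEmbedding_intCast.isEmbedding).isDiscrete_range htc.continuousOn hmaps (Set.mem_univ (0 : ℝ))
        (Set.mem_univ (1 : ℝ))
      simp only [hneg, map_neg] at this
      exact CharZero.eq_neg_self_iff.1 this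
    set p := (2 : ℂ)⁻¹ • (1 + S 0 0) with hp
    have hdim : Module.finrank ℂ V = 2 * Module.finrank ℂ (LinearMap.range p) := by
      have := trace_eq_of_mul_self_eq_one (hsq 0 0)
      rw [htr0, eq_comm, sub_eq_zero] at this
      exact_mod_cast this.symm
    have hinv (i : Fin M) (x : ℝ) : ∀ v ∈ LinearMap.range p, S i.succ x v ∈ LinearMap.range p := by
      rintro _ ⟨v, rfl⟩
      have h : S i.succ x * p = p * S i.succ x := by
        rw [hp, mul_smul_comm, smul_mul_assoc, mul_add, add_mul, mul_one, one_mul,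
          hcomm _ _ _ _ (Fin.succ_ne_zero i)]
      exact ⟨S i.succ x v, (LinearMap.congr_fun h v).symm⟩
    rw [hdim, pow_succ']
    refine mul_dvd_mul_left 2 (ih _ (fun i x => (S i.succ x).restrict (hinv i x)) ?_ ?_ ?_ ?_)
    · intro i x
      ext v
      exact LinearMap.congr_fun (hsq i.succ x) v
    · intro i
      ext v
      exact LinearMap.congr_fun (hneg i.succ) v
    · intro i f v
      obtain ⟨g, hg⟩ := LinearMap.exists_extend f
      have h (x : ℝ) : f ((S i.succ x).restrict (hinv i x) v) = g (S i.succ x v) := by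
        rw [← hg]; rfl
      simp only [h]
      exact hcont i.succ g v
    · intro i j x y hij
      ext v
      exact LinearMap.congr_fun (hcomm i.succ j.succ x y ((Fin.succ_injective _).ne hij)) v

end Involutions

/-! ### The degeneracy of the vacuum eigenvalue -/

section Degeneracy

variable {n : ℕ} [NeZero n] {η : ℂ} (hq : IsPrimitiveRoot (Complex.exp (2 * η * Complex.I)) n)

/-- The vacuum eigenvalue of the 6-vertex transfer matrix. -/
noncomputable def vacuumSix {N : ℕ} (η : ℂ) (μ : Fin N → ℂ) (z : ℂ) : ℂ :=
  ∏ i, Complex.sin (μ i + (z + η)) + ∏ i, Complex.sin (μ i + (z - η))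

/-- The vacuum eigenvalue of the transfer matrix of the `(n - 1)`-th symmetric power. -/
noncomputable def vacuumSym {N : ℕ} (n : ℕ) (η : ℂ) (μ : Fin N → ℂ) (z : ℂ) : ℂ :=
  ∑ k ∈ Finset.range n, ∏ i, Complex.sin (μ i + (z - 2 * k * η))

theorem differentiable_vacuumSym {N : ℕ} (n : ℕ) (η : ℂ) (μ : Fin N → ℂ) :
    Differentiable ℂ (vacuumSym n η μ) := by
  unfold vacuumSym
  fun_prop

include hq in
theorem symPowerL_mulVec_of_mem {N : ℕ} (μ : Fin N → ℂ) {v : (Fin N → Fin 2) → ℂ}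
    (hv : v ∈ eigenspaceOf (transferMatrix (sixVertexL η) μ) (vacuumSix η μ)) (z : ℂ) :
    (transferMatrix (symPowerL n η) μ z).mulVec v = vacuumSym n η μ z • v := by
  rw [transferMatrix_symPowerL_eq_fusL hq.pow_eq_one]
  exact transferMatrix_fusL_mulVec η μ hv n z

include hq in
theorem cycT_mulVec_mem {N : ℕ} (μ : Fin N → ℂ) {Λ : ℂ → ℂ} (ξ c d z : ℂ)
    {v : (Fin N → Fin 2) → ℂ} (hv : v ∈ eigenspaceOf (transferMatrix (sixVertexL η) μ) Λ) :
    (cycT n η μ ξ c d z).mulVec v ∈ eigenspaceOf (transferMatrix (sixVertexL η) μ) Λ := by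
  intro z'
  rw [Matrix.mulVec_mulVec, cycT_comm_sixVertex hq, ← Matrix.mulVec_mulVec, hv z',
    Matrix.mulVec_smul]

theorem exists_projection_matrix {ι : Type*} [Fintype ι] [DecidableEq ι]
    (E : Submodule ℂ (ι → ℂ)) : ∃ Q : Matrix ι ι ℂ, (∀ v, Q.mulVec v ∈ E) ∧
      ∀ v ∈ E, Q.mulVec v = v := by
  obtain ⟨f, hf⟩ := LinearMap.exists_leftInverse_of_injective E.subtype E.ker_subtype
  refine ⟨LinearMap.toMatrix' (E.subtype ∘ₗ f), fun v => ?_, fun v hv => ?_⟩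
  · rw [← Matrix.toLin'_apply, Matrix.toLin'_toMatrix']
    exact (f v).2
  · rw [← Matrix.toLin'_apply, Matrix.toLin'_toMatrix']
    exact congrArg Subtype.val (LinearMap.congr_fun hf ⟨v, hv⟩)

include hq in
/-- Simple zeros of the vacuum eigenvalue of `T₀` that differ modulo `π / n` produce commuting
involutions of the eigenspace, so that each of them doubles the dimension. -/
theorem two_pow_dvd_finrank_eigenspaceOf (hodd : Odd n) {N M : ℕ} (μ : Fin N → ℂ) (z : Fin M → ℂ)
    (hz : ∀ i, vacuumSym n η μ (z i) = 0) (hz' : ∀ i, deriv (vacuumSym n η μ) (z i) ≠ 0)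
    (hzz : ∀ i j, i ≠ j → (Complex.exp ((z j - z i) * Complex.I) ^ n) ^ 2 ≠ 1) :
    2 ^ M ∣ Module.finrank ℂ
      (eigenspaceOf (transferMatrix (sixVertexL η) μ) (vacuumSix η μ)) := by
  set E := eigenspaceOf (transferMatrix (sixVertexL η) μ) (vacuumSix η μ) with hE
  obtain ⟨Q, hQE, hQv⟩ := exists_projection_matrix E
  have hQ_of {A : Matrix (Fin N → Fin 2) (Fin N → Fin 2) ℂ} (hA : ∀ v ∈ E, A.mulVec v ∈ E) :
      Q * (A * Q) = A * Q := by
    refine Matrix.toLin'.injective (LinearMap.ext fun v => ?_)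
    simp only [Matrix.toLin'_apply, ← Matrix.mulVec_mulVec]
    exact hQv _ (hA _ (hQE v))
  have hQ : ∀ ξ c t z, Q * (cycT n η μ ξ c t z * Q) = cycT n η μ ξ c t z * Q := fun ξ c t z =>
    hQ_of fun v hv => cycT_mulVec_mem hq μ ξ c t z hv
  have hw : ∀ z, transferMatrix (symPowerL n η) μ z * Q = vacuumSym n η μ z • Q := by
    intro z
    refine Matrix.toLin'.injective (LinearMap.ext fun v => ?_)
    simp only [Matrix.toLin'_apply, ← Matrix.mulVec_mulVec, Matrix.smul_mulVec]
    exact symPowerL_mulVec_of_mem hq μ (hQE v) z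
  have hw0 (i : Fin M) : transferMatrix (symPowerL n η) μ (z i) * Q = 0 := by
    rw [hw, hz, zero_smul]
  have hDQ (i : Fin M) (ξ : ℂ) : Q * (cycD n η μ ξ (z i) * Q) = cycD n η μ ξ (z i) * Q := by
    have h₁ := tendsto_cycT_curve μ ξ (z i) (Q := Q) (fun ξ => by rw [cycT_zero_zero hq, hw0])
      (l := 0) (c := 0) rfl (hasDerivAt_const _ _) rfl (hasDerivAt_const _ _)
    refine tendsto_nhds_unique (h₁.const_mul Q) (h₁.congr fun t => ?_)
    rw [Matrix.mul_smul, hQ]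
  have hDE (i : Fin M) (ξ : ℂ) : ∀ v ∈ E, (cycD n η μ ξ (z i)).mulVec v ∈ E := by
    intro v hv
    have := congrArg (fun A => A.mulVec v) (hDQ i ξ)
    simp only [← Matrix.mulVec_mulVec, hQv v hv] at this
    rw [← this]
    exact hQE _
  have happ {A B : Matrix (Fin N → Fin 2) (Fin N → Fin 2) ℂ} {v : (Fin N → Fin 2) → ℂ}
      (hv : v ∈ E) (hB : ∀ v ∈ E, B.mulVec v ∈ E) :
      (A * Q * (B * Q)).mulVec v = A.mulVec (B.mulVec v) := by
    simp only [← Matrix.mulVec_mulVec]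
    rw [hQv v hv, hQv _ (hB v hv)]
  -- the involution at the zero number `i`, as a function of `ξ = π x`
  let S (i : Fin M) (x : ℝ) : Module.End ℂ E := (deriv (vacuumSym n η μ) (z i))⁻¹ •
    (Matrix.toLin' (cycD n η μ (x * Real.pi) (z i))).restrict (hDE i (x * Real.pi))
  have hS (i : Fin M) (x : ℝ) (v : E) : ((S i x v : E) : (Fin N → Fin 2) → ℂ) =
      (deriv (vacuumSym n η μ) (z i))⁻¹ • (cycD n η μ (x * Real.pi) (z i)).mulVec v := rfl
  refine two_pow_dvd_finrank M E S (fun i x => ?_) (fun i => ?_) (fun i f v => ?_)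
    (fun i j x y hij => ?_)
  · refine LinearMap.ext fun v => Subtype.ext ?_
    have h := congrArg (fun A => A.mulVec (v : (Fin N → Fin 2) → ℂ)) (cycD_mul_self hq hodd μ hQ hw
      (hz i) ((differentiable_vacuumSym n η μ) (z i)).hasDerivAt (x * Real.pi))
    simp only [happ v.2 (hDE i _), Matrix.smul_mulVec, hQv _ v.2] at h
    rw [Module.End.mul_apply, hS, hS, Matrix.mulVec_smul, h, smul_smul, smul_smul, Module.End.one_apply]
    have := hz' i
    field_simp
    rw [one_smul]
  · refine LinearMap.ext fun v => Subtype.ext ?_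
    rw [LinearMap.neg_apply, Submodule.coe_neg, hS, hS]
    have := cycD_add_pi hq hodd μ 0 (z i)
    rw [zero_add] at this
    rw [Complex.ofReal_one, one_mul, Complex.ofReal_zero, zero_mul, this, Matrix.neg_mulVec, smul_neg]
  · obtain ⟨g, hg⟩ := LinearMap.exists_extend f
    have h (x : ℝ) : f (S i x v) = g ((deriv (vacuumSym n η μ) (z i))⁻¹ •
        (cycD n η μ (x * Real.pi) (z i)).mulVec v) := by
      rw [← hS, ← hg]; rfl
    simp only [h]
    have hc : Continuous fun x : ℝ => (cycD n η μ (x * Real.pi) (z i)).mulVec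
        (v : (Fin N → Fin 2) → ℂ) :=
      ((continuous_cycD μ (z i)).comp (by fun_prop)).matrix_mulVec continuous_const
    exact (LinearMap.continuous_of_finiteDimensional g).comp
      (hc.const_smul (deriv (vacuumSym n η μ) (z i))⁻¹)
  · refine LinearMap.ext fun v => Subtype.ext ?_
    have h := congrArg (fun A => A.mulVec (v : (Fin N → Fin 2) → ℂ)) (cycD_comm hq hodd μ hQ
      (hw0 i) (hw0 j) (hzz i j hij) (x * Real.pi) (y * Real.pi))
    simp only [happ v.2 (hDE i _), happ v.2 (hDE j _)] at h
    rw [Module.End.mul_apply, Module.End.mul_apply, hS, hS, hS, hS, Matrix.mulVec_smul,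
      Matrix.mulVec_smul, h, smul_comm]

end Degeneracy

/-! ### The polynomial behind the vacuum eigenvalue of `T₀` -/

section ZeroPolynomial

open Polynomial

/-- The polynomial `∏ (e ^ {i μ_j} X - e ^ {-i μ_j})`, which is the product of the vacuum weights
in the variable `X = e ^ {2iz}` up to an invertible factor. -/
noncomputable def chainPoly {N : ℕ} (μ : Fin N → ℂ) : ℂ[X] :=
  ∏ i, (C (Complex.exp (μ i * Complex.I)) * X - C (Complex.exp (-μ i * Complex.I)))

/-- The polynomial whose zeros are the values of `e ^ {2inz}` at the zeros `z` of the vacuum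
eigenvalue of `T₀`. -/
noncomputable def zeroPoly (n : ℕ) {N : ℕ} (μ : Fin N → ℂ) : ℂ[X] := contract n (chainPoly μ)

theorem natDegree_chainPoly {N : ℕ} (μ : Fin N → ℂ) : (chainPoly μ).natDegree = N := by
  rw [chainPoly, natDegree_prod]
  · simp only [sub_eq_add_neg, ← C_neg, natDegree_linear (Complex.exp_ne_zero _)]
    simp
  · intro i _ h
    have := natDegree_linear (b := -Complex.exp (-μ i * Complex.I))
      (Complex.exp_ne_zero (μ i * Complex.I))
    rw [C_neg, ← sub_eq_add_neg, h] at this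
    simp at this

theorem chainPoly_ne_zero {N : ℕ} (μ : Fin N → ℂ) : chainPoly μ ≠ 0 := by
  intro h
  have h0 : (chainPoly μ).eval 0 = 0 := by rw [h, eval_zero]
  simp [chainPoly, eval_prod, Finset.prod_eq_zero_iff, Complex.exp_ne_zero] at h0

theorem natDegree_zeroPoly {n N : ℕ} (hn : n ≠ 0) (hN : n ∣ N) (μ : Fin N → ℂ) :
    (zeroPoly n μ).natDegree = N / n := by
  refine natDegree_eq_of_le_of_coeff_ne_zero ?_ ?_
  · rw [natDegree_le_iff_coeff_eq_zero]
    intro l hl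
    rw [zeroPoly, coeff_contract hn]
    refine coeff_eq_zero_of_natDegree_lt ?_
    rw [natDegree_chainPoly]
    exact (Nat.div_lt_iff_lt_mul (Nat.pos_of_ne_zero hn)).1 hl
  · rw [zeroPoly, coeff_contract hn, Nat.div_mul_cancel hN]
    have := leadingCoeff_ne_zero.2 (chainPoly_ne_zero μ)
    rwa [leadingCoeff, natDegree_chainPoly] at this

theorem eval_zero_zeroPoly {n N : ℕ} (hn : n ≠ 0) (μ : Fin N → ℂ) : (zeroPoly n μ).eval 0 ≠ 0 := by
  rw [← coeff_zero_eq_eval_zero, zeroPoly, coeff_contract hn, zero_mul, coeff_zero_eq_eval_zero]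
  simp [chainPoly, eval_prod, Finset.prod_eq_zero_iff, Complex.exp_ne_zero]

/-- Averaging a polynomial over the rotations by `n`-th roots of unity retains the coefficients
whose index is divisible by `n`. -/
theorem sum_eval_mul_pow {n : ℕ} {ζ : ℂ} (hζ : IsPrimitiveRoot ζ n) (hn : n ≠ 0) (A : ℂ[X]) (x : ℂ) :
    ∑ k ∈ Finset.range n, A.eval (x * ζ ^ k) = n * (contract n A).eval (x ^ n) := by
  have hB : (contract n A).eval (x ^ n) = ∑ l ∈ Finset.range (A.natDegree + 1),
      (if n ∣ l then A.coeff l else 0) * x ^ l := by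
    rw [← expand_eval, eval_eq_sum_range' (n := A.natDegree + 1)]
    · refine Finset.sum_congr rfl fun l _ => ?_
      rw [coeff_expand (Nat.pos_of_ne_zero hn)]
      split_ifs with h
      · rw [coeff_contract hn, Nat.div_mul_cancel h]
      · rfl
    · rw [Nat.lt_succ_iff, natDegree_le_iff_coeff_eq_zero]
      intro l hl
      rw [coeff_expand (Nat.pos_of_ne_zero hn)]
      split_ifs with h
      · rw [coeff_contract hn, Nat.div_mul_cancel h, coeff_eq_zero_of_natDegree_lt hl]
      · rfl
  simp only [eval_eq_sum_range]
  rw [Finset.sum_comm, ← eval_eq_sum_range, hB, Finset.mul_sum]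
  refine Finset.sum_congr rfl fun l _ => ?_
  have hs : ∑ k ∈ Finset.range n, (ζ ^ l) ^ k = if n ∣ l then (n : ℂ) else 0 := by
    split_ifs with h
    · rw [(hζ.pow_eq_one_iff_dvd l).2 h]
      simp
    · have h1 : ζ ^ l - 1 ≠ 0 := sub_ne_zero.2 fun h' => h ((hζ.pow_eq_one_iff_dvd l).1 h')
      refine (mul_eq_zero.1 ?_).resolve_right h1
      rw [geom_sum_mul, ← pow_mul, mul_comm, pow_mul, hζ.pow_eq_one, one_pow, sub_self]
  calc ∑ k ∈ Finset.range n, A.coeff l * (x * ζ ^ k) ^ l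
      = A.coeff l * x ^ l * ∑ k ∈ Finset.range n, (ζ ^ l) ^ k := by
        rw [Finset.mul_sum]
        refine Finset.sum_congr rfl fun k _ => ?_
        rw [mul_pow, ← pow_mul, ← pow_mul, mul_comm k l, mul_assoc]
    _ = _ := by
        rw [hs]
        split_ifs <;> ring

theorem prod_sin_eq_eval_chainPoly {N : ℕ} (μ : Fin N → ℂ) (z : ℂ) :
    ∏ i, Complex.sin (μ i + z) = (-Complex.I / 2) ^ N * (Complex.exp (z * Complex.I) ^ N)⁻¹ *
      (chainPoly μ).eval (Complex.exp (2 * z * Complex.I)) := by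
  have hprod : ((-Complex.I / 2) * (Complex.exp (z * Complex.I))⁻¹) ^ N =
      ∏ _i : Fin N, (-Complex.I / 2) * (Complex.exp (z * Complex.I))⁻¹ := by simp
  rw [chainPoly, eval_prod, ← inv_pow, ← mul_pow, hprod, ← Finset.prod_mul_distrib]
  refine Finset.prod_congr rfl fun i _ => ?_
  have h₁ := Complex.exp_ne_zero (μ i * Complex.I)
  have h₂ := Complex.exp_ne_zero (z * Complex.I)
  simp only [eval_sub, eval_mul, eval_C, eval_X]
  rw [sin_eq_exp, expI_add, expI_two, expI_neg]
  field_simp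
  ring

variable {n : ℕ} [NeZero n] {η : ℂ} (hq : IsPrimitiveRoot (Complex.exp (2 * η * Complex.I)) n)

include hq in
/-- The sum over the `n` weights of the vacuum retains those coefficients of `chainPoly` whose index
is divisible by `n`. Hence the eigenvalue has period `π / n` up to sign, and its zeros are given by
those of `zeroPoly`. -/
theorem vacuumSym_eq (hodd : Odd n) {N : ℕ} (hN : n ∣ N) (μ : Fin N → ℂ) (z : ℂ) :
    vacuumSym n η μ z = (n * (-Complex.I / 2) ^ N * (Complex.exp (z * Complex.I) ^ N)⁻¹) *
      (zeroPoly n μ).eval (Complex.exp (2 * z * Complex.I) ^ n) := by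
  have hζ : IsPrimitiveRoot ((Complex.exp (2 * η * Complex.I))⁻¹ ^ 2) n :=
    hq.inv.pow_of_coprime 2 hodd.coprime_two_left
  have hqN : Complex.exp (2 * η * Complex.I) ^ N = 1 := (hq.pow_eq_one_iff_dvd N).2 hN
  have hk (k : ℕ) : ∏ i, Complex.sin (μ i + (z - 2 * k * η)) =
      (-Complex.I / 2) ^ N * (Complex.exp (z * Complex.I) ^ N)⁻¹ *
      (chainPoly μ).eval (Complex.exp (2 * z * Complex.I) *
        ((Complex.exp (2 * η * Complex.I))⁻¹ ^ 2) ^ k) := by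
    have e₁ : Complex.exp ((z - 2 * k * η) * Complex.I) =
        Complex.exp (z * Complex.I) * (Complex.exp (2 * η * Complex.I))⁻¹ ^ k := by
      rw [expI_sub, inv_pow, ← Complex.exp_nat_mul]
      ring_nf
    rw [prod_sin_eq_eval_chainPoly, expI_two (z - 2 * k * η), e₁, mul_pow, ← pow_mul, mul_comm k N, pow_mul, inv_pow,
      hqN, inv_one, one_pow, mul_one, expI_two z]
    congr 2
    ring
  simp only [vacuumSym, hk, ← Finset.mul_sum]
  rw [sum_eval_mul_pow hζ (NeZero.ne n), zeroPoly]
  ring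

include hq in
theorem vacuumSym_eq_zero_iff (hodd : Odd n) {N : ℕ} (hN : n ∣ N) (μ : Fin N → ℂ) (z : ℂ) :
    vacuumSym n η μ z = 0 ↔ (zeroPoly n μ).eval (Complex.exp (2 * z * Complex.I) ^ n) = 0 := by
  rw [vacuumSym_eq hq hodd hN, mul_eq_zero, or_iff_right]
  exact mul_ne_zero (mul_ne_zero (Nat.cast_ne_zero.2 (NeZero.ne n)) (pow_ne_zero _ (by simp)))
    (inv_ne_zero (pow_ne_zero _ (Complex.exp_ne_zero _)))

include hq in
theorem deriv_vacuumSym_ne_zero_iff (hodd : Odd n) {N : ℕ} (hN : n ∣ N) (μ : Fin N → ℂ) {z : ℂ}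
    (hz : vacuumSym n η μ z = 0) : deriv (vacuumSym n η μ) z ≠ 0 ↔
      (zeroPoly n μ).derivative.eval (Complex.exp (2 * z * Complex.I) ^ n) ≠ 0 := by
  have hn : (n : ℂ) ≠ 0 := Nat.cast_ne_zero.2 (NeZero.ne n)
  rw [vacuumSym_eq_zero_iff hq hodd hN] at hz
  set c : ℂ → ℂ := fun z => n * (-Complex.I / 2) ^ N * (Complex.exp (z * Complex.I) ^ N)⁻¹ with hc
  have hc0 : c z ≠ 0 := mul_ne_zero (mul_ne_zero hn (pow_ne_zero _ (by simp)))
    (inv_ne_zero (pow_ne_zero _ (Complex.exp_ne_zero _)))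
  have hcd : DifferentiableAt ℂ c z := by
    refine DifferentiableAt.const_mul (DifferentiableAt.fun_inv (by fun_prop) ?_) _
    exact pow_ne_zero _ (Complex.exp_ne_zero _)
  have he : HasDerivAt (fun z => Complex.exp (2 * z * Complex.I) ^ n)
      (n * Complex.exp (2 * z * Complex.I) ^ (n - 1) *
        (Complex.exp (2 * z * Complex.I) * (2 * 1 * Complex.I))) z :=
    ((((hasDerivAt_id z).const_mul 2).mul_const Complex.I).cexp).pow n
  have hp := ((zeroPoly n μ).hasDerivAt (Complex.exp (2 * z * Complex.I) ^ n)).comp z he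
  have hw := hcd.hasDerivAt.mul hp
  rw [Function.comp_apply, hz, mul_zero, zero_add] at hw
  have hfun : vacuumSym n η μ = c * ((fun x => (zeroPoly n μ).eval x) ∘
      fun z => Complex.exp (2 * z * Complex.I) ^ n) := funext fun z => vacuumSym_eq hq hodd hN μ z
  rw [hfun, hw.deriv]
  have h₁ := Complex.exp_ne_zero (2 * z * Complex.I)
  simp [hc0, hn, h₁]

theorem analyticOrderAt_vacuumSym_eq_one_iff {N : ℕ} (μ : Fin N → ℂ) (z : ℂ) :
    analyticOrderAt (vacuumSym n η μ) z = 1 ↔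
      vacuumSym n η μ z = 0 ∧ deriv (vacuumSym n η μ) z ≠ 0 := by
  have han : AnalyticAt ℂ (vacuumSym n η μ) z := (differentiable_vacuumSym n η μ).analyticAt z
  refine ⟨fun h => ?_, fun h => han.analyticOrderAt_eq_one_of_zero_deriv_ne_zero h.1 h.2⟩
  have hz := apply_eq_zero_of_analyticOrderAt_ne_zero (by rw [h]; exact one_ne_zero)
  refine ⟨hz, ?_⟩
  have hd := han.analyticOrderAt_deriv_add_one
  simp only [hz, sub_zero] at hd
  rw [h] at hd
  have h0 : analyticOrderAt (deriv (vacuumSym n η μ)) z = 0 := by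
    have : analyticOrderAt (deriv (vacuumSym n η μ)) z + 1 = 0 + 1 := by rw [hd, zero_add]
    exact (ENat.add_left_injective_of_ne_top ENat.one_ne_top) this
  exact han.deriv.analyticOrderAt_eq_zero.1 h0

/-- The cardinality of an image depends only on which points are identified. -/
theorem encard_image_eq_of_kernel_eq {α β γ : Type*} {f : α → β} {g : α → γ}
    (h : ∀ x y, f x = f y ↔ g x = g y) (s : Set α) : (f '' s).encard = (g '' s).encard := by
  obtain ⟨s', hs', hf⟩ := Set.exists_subset_bijOn s f
  have hg : Set.BijOn g s' (g '' s) := by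
    refine ⟨fun x hx => ⟨x, hs' hx, rfl⟩, fun x hx y hy hxy => hf.injOn hx hy ((h x y).2 hxy), ?_⟩
    rintro _ ⟨x, hx, rfl⟩
    obtain ⟨y, hy, hxy⟩ := hf.surjOn ⟨x, hx, rfl⟩
    exact ⟨y, hy, (h y x).1 hxy⟩
  rw [← hf.image_eq, ← hg.image_eq, hf.injOn.encard_image, hg.injOn.encard_image]

/-- The variable `e ^ {2inz}` separates exactly the points that differ modulo `π / n`. -/
theorem exp_pow_eq_iff (n : ℕ) [NeZero n] (z z' : ℂ) :
    (z : ℂ ⧸ AddSubgroup.zmultiples ((Real.pi : ℂ) / (n : ℂ))) = z' ↔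
      Complex.exp (2 * z * Complex.I) ^ n = Complex.exp (2 * z' * Complex.I) ^ n := by
  have hn : (n : ℂ) ≠ 0 := Nat.cast_ne_zero.2 (NeZero.ne n)
  have hpi : (Real.pi : ℂ) ≠ 0 := by exact_mod_cast Real.pi_ne_zero
  rw [QuotientAddGroup.eq, AddSubgroup.mem_zmultiples_iff, eq_comm (a := Complex.exp _ ^ n),
    ← Complex.exp_nat_mul, ← Complex.exp_nat_mul, Complex.exp_eq_exp_iff_exists_int]
  refine exists_congr fun k => ?_
  rw [zsmul_eq_mul]
  constructor
  · intro h
    have : z' = z + k * (Real.pi / n) := by rw [h]; ring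
    rw [this]
    field_simp
  · intro h
    have : (2 * n * Complex.I) * (z' - z - k * (Real.pi / n)) = 0 := by
      field_simp
      linear_combination h
    have h2 := (mul_eq_zero.1 this).resolve_left (by simp [hn])
    linear_combination -h2

include hq in
theorem numSimpleZeros_vacuumSym (hodd : Odd n) {N : ℕ} (hN : n ∣ N) (μ : Fin N → ℂ) :
    numSimpleZeros n (vacuumSym n η μ) =
      ({x | (zeroPoly n μ).eval x = 0 ∧ (zeroPoly n μ).derivative.eval x ≠ 0} : Set ℂ).encard := by
  rw [numSimpleZeros, encard_image_eq_of_kernel_eq (exp_pow_eq_iff n)]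
  congr 1
  ext x
  simp only [Set.mem_image, Set.mem_ofPred_eq, analyticOrderAt_vacuumSym_eq_one_iff]
  constructor
  · rintro ⟨z, ⟨hz, hz'⟩, rfl⟩
    exact ⟨(vacuumSym_eq_zero_iff hq hodd hN μ z).1 hz,
      (deriv_vacuumSym_ne_zero_iff hq hodd hN μ hz).1 hz'⟩
  · rintro ⟨hx, hx'⟩
    have hx0 : x ≠ 0 := by
      rintro rfl
      exact eval_zero_zeroPoly (NeZero.ne n) μ hx
    obtain ⟨a, rfl⟩ := exists_exp_pow_eq n hx0
    obtain ⟨z, rfl⟩ : ∃ z, a = 2 * z := ⟨a / 2, by ring⟩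
    have hz := (vacuumSym_eq_zero_iff hq hodd hN μ z).2 hx
    exact ⟨z, ⟨hz, (deriv_vacuumSym_ne_zero_iff hq hodd hN μ hz).2 hx'⟩, rfl⟩

/-- The number of simple roots equals the degree if and only if there are no multiple roots. -/
theorem encard_simple_roots_eq_iff {P : ℂ[X]} (hP : P ≠ 0) :
    ({x | P.eval x = 0 ∧ P.derivative.eval x ≠ 0} : Set ℂ).encard = (P.natDegree : ℕ∞) ↔
      ∀ x, P.eval x = 0 → P.derivative.eval x ≠ 0 := by
  classical
  have hset : ({x | P.eval x = 0 ∧ P.derivative.eval x ≠ 0} : Set ℂ) =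
      ↑(P.roots.toFinset.filter fun x => P.derivative.eval x ≠ 0) := by
    ext x
    simp [hP]
  rw [hset, Set.encard_coe_eq_coe_finsetCard, ENat.natCast_inj, (IsAlgClosed.splits P).natDegree_eq_card_roots]
  have h₁ := Finset.card_filter_le P.roots.toFinset fun x => P.derivative.eval x ≠ 0
  have h₂ := P.roots.toFinset_card_le
  constructor
  · intro h x hx
    have heq : P.roots.toFinset.filter (fun x => P.derivative.eval x ≠ 0) = P.roots.toFinset :=
      Finset.eq_of_subset_of_card_le (Finset.filter_subset _ _) (by omega)
    have : x ∈ P.roots.toFinset := by simpa [hP] using hx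
    rw [← heq, Finset.mem_filter] at this
    exact this.2
  · intro h
    rw [Finset.filter_true_of_mem, Multiset.toFinset_card_of_nodup]
    · rw [Multiset.nodup_iff_count_le_one]
      intro x
      rw [count_roots]
      by_contra! hx
      obtain ⟨h₁, h₂⟩ := (one_lt_rootMultiplicity_iff_isRoot hP).1 hx
      exact h x h₁ h₂
    · intro x hx
      exact h x (by simpa [hP] using hx)

theorem zeroPoly_ne_zero (n : ℕ) [NeZero n] {N : ℕ} (μ : Fin N → ℂ) : zeroPoly n μ ≠ 0 := by
  intro h
  have := eval_zero_zeroPoly (NeZero.ne n) μ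
  simp [h] at this

include hq in
/-- The number of simple zeros is maximal if and only if all zeros are simple. -/
theorem numSimpleZeros_eq_iff (hodd : Odd n) {N : ℕ} (hN : n ∣ N) (μ : Fin N → ℂ) :
    numSimpleZeros n (vacuumSym n η μ) = ((N / n : ℕ) : ℕ∞) ↔
      ∀ x, (zeroPoly n μ).eval x = 0 → (zeroPoly n μ).derivative.eval x ≠ 0 := by
  rw [numSimpleZeros_vacuumSym hq hodd hN, ← natDegree_zeroPoly (NeZero.ne n) hN μ,
    encard_simple_roots_eq_iff (zeroPoly_ne_zero n μ)]

end ZeroPolynomial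

/-! ### The homogeneous chain -/

section Homogeneous

open Polynomial

/-- A positivity argument: iterating `u_k ↦ u_k + u_{k+1}` on a sequence that is quasi-periodic with
respect to an operator `y` preserves the positivity of an antisymmetric form `ω` on pairs of members
at distance at most one period, provided that `ω (y v) v` is nonnegative. -/
theorem antisymm_pos_of_pascal {V : Type*} [Add V] {n : ℕ} (hn : 1 < n) (ω : V → V → ℝ) (y : V → V)
    (hadd : ∀ v v' w, ω (v + v') w = ω v w + ω v' w)
    (hadd' : ∀ v w w', ω v (w + w') = ω v w + ω v w') (hself : ∀ v, ω v v = 0)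
    (hy : ∀ v, 0 ≤ ω (y v) v) (u : ℕ → ℕ → V) (hu : ∀ N k, u (N + 1) k = u N k + u N (k + 1))
    (hper : ∀ N k, u N (k + n) = y (u N k))
    (h₀ : ∀ a b, a < b → b < a + n → ω (u 0 b) (u 0 a) = 0)
    (h₁ : 0 < ω (u 0 (n - 1 + n)) (u 0 (n - 1))) (N : ℕ) :
    0 < ω (u (N + 1) (n - 1 + n - 1)) (u (N + 1) (n - 1)) := by
  have hstep (N a b : ℕ) : ω (u (N + 1) b) (u (N + 1) a) = ω (u N b) (u N a) +
      ω (u N (b + 1)) (u N (a + 1)) + ω (u N (b + 1)) (u N a) + ω (u N b) (u N (a + 1)) := by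
    rw [hu, hu, hadd, hadd', hadd']
    ring
  have hnonneg (N : ℕ) : ∀ a b, a ≤ b → b ≤ a + n → 0 ≤ ω (u N b) (u N a) := by
    induction N with
    | zero =>
      intro a b hab hba
      rcases hab.eq_or_lt with rfl | hab
      · rw [hself]
      · rcases hba.eq_or_lt with rfl | hba
        · rw [hper]; exact hy _
        · rw [h₀ a b hab hba]
    | succ N ih =>
      intro a b hab hba
      rcases hab.eq_or_lt with rfl | hab
      · rw [hself]
      · rcases hba.eq_or_lt with rfl | hba
        · rw [hper]; exact hy _
        · rw [hstep]
          have := ih a b (by omega) (by omega)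
          have := ih (a + 1) (b + 1) (by omega) (by omega)
          have := ih a (b + 1) (by omega) (by omega)
          have := ih (a + 1) b (by omega) (by omega)
          positivity
  have hlast (N : ℕ) (h : 0 < ω (u N (n - 1 + n)) (u N (n - 1)) ∨
      0 < ω (u N (n - 1 + n - 1)) (u N (n - 1))) :
      0 < ω (u (N + 1) (n - 1 + n - 1)) (u (N + 1) (n - 1)) := by
    rw [hstep, show n - 1 + n - 1 + 1 = n - 1 + n by omega]
    have := hnonneg N (n - 1) (n - 1 + n - 1) (by omega) (by omega)
    have := hnonneg N (n - 1 + 1) (n - 1 + n) (by omega) (by omega)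
    have := hnonneg N (n - 1) (n - 1 + n) (by omega) (by omega)
    have := hnonneg N (n - 1 + 1) (n - 1 + n - 1) (by omega) (by omega)
    rcases h with h | h <;> linarith
  induction N with
  | zero => exact hlast 0 (Or.inl h₁)
  | succ N ih => exact hlast (N + 1) (Or.inr ih)

/-- The polynomials `∑_l choose N (n (l + 1) - 1 - k) X ^ l`, generated by Pascal's rule. -/
noncomputable def pascalPoly (n : ℕ) : ℕ → ℕ → ℝ[X]
  | 0, k => if n ∣ k + 1 then X ^ ((k + 1) / n - 1) else 0
  | N + 1, k => pascalPoly n N k + pascalPoly n N (k + 1)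

/-- The Pascal scheme is quasi-periodic: a shift of the index by `n` is multiplication by `X`. -/
theorem pascalPoly_add {n : ℕ} (hn : 1 < n) (N : ℕ) : ∀ k,
    pascalPoly n N (k + n) = X * pascalPoly n N k := by
  induction N with
  | zero =>
    intro k
    have hdvd : n ∣ k + n + 1 ↔ n ∣ k + 1 := by
      rw [show k + n + 1 = k + 1 + n by ring, Nat.dvd_add_self_right]
    simp only [pascalPoly, hdvd]
    split_ifs with h
    · rw [← pow_succ', show k + n + 1 = k + 1 + n by ring, Nat.add_div_right _ (by omega),
        Nat.succ_sub_one, Nat.sub_add_cancel (Nat.div_pos (Nat.le_of_dvd (by omega) h) (by omega))]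
    · rw [mul_zero]
  | succ N ih =>
    intro k
    rw [pascalPoly, pascalPoly, ih, show k + n + 1 = k + 1 + n by ring, ih, mul_add]

theorem coeff_pascalPoly {n : ℕ} (hn : 1 < n) (N : ℕ) : ∀ k l, (pascalPoly n N k).coeff l =
    if k + 1 ≤ n * (l + 1) then (N.choose (n * (l + 1) - 1 - k) : ℝ) else 0 := by
  induction N with
  | zero =>
    intro k l
    rw [pascalPoly]
    by_cases hk : n ∣ k + 1
    · obtain ⟨q, hq⟩ := hk
      obtain ⟨q, rfl⟩ : ∃ r, q = r + 1 := Nat.exists_eq_succ_of_ne_zero (by rintro rfl; omega)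
      rw [hq, if_pos (Dvd.intro _ rfl), Nat.mul_div_cancel_left _ (by omega), Nat.add_sub_cancel,
        coeff_X_pow]
      by_cases hl : l = q
      · subst hl
        rw [if_pos rfl, if_pos le_rfl, show n * (l + 1) - 1 - k = 0 by omega]
        simp
      · rw [if_neg hl]
        split_ifs with h
        · have hlt : n * (q + 1) < n * (l + 1) :=
            lt_of_le_of_ne h fun h' => hl (by have := Nat.eq_of_mul_eq_mul_left (by omega) h'; omega)
          rw [Nat.choose_eq_zero_of_lt (by omega), Nat.cast_zero]
        · rfl
    · rw [if_neg hk, coeff_zero]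
      split_ifs with h
      · have hlt : k + 1 < n * (l + 1) := lt_of_le_of_ne h fun h' => hk ⟨_, h'⟩
        rw [Nat.choose_eq_zero_of_lt (by omega), Nat.cast_zero]
      · rfl
  | succ N ih =>
    intro k l
    rw [pascalPoly, coeff_add, ih, ih]
    by_cases h : k + 1 + 1 ≤ n * (l + 1)
    · rw [if_pos h, if_pos (by omega), if_pos (by omega)]
      obtain ⟨m, hm⟩ : ∃ m, n * (l + 1) = m + k + 2 := ⟨n * (l + 1) - k - 2, by omega⟩
      rw [hm, show m + k + 2 - 1 - k = m + 1 by omega, show m + k + 2 - 1 - (k + 1) = m by omega,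
        Nat.choose_succ_succ]
      push_cast
      ring
    · rw [if_neg h]
      by_cases h' : k + 1 ≤ n * (l + 1)
      · rw [if_pos h', if_pos h', show n * (l + 1) - 1 - k = 0 by omega]
        simp
      · rw [if_neg h', if_neg h', add_zero]

theorem pascalPoly_eq_contract {n : ℕ} (hn : 1 < n) (N : ℕ) :
    pascalPoly n N (n - 1) = contract n ((X + 1) ^ N) := by
  ext l
  rw [coeff_pascalPoly hn, coeff_contract (by omega), coeff_X_add_one_pow,
    if_pos (by have := Nat.le_mul_of_pos_right n (show 0 < l + 1 by omega); omega)]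
  congr 2
  rw [mul_add, mul_one, mul_comm l n]
  omega

/-- In the initial row of the Pascal scheme only every `n`-th entry is nonzero. -/
theorem pascalPoly_zero {n : ℕ} {a b : ℕ} (hab : a < b) (hba : b < a + n) :
    pascalPoly n 0 a = 0 ∨ pascalPoly n 0 b = 0 := by
  by_contra! h
  simp only [pascalPoly, ne_eq, ite_eq_right_iff, not_forall, exists_prop] at h
  have := (Nat.dvd_sub h.2.1 h.1.1)
  have := Nat.le_of_dvd (by omega) this
  omega

/-- All zeros of the section `∑_l choose N (n l) X ^ l` of a binomial are simple: off the real axis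
the form `Im (v * conj w)` shows that there are no zeros, and on the real axis the Wronskian of two
members of the Pascal scheme does the same for common zeros with the derivative. -/
theorem contract_binomial_simple {n : ℕ} (hn : 1 < n) (N : ℕ) (x : ℂ)
    (hx : (contract n ((X + 1) ^ N : ℂ[X])).eval x = 0) :
    (contract n ((X + 1) ^ N : ℂ[X])).derivative.eval x ≠ 0 := by
  have hmap : contract n ((X + 1) ^ N : ℂ[X]) = (pascalPoly n N (n - 1)).map (algebraMap ℝ ℂ) := by
    rw [pascalPoly_eq_contract hn, map_contract (by omega)]
    simp
  have hbase : pascalPoly n 0 (n - 1) = 1 := by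
    have : n - 1 + 1 = n := by omega
    simp [pascalPoly, this, Nat.div_self (show 0 < n by omega)]
  rcases N with _ | N
  · rw [hmap, hbase] at hx
    simp at hx
  rw [hmap, eval_map_algebraMap] at hx
  rw [hmap, derivative_map, eval_map_algebraMap]
  -- off the real axis, `Im x * Im (v * conj w)` is positive on a pair with `w` the value at `x`
  have him : x.im = 0 := by
    by_contra him
    have key := antisymm_pos_of_pascal hn (fun v w : ℂ => x.im * (v * (starRingEnd ℂ) w).im)
      (fun v => x * v) (fun v v' w => by simp only [add_mul, Complex.add_im, mul_add])
      (fun v w w' => by simp only [map_add, mul_add, Complex.add_im])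
      (fun v => by simp [Complex.mul_conj])
      (fun v => by
        rw [mul_assoc, Complex.mul_conj, Complex.im_mul_ofReal, ← mul_assoc]
        exact mul_nonneg (mul_self_nonneg _) (Complex.normSq_nonneg _))
      (fun N k => aeval x (pascalPoly n N k)) (fun N k => by simp only [pascalPoly, map_add])
      (fun N k => by simp only [pascalPoly_add hn, map_mul, aeval_X])
      (fun a b hab hba => by
        rcases pascalPoly_zero hab hba with h | h <;> simp [h])
      (by
        simp only [pascalPoly_add hn, hbase]
        simpa using him) N
    simp only [hx, map_zero, mul_zero, Complex.zero_im] at key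
    exact lt_irrefl _ key
  obtain ⟨r, rfl⟩ : ∃ r : ℝ, x = r := ⟨x.re, Complex.ext rfl (by simpa using him)⟩
  have haeval (P : ℝ[X]) : aeval (r : ℂ) P = ((P.eval r : ℝ) : ℂ) := by
    rw [← Complex.coe_algebraMap, aeval_algebraMap_apply]
    simp
  rw [haeval] at hx ⊢
  intro hx'
  have hx : (pascalPoly n (N + 1) (n - 1)).eval r = 0 := by exact_mod_cast hx
  have hx' : (derivative (pascalPoly n (N + 1) (n - 1))).eval r = 0 := by exact_mod_cast hx'
  -- at a real zero, the same holds for the Wronskian, with `w` the value and the derivative at `r`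
  have key := antisymm_pos_of_pascal hn (fun v w : ℝ × ℝ => v.2 * w.1 - v.1 * w.2)
    (fun v => (r * v.1, v.1 + r * v.2)) (fun v v' w => by simp only [Prod.fst_add, Prod.snd_add]; ring)
    (fun v w w' => by simp only [Prod.fst_add, Prod.snd_add]; ring)
    (fun v => by ring) (fun v => by
      ring_nf
      exact sq_nonneg _)
    (fun N k => ((pascalPoly n N k).eval r, (derivative (pascalPoly n N k)).eval r))
    (fun N k => by simp [pascalPoly])
    (fun N k => by simp [pascalPoly_add hn])
    (fun a b hab hba => by rcases pascalPoly_zero hab hba with h | h <;> simp [h])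
    (by
      simp only [pascalPoly_add hn, hbase]
      simp) N
  simp only [hx, hx', mul_zero, sub_zero] at key
  exact lt_irrefl _ key

end Homogeneous

/-! ### Generic inhomogeneities -/

section Generic

open Polynomial

variable {n : ℕ} [NeZero n] {η : ℂ} (hq : IsPrimitiveRoot (Complex.exp (2 * η * Complex.I)) n)

include hq in
theorem numSimpleZeros_eq_iff_deriv (hodd : Odd n) {N : ℕ} (hN : n ∣ N) (μ : Fin N → ℂ) :
    numSimpleZeros n (vacuumSym n η μ) = ((N / n : ℕ) : ℕ∞) ↔
      ∀ z, vacuumSym n η μ z = 0 → deriv (vacuumSym n η μ) z ≠ 0 := by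
  rw [numSimpleZeros_eq_iff hq hodd hN]
  constructor
  · intro h z hz
    exact (deriv_vacuumSym_ne_zero_iff hq hodd hN μ hz).2
      (h _ ((vacuumSym_eq_zero_iff hq hodd hN μ z).1 hz))
  · intro h x hx
    have hx0 : x ≠ 0 := by
      rintro rfl
      exact eval_zero_zeroPoly (NeZero.ne n) μ hx
    obtain ⟨a, rfl⟩ := exists_exp_pow_eq n hx0
    obtain ⟨z, rfl⟩ : ∃ z, a = 2 * z := ⟨a / 2, by ring⟩
    have hz := (vacuumSym_eq_zero_iff hq hodd hN μ z).2 hx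
    exact (deriv_vacuumSym_ne_zero_iff hq hodd hN μ hz).1 (h z hz)

/-- For the homogeneous chain the zeros may be studied at `μ_i = π / 2`, where `chainPoly` is a
multiple of `(X + 1) ^ N`. -/
theorem zeroPoly_pi_div_two (n : ℕ) [NeZero n] (N : ℕ) :
    zeroPoly n (fun _ : Fin N => ((Real.pi : ℂ) / 2)) =
      C (Complex.I ^ N) * contract n ((X + 1) ^ N : ℂ[X]) := by
  have h : chainPoly (fun _ : Fin N => ((Real.pi : ℂ) / 2)) =
      C (Complex.I ^ N) * ((X + 1) ^ N : ℂ[X]) := by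
    rw [chainPoly, Finset.prod_const, Finset.card_univ, Fintype.card_fin, expI_neg,
      Complex.exp_pi_div_two_mul_I, Complex.inv_I, C_neg, sub_neg_eq_add, C_pow, ← mul_pow, mul_add,
      mul_one]
  rw [zeroPoly, h]
  ext l
  rw [coeff_contract (NeZero.ne n), coeff_C_mul, coeff_C_mul, coeff_contract (NeZero.ne n)]

include hq in
/-- For the homogeneous chain the number of simple zeros is maximal. -/
theorem numSimpleZeros_homogeneous (hodd : Odd n) (hn : 1 < n) {N : ℕ} (hN : n ∣ N) (c : ℂ) :
    numSimpleZeros n (vacuumSym n η fun _ : Fin N => c) = ((N / n : ℕ) : ℕ∞) := by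
  have h₀ : numSimpleZeros n (vacuumSym n η fun _ : Fin N => ((Real.pi : ℂ) / 2)) =
      ((N / n : ℕ) : ℕ∞) := by
    rw [numSimpleZeros_eq_iff hq hodd hN, zeroPoly_pi_div_two]
    intro x hx
    rw [eval_C_mul, mul_eq_zero, or_iff_right (pow_ne_zero _ Complex.I_ne_zero)] at hx
    rw [derivative_C_mul, eval_C_mul]
    exact mul_ne_zero (pow_ne_zero _ Complex.I_ne_zero) (contract_binomial_simple hn N x hx)
  rw [numSimpleZeros_eq_iff_deriv hq hodd hN] at h₀ ⊢
  have hshift : (vacuumSym n η fun _ : Fin N => c) = fun z =>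
      vacuumSym n η (fun _ : Fin N => ((Real.pi : ℂ) / 2)) (z + (c - Real.pi / 2)) := by
    funext z
    refine Finset.sum_congr rfl fun k _ => Finset.prod_congr rfl fun i _ => congrArg Complex.sin ?_
    ring
  rw [hshift]
  intro z hz
  rw [deriv_comp_add_const]
  exact h₀ _ hz

/-- All roots are simple if and only if the resultant with the derivative, of the sizes given by the
degree, does not vanish. -/
theorem simple_iff_resultant_ne_zero {P : ℂ[X]} (hP : P ≠ 0) :
    (∀ x, P.eval x = 0 → P.derivative.eval x ≠ 0) ↔
      resultant P P.derivative P.natDegree (P.natDegree - 1) ≠ 0 := by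
  have hd : P.natDegree - 1 = P.derivative.natDegree := (natDegree_derivative P).symm
  rw [hd, ne_eq, resultant_eq_zero_iff, not_and_not_right]
  simp only [hP, ne_eq, not_false_eq_true, true_or, true_imp_iff]
  rw [isCoprime_iff_aeval_ne_zero_of_isAlgClosed ℂ ℂ]
  simp only [coe_aeval_eq_eval]
  exact forall_congr' fun x => by tauto

theorem differentiable_coeff_chainPoly {N : ℕ} (l : ℕ) :
    Differentiable ℂ fun μ : Fin N → ℂ => (chainPoly μ).coeff l := by
  have key : ∀ (s : Finset (Fin N)) (l : ℕ), Differentiable ℂ fun μ : Fin N → ℂ =>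
      (∏ i ∈ s, (C (Complex.exp (μ i * Complex.I)) * X -
        C (Complex.exp (-μ i * Complex.I)))).coeff l := by
    intro s
    induction s using Finset.induction_on with
    | empty => intro l; simp
    | insert a s ha ih =>
      intro l
      simp only [Finset.prod_insert ha, coeff_mul]
      refine Differentiable.fun_sum fun p _ => Differentiable.mul ?_ (ih p.2)
      simp only [coeff_sub, coeff_C_mul, coeff_X, coeff_C]
      split_ifs <;> fun_prop
  exact key Finset.univ l

theorem differentiable_coeff_zeroPoly (n : ℕ) [NeZero n] {N : ℕ} (l : ℕ) :
    Differentiable ℂ fun μ : Fin N → ℂ => (zeroPoly n μ).coeff l := by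
  simp only [zeroPoly, coeff_contract (NeZero.ne n)]
  exact differentiable_coeff_chainPoly _

/-- The resultant of two polynomials depends holomorphically on parameters of their coefficients. -/
theorem differentiable_resultant {X : Type*} [NormedAddCommGroup X] [NormedSpace ℂ X]
    {f g : X → ℂ[X]} (hf : ∀ l, Differentiable ℂ fun x => (f x).coeff l)
    (hg : ∀ l, Differentiable ℂ fun x => (g x).coeff l) (a b : ℕ) :
    Differentiable ℂ fun x => resultant (f x) (g x) a b := by
  simp only [resultant, Matrix.det_apply]
  refine Differentiable.fun_sum fun σ _ => Differentiable.const_smul ?_ _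
  have hprod : ∀ (s : Finset (Fin (a + b))) (F : Fin (a + b) → X → ℂ),
      (∀ i, Differentiable ℂ (F i)) → Differentiable ℂ fun x => ∏ i ∈ s, F i x := by
    intro s F hF
    induction s using Finset.induction_on with
    | empty => simp
    | insert i s hi ih =>
      simp only [Finset.prod_insert hi]
      exact (hF i).mul ih
  refine hprod Finset.univ _ fun i => ?_
  simp only [sylvester, Matrix.of_apply]
  generalize σ i = k
  refine Fin.addCases (fun j => ?_) (fun j => ?_) i
  · simp only [Fin.addCases_left]
    split_ifs
    · exact hg _
    · exact differentiable_const _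
  · simp only [Fin.addCases_right]
    split_ifs
    · exact hf _
    · exact differentiable_const _

include hq in
/-- The condition that the number of simple zeros is maximal, expressed by the nonvanishing of a
holomorphic function of the inhomogeneities. -/
theorem exists_differentiable_numSimpleZeros_eq_iff (hodd : Odd n) {N : ℕ} (hN : n ∣ N) :
    ∃ D : (Fin N → ℂ) → ℂ, Differentiable ℂ D ∧ ∀ μ,
      numSimpleZeros n (vacuumSym n η μ) = ((N / n : ℕ) : ℕ∞) ↔ D μ ≠ 0 := by
  refine ⟨fun μ => resultant (zeroPoly n μ) (zeroPoly n μ).derivative (N / n) (N / n - 1),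
    differentiable_resultant (differentiable_coeff_zeroPoly n) (fun l => ?_) _ _, fun μ => ?_⟩
  · simp only [coeff_derivative]
    exact (differentiable_coeff_zeroPoly n _).mul_const _
  · rw [numSimpleZeros_eq_iff hq hodd hN, simple_iff_resultant_ne_zero (zeroPoly_ne_zero n μ),
      natDegree_zeroPoly (NeZero.ne n) hN]

/-- The complement of the zero set of a holomorphic function that is not identically zero is
dense. -/
theorem dense_setOf_ne_zero {X : Type*} [NormedAddCommGroup X] [NormedSpace ℂ X] {D : X → ℂ}
    (hD : Differentiable ℂ D) {x₀ : X} (h₀ : D x₀ ≠ 0) : Dense {x | D x ≠ 0} := by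
  intro x
  set γ : ℂ → X := fun t => x₀ + t • (x - x₀) with hγ
  have hγ₁ : γ 1 = x := by simp [hγ]
  have hγd : Differentiable ℂ γ := by fun_prop
  have han : AnalyticOnNhd ℂ (D ∘ γ) Set.univ :=
    (hD.comp hγd).differentiableOn.analyticOnNhd isOpen_univ
  have hev : ∀ᶠ t in nhdsWithin 1 {1}ᶜ, D (γ t) ≠ 0 := by
    rcases (han 1 trivial).eventually_eq_zero_or_eventually_ne_zero with h | h
    · have := han.eqOn_zero_of_preconnected_of_eventuallyEq_zero isPreconnected_univ
        (Set.mem_univ 1) h (Set.mem_univ 0)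
      simp [hγ, h₀] at this
    · exact h
  have ht : Filter.Tendsto γ (nhdsWithin 1 {1}ᶜ) (nhds x) := by
    have := (hγd.continuous.tendsto 1).mono_left (nhdsWithin_le_nhds (s := {1}ᶜ))
    rwa [hγ₁] at this
  exact mem_closure_of_tendsto ht hev

include hq in
/-- Each simple zero of the vacuum eigenvalue of `T₀`, counted modulo `π / n`, contributes a
factor `2` to the degeneracy. -/
theorem two_pow_dvd_of_numSimpleZeros (hodd : Odd n) {N M : ℕ} (μ : Fin N → ℂ)
    (h : numSimpleZeros n (vacuumSym n η μ) = (M : ℕ∞)) :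
    2 ^ M ∣ Module.finrank ℂ
      (eigenspaceOf (transferMatrix (sixVertexL η) μ) (vacuumSix η μ)) := by
  rw [numSimpleZeros] at h
  set S := (fun z : ℂ => (z : ℂ ⧸ AddSubgroup.zmultiples ((Real.pi : ℂ) / (n : ℂ)))) ''
    {z : ℂ | analyticOrderAt (vacuumSym n η μ) z = 1} with hS
  have hfin : S.Finite := Set.finite_of_encard_eq_coe h
  have hcard : hfin.toFinset.card = M := by
    rw [hfin.encard_eq_coe_toFinset_card] at h
    exact_mod_cast h
  let e : Fin M ≃ hfin.toFinset := (finCongr hcard.symm).trans hfin.toFinset.equivFin.symm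
  have hmem (i : Fin M) : ∃ z : ℂ, analyticOrderAt (vacuumSym n η μ) z = 1 ∧
      (z : ℂ ⧸ AddSubgroup.zmultiples ((Real.pi : ℂ) / (n : ℂ))) = e i := by
    have := (e i).2
    rwa [Set.Finite.mem_toFinset] at this
  choose z hz hze using hmem
  refine two_pow_dvd_finrank_eigenspaceOf hq hodd μ z
    (fun i => ((analyticOrderAt_vacuumSym_eq_one_iff μ _).1 (hz i)).1)
    (fun i => ((analyticOrderAt_vacuumSym_eq_one_iff μ _).1 (hz i)).2) fun i j hij h => hij ?_
  refine e.injective (Subtype.ext ?_)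
  rw [← hze, ← hze, exp_pow_eq_iff]
  have h2 : Complex.exp (2 * (z j - z i) * Complex.I) ^ n = 1 := by
    rw [← h, expI_two, ← pow_two, ← pow_mul, ← pow_mul, mul_comm 2 n]
  rw [show 2 * z j = 2 * z i + 2 * (z j - z i) by ring, expI_add, mul_pow, h2, mul_one]

end Generic

end SixVertex

theorem mainTheorem2 (n N : ℕ) (m : ℤ) (hodd : Odd n) (hn : 1 < n)
    (hmn : IsCoprime m (n : ℤ)) (hN : n ∣ N) (η : ℂ)
    (hη : η = (m : ℂ) * (Real.pi : ℂ) / (n : ℂ)) :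
    ∃ Λ w₀ : (Fin N → ℂ) → ℂ → ℂ,
      -- the naked vacuum is an eigenvector of the 6-vertex transfer matrix and of `T₀`
      SixVertex.nakedVacuum N ≠ 0 ∧
      (∀ μ z, (SixVertex.transferMatrix (SixVertex.sixVertexL η) μ z).mulVec
          (SixVertex.nakedVacuum N) = Λ μ z • SixVertex.nakedVacuum N) ∧
      (∀ μ z, (SixVertex.transferMatrix (SixVertex.symPowerL n η) μ z).mulVec
          (SixVertex.nakedVacuum N) = w₀ μ z • SixVertex.nakedVacuum N) ∧
      -- `T₀` acts as the scalar `w₀` in the eigenspace of the 6-vertex transfer matrix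
      (∀ μ, ∀ v ∈ SixVertex.eigenspaceOf
            (SixVertex.transferMatrix (SixVertex.sixVertexL η) μ) (Λ μ),
          ∀ z, (SixVertex.transferMatrix (SixVertex.symPowerL n η) μ z).mulVec v = w₀ μ z • v) ∧
      -- homogeneous chain
      (∀ c : ℂ,
        SixVertex.numSimpleZeros n (w₀ fun _ => c) = ((N / n : ℕ) : ℕ∞) ∧
        2 ^ (N / n) ∣ Module.finrank ℂ (SixVertex.eigenspaceOf
          (SixVertex.transferMatrix (SixVertex.sixVertexL η) (fun _ : Fin N => c))
          (Λ fun _ => c))) ∧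
      -- inhomogeneous chain
      IsOpen {μ | SixVertex.numSimpleZeros n (w₀ μ) = ((N / n : ℕ) : ℕ∞)} ∧
      Dense {μ | SixVertex.numSimpleZeros n (w₀ μ) = ((N / n : ℕ) : ℕ∞)} ∧
      (∀ μ, SixVertex.numSimpleZeros n (w₀ μ) = ((N / n : ℕ) : ℕ∞) →
        2 ^ (N / n) ∣ Module.finrank ℂ (SixVertex.eigenspaceOf
          (SixVertex.transferMatrix (SixVertex.sixVertexL η) μ) (Λ μ))) := by
  have hn0 : n ≠ 0 := by omega
  have : NeZero n := ⟨hn0⟩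
  have hq : IsPrimitiveRoot (Complex.exp (2 * η * Complex.I)) n := by
    have h := Complex.isPrimitiveRoot_exp n hn0
    have h' := h.zpow_of_gcd_eq_one m (Int.isCoprime_iff_gcd_eq_one.1 hmn)
    rwa [← Complex.exp_int_mul, show (m : ℂ) * (2 * Real.pi * Complex.I / n) = 2 * η * Complex.I by
      rw [hη]; ring] at h'
  have hvac (μ : Fin N → ℂ) : SixVertex.nakedVacuum N ∈ SixVertex.eigenspaceOf
      (SixVertex.transferMatrix (SixVertex.sixVertexL η) μ) (SixVertex.vacuumSix η μ) :=
    SixVertex.sixVertex_mulVec_nakedVacuum η μ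
  obtain ⟨D, hD, hiff⟩ := SixVertex.exists_differentiable_numSimpleZeros_eq_iff hq hodd hN
  have hset : {μ : Fin N → ℂ | SixVertex.numSimpleZeros n (SixVertex.vacuumSym n η μ) =
      ((N / n : ℕ) : ℕ∞)} = {μ | D μ ≠ 0} := Set.ext hiff
  refine ⟨SixVertex.vacuumSix η, SixVertex.vacuumSym n η, SixVertex.nakedVacuum_ne_zero N,
    hvac, fun μ z => SixVertex.symPowerL_mulVec_of_mem hq μ (hvac μ) z,
    fun μ v hv z => SixVertex.symPowerL_mulVec_of_mem hq μ hv z, fun c => ?_, ?_, ?_,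
    fun μ => SixVertex.two_pow_dvd_of_numSimpleZeros hq hodd μ⟩
  · have h := SixVertex.numSimpleZeros_homogeneous hq hodd hn hN c
    exact ⟨h, SixVertex.two_pow_dvd_of_numSimpleZeros hq hodd _ h⟩
  · rw [hset]
    exact isOpen_ne_fun hD.continuous continuous_const
  · rw [hset]
    exact SixVertex.dense_setOf_ne_zero hD
      ((hiff _).1 (SixVertex.numSimpleZeros_homogeneous hq hodd hn hN 0))
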